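/- **Setting.** A *pointed indexing category* is a small connected category $J$ with finite hom-sets and a degree function $|\cdot|:\mathrm{Ob}\,J\to\mathbb N$ such that there are finitely many objects in each degree, every non-identity map strictly lowers degree, and every object maps to one of degree $0$; together with a class $\overline{J}$ of *null* maps which is closed under composition with arbitrary maps on either side and contains $\mathrm{Id}_x$ if and only if $x$ is a zero object. Write $\widetilde J$ for the class of non-null maps. $J$ is *fully reduced* if every map lowering degree by at least $2$ is null. Let $\mathcal E$ be a model category with a zero object $*$. A diagram is *pointed* if it sends null maps to $0$. Its *reduced matching object* $\overline M_s$ at $s$ consists of the families $(y_f)\in\prod_{f:s\to t,\ f\in\widetilde J,\ |t|<|s|}Y(t)$ which are compatible under the maps of the diagram once $y_f:=0$ for null $f$; the diagram is *pointed Reedy fibrant* if all the maps $Y(s)\to\overline M_s$ are fibrations. Let $J$ be fully reduced, $x\in J$, $2\le k<|x|$, and let $Y$ be a pointed Reedy fibrant diagram in $\mathcal E$ on the full subcategory of objects $t$ with $|t|\le k$ and $J(x,t)\ne\emptyset$. *Data at $x$* consist of a cofibrant object $X$ and a strict pointed extension of $Y$ restricted to degrees $<k$ to $x$, with value $X$ at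 $x$, together with maps $\sigma_f:X\to Y(s)$, for $f:x\to s$ in $\widetilde J$ with $|s|=k$, which extend it to a homotopy commutative diagram. Homotopy of maps means left homotopy. **Total operation.** Factor the reduced generalized diagonal $$\overline\Psi:\prod_{f:x\to t,\,f\in\widetilde J,\,|t|<k}Y(t)\longrightarrow C:=\prod_{f:x\to s,\,f\in\widetilde J,\,|s|=k}\ \prod_{g:s\to v,\,g\in\widetilde J,\,|v|<k}Y(v)$$ (whose coordinate at $(f,g)$ is the projection to the coordinate $gf$, or $0$ if $gf$ is null) as a weak equivalence $\iota$ to $F^1$ followed by a fibration $F^1\to C$, and put $F^2=F^1\times_C\prod_f\overline M_s$, $\overline Q=\big(\prod_{|t|<k} Y(t)\big)\times_C\prod_f\overline M_s$. The *total pointed higher homotopy operation* is the set of homotopy classes of maps $\theta:X\to F^2$ whose image in $C$ is the one given by $(\sigma_f)$ and whose image in $F^1$ is homotopic to $\iota$ composed with the map given by the strict extension. It *vanishes* if it contains the class of the composite $X\to\overline Q\to F^2$ given by the strict extension. **Separation grid.** For $z=x$ (regarded as an object of degree $k+1$), and for each object $z$ of the diagram of degree $d=|z|\ge1$, let $F_z^{j,i}$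 (column $0\le j<d$, row $\max(1,j)\le i\le d$) be a grid with maps $F_z^{j+1,i}\to F_z^{j,i}$ and $F_z^{j,i+1}\to F_z^{j,i}$ in which all squares are pullbacks, and such that: $F_z^{0,d}=\prod Y(s)$ and $F_z^{0,i+1}=\prod F_s^{i,d-1}$ for $0\le i\le d-2$, both products over the non-null $z\to s$ with $|s|=d-1$; for $0<j<d-1$ the map $F_z^{j,j}\to F_z^{j-1,j}$ is a fibration and $F_z^{j,j}$ is weakly contractible; for $d\ge2$, $F_z^{d-1,d-1}=*$; for $z\neq x$, $F_z^{d-1,d}=\overline M_z$ (compatibly with its inclusion in the product); and the vertical maps of column $0$ are the products of the matching maps $Y(s)\to\overline M_s=F_s^{d-2,d-1}$ followed by the horizontal maps $F_s^{i+1,d-1}\to F_s^{i,d-1}$. **Separated operations.** Let $2\le j\le k$, and let $\kappa_0,\dots,\kappa_{j-2}$ be maps $\kappa_i:X\to F_x^{i,k+1}$ such that $\kappa_0=(\sigma_f)$, each $\kappa_{i+1}$ lifts $\kappa_i$, and the image of $\kappa_i$ in $F_x^{i,i+1}$ is null-homotopic for $1\le i\le j-2$. The *separated operation of order $j$* determined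 by them is the set of homotopy classes of maps $\theta:X\to F_x^{j-1,j}$ whose composite to $F_x^{j-2,j}$ equals that of $\kappa_{j-2}$, and whose composite to $F_x^{j-1,j-1}$ is null-homotopic. A value $\theta$ vanishes if it is null-homotopic. **Toda brackets.** A *string* of order $j$ is a sequence $x\to s_k\to s_{k-1}\to\dots\to s_{k-j}$ of maps in $\widetilde J$ with $|s_i|=i$. Its *Toda bracket* is defined from $h=\sigma_{x\to s_k}$ and the chain complex $Y(s_k)\to\dots\to Y(s_{k-j})$ as follows: choose a pointed Reedy fibrant replacement $Z$ of the chain complex (indexed by the category $[j]$, in which all maps of length at least two are null) and a separation grid for it at an added object of degree $j+1$ mapping to the first object $Z_j$; the Toda bracket is the union, over all choices as above starting with $\kappa_0:X\xrightarrow{h}Y(s_k)\to Z_j$, of the last separated operation, which has order $j$. It is a set of homotopy classes of maps from $X$ into a model for $\Omega^{j-1}Y(s_{k-j})$. **Theorem.** In this situation the total operation decomposes into a sequence of separated operations of orders $2\le j\le k$, and these decompose into Toda brackets whose order is at most the degree $k$ of the first target $s_k$ of the string. Precisely: 1. The factorization of $\overline\Psi$ and a separation grid exist, and so do the choices in the definition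 of the Toda bracket of any string; the order of a string is at most $|s_k|$. 2. Fix any separation grid, any choices in the definition of the Toda brackets of all strings, and any models of the iterated loop objects $\Omega^{j-1}Y(s_{k-j})$. In $\mathrm{ho}(\mathcal E)$ there are isomorphisms between the targets of the Toda brackets and these loop objects, and, for $2\le j\le k$, projections exhibiting $$F_x^{j-1,j}\ \cong\ \prod_{x\to s_k\to\dots\to s_{k-j}}\Omega^{j-1}Y(s_{k-j}),$$ where the product is over all strings of order $j$. These do not depend on the data at $x$, and for all data at $x$: (a) for $2\le j\le k$ and every value $\theta$ of the separated operation of order $j$ determined by any choice of $\kappa_0,\dots,\kappa_{j-2}$ as above, each factor $X\to\Omega^{j-1}Y(s_{k-j})$ of $\theta$ is a value of the Toda bracket of the corresponding string, and $\theta$ vanishes if and only if all of its factors vanish; (b) for every factorization of $\overline\Psi$ the following are equivalent: (i) the total operation vanishes; (ii) the sequence of separated operations of orders $2,\dots,k$ vanishes, i.e. there is a sequence $\kappa_0,\dots,\kappa_{k-1}$ as above with null-homotopic images in $F_x^{i,i+1}$ for $1\le i\le k-1$; (iii) there are maps $\kappa_i:X\to F_x^{i,k+1}$ for $0\le i\le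 k-1$ such that $\kappa_0=(\sigma_f)$, each $\kappa_{i+1}$ lifts $\kappa_i$, and for $2\le j\le k$ every factor of the image of $\kappa_{j-1}$ in $F_x^{j-1,j}$ vanishes. -/

import Mathlib

open CategoryTheory CategoryTheory.Limits HomotopicalAlgebra Opposite
open scoped ZeroObject

universe v u v₂ u₂ v₃ u₃

noncomputable section

namespace HigherOps

attribute [local instance] Classical.propDecidable

/-! ### Graded categories with an ideal of null maps -/

/-- A small category with a degree function and a class `null` of designated null maps, in which
every object is the source of only finitely many morphisms. -/
structure GradedIdeal (C : Type u) [Category.{v} C] where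
  deg : C → ℕ
  null : ∀ {s t : C}, (s ⟶ t) → Prop
  finite_out : ∀ s : C, Finite (Σ t : C, s ⟶ t)

/-- A pointed indexing category: a connected, locally finite category with a degree function for
which all non-identity maps strictly decrease degree, with finitely many objects in each degree,
in which every object maps to one of degree zero; together with an absorbing class `null` of maps
which contains the identity of `x` exactly when `x` is a zero object. -/
structure PointedIndexing (J : Type u) [Category.{v} J] where
  deg : J → ℕ
  null : ∀ {x y : J}, (x ⟶ y) → Prop
  connected : IsConnected J
  finite_hom : ∀ x y : J, Finite (x ⟶ y)
  finite_deg : ∀ n : ℕ, {x : J | deg x = n}.Finite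
  deg_lt : ∀ {x y : J} (f : x ⟶ y), deg y < deg x ∨ ∃ h : x = y, f = eqToHom h
  exists_deg_zero : ∀ x : J, ∃ y : J, deg y = 0 ∧ Nonempty (x ⟶ y)
  null_id_iff : ∀ x : J, null (𝟙 x) ↔ IsZero x
  null_precomp : ∀ {x y z : J} (f : x ⟶ y) (g : y ⟶ z), null g → null (f ≫ g)
  null_postcomp : ∀ {x y z : J} (f : x ⟶ y) (g : y ⟶ z), null f → null (f ≫ g)

namespace PointedIndexing

variable {J : Type u} [Category.{v} J] (D : PointedIndexing J)

/-- Every map lowering degree by at least two is null. -/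
def FullyReduced : Prop :=
  ∀ {x y : J} (f : x ⟶ y), D.deg y + 2 ≤ D.deg x → D.null f

/-- The objects under `x` of degree at most `k`.  (When `k < |x|` this excludes `x`.) -/
def bdry (x : J) (k : ℕ) : ObjectProperty J :=
  fun t => D.deg t ≤ k ∧ Nonempty (x ⟶ t)

/-- The full subcategory of objects under `x` of degree at most `k`. -/
abbrev Bdry (x : J) (k : ℕ) : Type u := (D.bdry x k).FullSubcategory

lemma finite_out (D : PointedIndexing J) (s : J) : Finite (Σ t : J, s ⟶ t) := by
  have hfin : {t : J | D.deg t ≤ D.deg s}.Finite := by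
    refine ((Set.finite_Iic (D.deg s)).biUnion (fun n _ => D.finite_deg n)).subset ?_
    intro t ht
    simp only [Set.mem_iUnion]
    exact ⟨D.deg t, ht, rfl⟩
  have hle : ∀ {t : J}, (s ⟶ t) → D.deg t ≤ D.deg s := by
    intro t f
    rcases D.deg_lt f with h | ⟨h, _⟩
    · exact h.le
    · rw [h]
  have : Finite {t : J | D.deg t ≤ D.deg s} := hfin
  have := D.finite_hom
  refine Finite.of_injective
    (β := Σ t : {t : J | D.deg t ≤ D.deg s}, s ⟶ t.1) (fun p => ⟨⟨p.1, hle p.2⟩, p.2⟩) ?_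
  rintro ⟨a, f⟩ ⟨b, g⟩ h
  simp only [Sigma.mk.injEq, Subtype.mk.injEq] at h
  obtain ⟨rfl, h⟩ := h
  simpa using h

/-- The grading and null maps restricted to the objects under `x` of degree at most `k`. -/
def bdryIdeal (x : J) (k : ℕ) : GradedIdeal (D.Bdry x k) where
  deg t := D.deg t.obj
  null f := D.null f.hom
  finite_out s := by
    have := D.finite_out s.obj
    refine Finite.of_injective
      (β := Σ t : J, s.obj ⟶ t) (fun p => ⟨p.1.obj, p.2.hom⟩) ?_
    rintro ⟨⟨a, ha⟩, f⟩ ⟨⟨b, hb⟩, g⟩ h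
    simp only [Sigma.mk.injEq] at h
    obtain ⟨rfl, h⟩ := h
    have : f = g := ObjectProperty.hom_ext _ (eq_of_heq h)
    rw [this]

end PointedIndexing

/-- The chain `0 ⟶ 1 ⟶ ⋯ ⟶ n`, whose `p`-th object has degree `n - p`, with the maps of length at
least two null. Pointed diagrams on it are chain complexes. -/
def chainIdeal (n : ℕ) : GradedIdeal (Fin (n + 1)) where
  deg p := n - (p : ℕ)
  null {p q} _ := (p : ℕ) + 2 ≤ (q : ℕ)
  finite_out _ := inferInstance

/-! ### Pointed diagrams, reduced matching objects, pointed Reedy fibrancy -/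

section Matching

variable {C : Type u} [Category.{v} C] (D : GradedIdeal C)
variable {E : Type u₂} [Category.{v₂} E]

/-- The non-null maps out of `s` with target of degree less than `m`. -/
abbrev Out (s : C) (m : ℕ) : Type (max u v) :=
  {p : Σ t : C, s ⟶ t // D.deg p.1 < m ∧ ¬ D.null p.2}

instance (s : C) (m : ℕ) : Finite (Out D s m) := by
  have := D.finite_out s
  infer_instance

/-- The non-null maps out of `s` lowering degree by one. -/
abbrev OutOne (s : C) : Type (max u v) :=
  {p : Σ t : C, s ⟶ t // D.deg p.1 + 1 = D.deg s ∧ ¬ D.null p.2}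

/-- Pairs of a map in `Out D s m` and a map out of its target. -/
abbrev OutRel (s : C) (m : ℕ) : Type (max u v) :=
  Σ e : Out D s m, {p : Σ t : C, e.1.1 ⟶ t // D.deg p.1 < m}

instance (s : C) (m : ℕ) : Finite (OutRel D s m) := by
  have : ∀ e : Out D s m, Finite (Σ t : C, e.1.1 ⟶ t) := fun e => D.finite_out e.1.1
  infer_instance

variable [HasZeroMorphisms E]

/-- A diagram is pointed if it sends null maps to zero. -/
def Pointed (Y : C ⥤ E) : Prop :=
  ∀ {s t : C} (f : s ⟶ t), D.null f → Y.map f = 0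

variable [HasFiniteLimits E]

/-- The projection of `∏_{Out s m} Y t` to the coordinate of an arbitrary map `f : s ⟶ t`, where the
coordinates of null maps are zero. -/
def coord (Y : C ⥤ E) (s : C) (m : ℕ) {t : C} (f : s ⟶ t) (ht : D.deg t < m) :
    (∏ᶜ fun e : Out D s m => Y.obj e.1.1) ⟶ Y.obj t :=
  if h : D.null f then 0 else Pi.π (fun e : Out D s m => Y.obj e.1.1) ⟨⟨t, f⟩, ht, h⟩

/-- The reduced matching object: the families `(y_f)` indexed by the non-null `f : s ⟶ t` with
`|t| < |s|` which become a compatible family on all such maps after setting `y_f = 0` for `f` null. -/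
abbrev redMatch (Y : C ⥤ E) (s : C) : E :=
  equalizer
    (Pi.lift fun r : OutRel D s (D.deg s) =>
      Pi.π (fun e : Out D s (D.deg s) => Y.obj e.1.1) r.1 ≫ Y.map r.2.1.2)
    (Pi.lift fun r : OutRel D s (D.deg s) =>
      coord D Y s (D.deg s) (r.1.1.2 ≫ r.2.1.2) r.2.2)

/-- The inclusion of the reduced matching object in the product. -/
def forget (Y : C ⥤ E) (s : C) :
    redMatch D Y s ⟶ ∏ᶜ fun e : Out D s (D.deg s) => Y.obj e.1.1 :=
  equalizer.ι _ _

/-- A compatible family of maps out of `X` defines a map to the reduced matching object. -/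
def redMatchLift (Y : C ⥤ E) (s : C) {X : E}
    (a : ∀ {t : C}, (s ⟶ t) → D.deg t < D.deg s → (X ⟶ Y.obj t))
    (a_null : ∀ {t : C} (f : s ⟶ t) (ht : D.deg t < D.deg s), D.null f → a f ht = 0)
    (a_comp : ∀ {t t' : C} (f : s ⟶ t) (g : t ⟶ t') (ht : D.deg t < D.deg s)
      (ht' : D.deg t' < D.deg s), a f ht ≫ Y.map g = a (f ≫ g) ht') :
    X ⟶ redMatch D Y s :=
  equalizer.lift (Pi.lift fun e => a e.1.2 e.2.1) (by
    refine Pi.hom_ext _ _ fun r => ?_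
    simp only [Category.assoc, limit.lift_π, Fan.mk_π_app, limit.lift_π_assoc, coord]
    rw [a_comp _ _ _ r.2.2]
    split_ifs with h
    · rw [a_null _ _ h, comp_zero]
    · simp)

lemma redMatchLift_forget (Y : C ⥤ E) (s : C) {X : E}
    (a : ∀ {t : C}, (s ⟶ t) → D.deg t < D.deg s → (X ⟶ Y.obj t))
    (a_null : ∀ {t : C} (f : s ⟶ t) (ht : D.deg t < D.deg s), D.null f → a f ht = 0)
    (a_comp : ∀ {t t' : C} (f : s ⟶ t) (g : t ⟶ t') (ht : D.deg t < D.deg s)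
      (ht' : D.deg t' < D.deg s), a f ht ≫ Y.map g = a (f ≫ g) ht')
    (e : Out D s (D.deg s)) :
    redMatchLift D Y s a a_null a_comp ≫ forget D Y s ≫ Pi.π _ e = a e.1.2 e.2.1 := by
  unfold redMatchLift forget
  rw [equalizer.lift_ι_assoc, Pi.lift_π]

/-- The matching map of a pointed diagram. -/
def matchMap (Y : C ⥤ E) (hY : Pointed D Y) (s : C) : Y.obj s ⟶ redMatch D Y s :=
  redMatchLift D Y s (fun f _ => Y.map f) (fun f _ h => hY f h) (fun f g _ _ => (Y.map_comp f g).symm)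

/-- A pointed diagram is pointed Reedy fibrant if all its matching maps are fibrations. -/
def PointedReedyFibrant [CategoryWithFibrations E] (Y : C ⥤ E) (hY : Pointed D Y) : Prop :=
  ∀ s : C, Fibration (matchMap D Y hY s)

end Matching

/-! ### The total pointed higher homotopy operation -/

section Total

variable {J : Type u} [Category.{v} J] (D : PointedIndexing J) (x : J) (k : ℕ)
variable {E : Type u₂} [Category.{v₂} E] [ModelCategory E] [HasZeroObject E] [HasZeroMorphisms E]

/-- The non-null maps from `x` to objects of degree less than `k`. -/
abbrev XLow : Type (max u v) :=
  {p : Σ t : D.Bdry x k, x ⟶ t.obj // D.deg p.1.obj < k ∧ ¬ D.null p.2}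

/-- The non-null maps from `x` to objects of degree exactly `k`. -/
abbrev XTop : Type (max u v) :=
  {p : Σ t : D.Bdry x k, x ⟶ t.obj // D.deg p.1.obj = k ∧ ¬ D.null p.2}

lemma finite_under : Finite (Σ t : D.Bdry x k, x ⟶ t.obj) := by
  have := D.finite_out x
  refine Finite.of_injective
    (β := Σ t : J, x ⟶ t) (fun p => ⟨p.1.obj, p.2⟩) ?_
  rintro ⟨⟨a, ha⟩, f⟩ ⟨⟨b, hb⟩, g⟩ h
  simp only [Sigma.mk.injEq] at h
  obtain ⟨rfl, h⟩ := h
  simpa using h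

instance : Finite (XLow D x k) := by
  have := finite_under D x k
  infer_instance

instance : Finite (XTop D x k) := by
  have := finite_under D x k
  infer_instance

variable {D x k}

/-- The data at `x` for the inner induction step at `k`, over a strict pointed diagram `Y` on the
objects under `x` of degree at most `k`, with value `X` at `x`: a strict pointed extension `low` to
`x`, `X` of `Y` restricted to degrees below `k`, and maps `top` representing an extension of the
diagram to `x`, `X` which is only homotopy commutative. -/
structure PointwiseData (Y : D.Bdry x k ⥤ E) (X : E) where
  low : ∀ {t : D.Bdry x k}, (x ⟶ t.obj) → D.deg t.obj < k → (X ⟶ Y.obj t)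
  low_null : ∀ {t : D.Bdry x k} (f : x ⟶ t.obj) (ht : D.deg t.obj < k), D.null f → low f ht = 0
  low_comp : ∀ {t t' : D.Bdry x k} (f : x ⟶ t.obj) (g : t ⟶ t') (ht : D.deg t.obj < k)
    (ht' : D.deg t'.obj < k), low f ht ≫ Y.map g = low (f ≫ g.hom) ht'
  top : ∀ e : XTop D x k, X ⟶ Y.obj e.1.1
  top_htpy : ∀ (e : XTop D x k) {t : D.Bdry x k} (g : e.1.1 ⟶ t) (ht : D.deg t.obj < k),
    LeftHomotopyRel (top e ≫ Y.map g) (low (e.1.2 ≫ g.hom) ht)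

variable (Y : D.Bdry x k ⥤ E)

/-- `∏_{x → s} ∏_{s → v} Y v` -/
abbrev cornerObj : E :=
  ∏ᶜ fun e : XTop D x k => ∏ᶜ fun d : Out (D.bdryIdeal x k) e.1.1 ((D.bdryIdeal x k).deg e.1.1) =>
    Y.obj d.1.1

/-- The reduced generalized diagonal: its coordinate at `x ⟶ s ⟶ v` is the projection to the
coordinate of the composite, which is zero if the composite is null. -/
def genDiag : (∏ᶜ fun e : XLow D x k => Y.obj e.1.1) ⟶ cornerObj Y :=
  Pi.lift fun e => Pi.lift fun d =>
    if h : D.null (e.1.2 ≫ d.1.2.hom) then 0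
    else Pi.π (fun e : XLow D x k => Y.obj e.1.1)
      ⟨⟨d.1.1, e.1.2 ≫ d.1.2.hom⟩, lt_of_lt_of_eq d.2.1 e.2.1, h⟩

/-- The product of the inclusions of the matching objects. -/
def prodForget :
    (∏ᶜ fun e : XTop D x k => redMatch (D.bdryIdeal x k) Y e.1.1) ⟶ cornerObj Y :=
  Limits.Pi.map fun e => forget (D.bdryIdeal x k) Y e.1.1

/-- The product of the matching maps. -/
def prodMatch (hY : Pointed (D.bdryIdeal x k) Y) :
    (∏ᶜ fun e : XTop D x k => Y.obj e.1.1) ⟶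
      ∏ᶜ fun e : XTop D x k => redMatch (D.bdryIdeal x k) Y e.1.1 :=
  Limits.Pi.map fun e => matchMap (D.bdryIdeal x k) Y hY e.1.1

/-- A factorization of the generalized diagonal as a weak equivalence followed by a fibration. -/
structure DiagFactorization where
  F₁ : E
  ι : (∏ᶜ fun e : XLow D x k => Y.obj e.1.1) ⟶ F₁
  p : F₁ ⟶ cornerObj Y
  fac : ι ≫ p = genDiag Y
  weq : WeakEquivalence ι
  fib : Fibration p

variable {Y}

/-- The target of the total operation. -/
abbrev DiagFactorization.F₂ (Φ : DiagFactorization Y) : E := pullback Φ.p (prodForget Y)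

variable (Y) in
/-- The pullback of the generalized diagonal and the product of the forgetful maps. -/
abbrev Qbar : E := pullback (genDiag Y) (prodForget Y)

/-- The map induced on pullbacks by the weak equivalence of the factorization. -/
def DiagFactorization.γ (Φ : DiagFactorization Y) : Qbar Y ⟶ Φ.F₂ :=
  pullback.lift (pullback.fst _ _ ≫ Φ.ι) (pullback.snd _ _)
    (by rw [Category.assoc, Φ.fac, pullback.condition])

namespace PointwiseData

variable {X : E} (d : PointwiseData Y X)

/-- The maps to objects of degree less than `k`, jointly. -/
def σlow : X ⟶ ∏ᶜ fun e : XLow D x k => Y.obj e.1.1 :=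
  Pi.lift fun e => d.low e.1.2 e.2.1

/-- The maps to objects of degree `k`, jointly. -/
def σtop : X ⟶ ∏ᶜ fun e : XTop D x k => Y.obj e.1.1 :=
  Pi.lift d.top

lemma low_aux (e : XTop D x k) {t : D.Bdry x k} (f : e.1.1 ⟶ t)
    (ht : D.deg t.obj < k) (hf : D.null f.hom) : d.low (e.1.2 ≫ f.hom) ht = 0 :=
  d.low_null _ _ (D.null_precomp _ _ hf)

lemma low_aux' (e : XTop D x k) {t t' : D.Bdry x k} (f : e.1.1 ⟶ t) (g : t ⟶ t')
    (ht : D.deg t.obj < k) (ht' : D.deg t'.obj < k) :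
    d.low (e.1.2 ≫ f.hom) ht ≫ Y.map g = d.low (e.1.2 ≫ (f ≫ g).hom) ht' := by
  rw [d.low_comp _ g _ ht']
  congr 1
  simp

/-- The map to the matching object of the target of a map to degree `k` given by the strict
extension. -/
def ρ₁ (e : XTop D x k) : X ⟶ redMatch (D.bdryIdeal x k) Y e.1.1 :=
  redMatchLift (D.bdryIdeal x k) Y e.1.1
    (fun f ht => d.low (e.1.2 ≫ f.hom) (lt_of_lt_of_eq ht e.2.1))
    (fun f _ hf => d.low_aux e f _ hf)
    (fun f g _ _ => d.low_aux' e f g _ _)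

/-- The map to the product of the matching objects given by the strict extension. -/
def ρ : X ⟶ ∏ᶜ fun e : XTop D x k => redMatch (D.bdryIdeal x k) Y e.1.1 :=
  Pi.lift d.ρ₁

lemma ρ_forget (e : XTop D x k)
    (f : Out (D.bdryIdeal x k) e.1.1 ((D.bdryIdeal x k).deg e.1.1)) :
    d.ρ ≫ prodForget Y ≫ Pi.π _ e ≫ Pi.π _ f =
      d.low (e.1.2 ≫ f.1.2.hom) (lt_of_lt_of_eq f.2.1 e.2.1) := by
  unfold prodForget ρ
  rw [Pi.map_π_assoc, Pi.lift_π_assoc]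
  exact redMatchLift_forget (D.bdryIdeal x k) Y e.1.1
    (fun f ht => d.low (e.1.2 ≫ f.hom) (lt_of_lt_of_eq ht e.2.1))
    (fun f _ hf => d.low_aux e f _ hf) (fun f g _ _ => d.low_aux' e f g _ _) f

/-- The map to `Qbar` given by the strict extension. -/
def η : X ⟶ Qbar Y :=
  pullback.lift d.σlow d.ρ (by
    refine Pi.hom_ext _ _ fun e => Pi.hom_ext _ _ fun f => ?_
    have h2 : d.σlow ≫ genDiag Y ≫ Pi.π _ e ≫ Pi.π _ f =
        d.low (e.1.2 ≫ f.1.2.hom) (lt_of_lt_of_eq f.2.1 e.2.1) := by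
      unfold genDiag σlow
      rw [Pi.lift_π_assoc, Pi.lift_π]
      split_ifs with h
      · rw [comp_zero, d.low_null _ _ h]
      · rw [Pi.lift_π]
    simp only [Category.assoc]
    exact h2.trans (d.ρ_forget e f).symm)

/-- The total pointed higher homotopy operation: the set of homotopy classes of maps `θ : X ⟶ F₂`
whose image in the lower right corner is given by `top` and whose image in `F₁` is homotopic to
the composite of `low` with `ι`. -/
def totalOp (hY : Pointed (D.bdryIdeal x k) Y) (Φ : DiagFactorization Y) :
    Set (LeftHomotopyClass X Φ.F₂) :=
  {c | ∃ θ : X ⟶ Φ.F₂, LeftHomotopyClass.mk θ = c ∧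
    θ ≫ pullback.fst _ _ ≫ Φ.p = d.σtop ≫ prodMatch Y hY ≫ prodForget Y ∧
    LeftHomotopyRel (θ ≫ pullback.fst _ _) (d.σlow ≫ Φ.ι)}

/-- The total operation vanishes if it contains the class of `η ≫ γ`. -/
def TotalVanishes (hY : Pointed (D.bdryIdeal x k) Y) (Φ : DiagFactorization Y) : Prop :=
  LeftHomotopyClass.mk (d.η ≫ Φ.γ) ∈ d.totalOp hY Φ

end PointwiseData

end Total

/-! ### Separation grids and separated operations -/

/-- The entry of a grid in column `j` (from the right) and row `i` (from the bottom). -/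
abbrev entry {E : Type u₂} [Category.{v₂} E] (B : ℕᵒᵖ ⥤ ℕᵒᵖ ⥤ E) (j i : ℕ) : E :=
  (B.obj (op j)).obj (op i)

/-- The vertical maps of a grid, from higher to lower rows. -/
abbrev ver {E : Type u₂} [Category.{v₂} E] (B : ℕᵒᵖ ⥤ ℕᵒᵖ ⥤ E) (j : ℕ) {i i' : ℕ} (h : i ≤ i') :
    entry B j i' ⟶ entry B j i :=
  (B.obj (op j)).map (homOfLE h).op

/-- The horizontal maps of a grid, from left to right. -/
abbrev hor {E : Type u₂} [Category.{v₂} E] (B : ℕᵒᵖ ⥤ ℕᵒᵖ ⥤ E) {j j' : ℕ} (h : j ≤ j') (i : ℕ) :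
    entry B j' i ⟶ entry B j i :=
  (B.map (homOfLE h).op).app (op i)

section Grid

variable {C : Type u} [Category.{v} C] (D : GradedIdeal C)

/-- The maps from a node to the objects of one degree lower; the node `none` stands for an extra
object of degree `k + 1`, with a map to `tgt e` for each `e : I`. -/
def Fam (I : Type (max u v)) : Option C → Type (max u v)
  | none => I
  | some s => OutOne D s

/-- The targets of these maps. -/
def famTgt {I : Type (max u v)} (tgt : I → C) : (z : Option C) → Fam D I z → C
  | none, e => tgt e
  | some _, e => e.1.1

/-- The degree of a node. -/
def nodeDeg (k : ℕ) : Option C → ℕ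
  | none => k + 1
  | some s => D.deg s

variable {E : Type u₂} [Category.{v₂} E] [ModelCategory E] [HasZeroObject E] [HasZeroMorphisms E]

/-- A separation grid for a pointed diagram `Y` over a fully reduced category, and an extra object
`x` of degree `k + 1` whose non-null maps to objects of degree `k` are indexed by `I`.

There is a grid `F z` for each node `z` (either `x`, or an object of positive degree of `C`); only
its entries in columns `0 ≤ j < |z|` and rows `max 1 j ≤ i ≤ |z|` matter. All squares are pullbacks.
The entries `F z j j` with `0 < j < |z| - 1` come from factorizations of `* ⟶ F z (j-1) j` as a
weak equivalence followed by a fibration, and in the leftmost column `F z (|z|-1) (|z|-1) = *`, so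
that `F z (|z|-1) |z|` is the reduced matching object.
Column `0` is the product, over the maps `z ⟶ s` to objects of one degree lower, of `Y s` (the top
entry), the matching object of `s`, and then the other entries of the top row of the grid of `s`,
written vertically. -/
structure SepGrid (Y : C ⥤ E) (hY : Pointed D Y) (I : Type (max u v)) (tgt : I → C) (k : ℕ) where
  F : Option C → ℕᵒᵖ ⥤ ℕᵒᵖ ⥤ E
  square : ∀ (z : Option C) (j i : ℕ), j + 1 ≤ i → i + 1 ≤ nodeDeg D k z →
    IsPullback (hor (F z) (Nat.le_succ j) (i + 1)) (ver (F z) (j + 1) (Nat.le_succ i))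
      (ver (F z) j (Nat.le_succ i)) (hor (F z) (Nat.le_succ j) i)
  weq : ∀ (z : Option C) (j : ℕ), j + 2 < nodeDeg D k z →
    WeakEquivalence (0 : (0 : E) ⟶ entry (F z) (j + 1) (j + 1))
  fib : ∀ (z : Option C) (j : ℕ), j + 2 < nodeDeg D k z →
    Fibration (hor (F z) (Nat.le_succ j) (j + 1))
  last : ∀ (z : Option C), 2 ≤ nodeDeg D k z →
    IsZero (entry (F z) (nodeDeg D k z - 1) (nodeDeg D k z - 1))
  top : ∀ (z : Option C) (e : Fam D I z),
    entry (F z) 0 (nodeDeg D k z) ⟶ Y.obj (famTgt D tgt z e)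
  top_isLimit : ∀ z : Option C, 1 ≤ nodeDeg D k z →
    Nonempty (IsLimit (Fan.mk (entry (F z) 0 (nodeDeg D k z)) (top z)))
  row : ∀ (z : Option C) (i : ℕ) (e : Fam D I z),
    entry (F z) 0 (i + 1) ⟶
      entry (F (some (famTgt D tgt z e))) i (D.deg (famTgt D tgt z e))
  row_isLimit : ∀ (z : Option C) (i : ℕ), i + 2 ≤ nodeDeg D k z →
    Nonempty (IsLimit (Fan.mk (entry (F z) 0 (i + 1)) (row z i)))
  row_ver : ∀ (z : Option C) (i : ℕ) (e : Fam D I z), i + 3 ≤ nodeDeg D k z →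
    ver (F z) 0 (Nat.le_succ (i + 1)) ≫ row z i e =
      row z (i + 1) e ≫ hor (F (some (famTgt D tgt z e))) (Nat.le_succ i) _
  matIso : ∀ s : C, 1 ≤ D.deg s → (redMatch D Y s ≅ entry (F (some s)) (D.deg s - 1) (D.deg s))
  matIso_forget : ∀ (s : C) (hs : 1 ≤ D.deg s) (e : OutOne D s),
    (matIso s hs).hom ≫ hor (F (some s)) (Nat.zero_le _) (D.deg s) ≫ top (some s) e =
      forget D Y s ≫ Pi.π (fun e : Out D s (D.deg s) => Y.obj e.1.1)
        ⟨e.1, by have := e.2.1; omega, e.2.2⟩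
  top_ver : ∀ (z : Option C) (i : ℕ) (e : Fam D I z) (hi : i + 2 ≤ nodeDeg D k z)
    (hs : 1 ≤ D.deg (famTgt D tgt z e)) (h : i ≤ D.deg (famTgt D tgt z e) - 1),
    ver (F z) 0 (by omega : i + 1 ≤ nodeDeg D k z) ≫ row z i e =
      top z e ≫ matchMap D Y hY (famTgt D tgt z e) ≫ (matIso _ hs).hom ≫
        hor (F (some (famTgt D tgt z e))) h _

namespace SepGrid

variable {D} {Y : C ⥤ E} {hY : Pointed D Y} {I : Type (max u v)} {tgt : I → C} {k : ℕ}
variable (G : SepGrid D Y hY I tgt k) {X : E}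

/-- The entry `F_x^{j,i}` of the grid of the extra object `x`. -/
abbrev at' (j i : ℕ) : E := entry (G.F none) j i

/-- An inductively chosen sequence `κ_0, …, κ_m` of maps to the top row of the grid of `x`, starting
with the given `σ`: each lifts the previous one, and for `1 ≤ j ≤ m` the image of `κ_j` in
`F_x^{j,j+1}`, which is a value of the separated operation of order `j + 1` determined by
`κ_{j-1}`, vanishes. -/
structure IsThread (σ : ∀ e : I, X ⟶ Y.obj (tgt e)) (κ : ∀ j : ℕ, X ⟶ G.at' j (k + 1)) (m : ℕ) :
    Prop where
  start : ∀ e : I, κ 0 ≫ G.top none e = σ e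
  lift : ∀ j : ℕ, j < m → κ (j + 1) ≫ hor (G.F none) (Nat.le_succ j) (k + 1) = κ j
  vanish : ∀ (j : ℕ) (h : j + 1 ≤ k + 1), 1 ≤ j → j ≤ m →
    LeftHomotopyRel (κ j ≫ ver (G.F none) j h) 0

/-- `θ` represents a value of the separated operation of order `j + 2` (with `j + 2 ≤ k`)
determined by `κ_j`. -/
def IsValue (j : ℕ) (hj : j + 2 ≤ k) (κj : X ⟶ G.at' j (k + 1)) (θ : X ⟶ G.at' (j + 1) (j + 2)) :
    Prop :=
  θ ≫ hor (G.F none) (Nat.le_succ j) (j + 2) =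
      κj ≫ ver (G.F none) j (by omega : j + 2 ≤ k + 1) ∧
    LeftHomotopyRel (θ ≫ ver (G.F none) (j + 1) (Nat.le_succ (j + 1))) 0

/-- The separated operation of order `j + 2` determined by `κ_j`. -/
def sepOp (j : ℕ) (hj : j + 2 ≤ k) (κj : X ⟶ G.at' j (k + 1)) :
    Set (LeftHomotopyClass X (G.at' (j + 1) (j + 2))) :=
  {c | ∃ θ, G.IsValue j hj κj θ ∧ LeftHomotopyClass.mk θ = c}

end SepGrid

end Grid

/-! ### Strings and long Toda brackets -/

section Toda

variable {E : Type u₂} [Category.{v₂} E] [ModelCategory E] [HasZeroObject E] [HasZeroMorphisms E]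

/-- The data needed to define the Toda bracket of a map `X ⟶ S 0` and a strict chain complex
`S 0 ⟶ ⋯ ⟶ S n`: a pointed Reedy fibrant replacement `Z` of `S`, and a separation grid for the
chain complex `x ⟶ Z 0 ⟶ ⋯ ⟶ Z n` of length `n + 1`. -/
structure TodaModel {n : ℕ} (S : Fin (n + 1) ⥤ E) where
  Z : Fin (n + 1) ⥤ E
  pointed : Pointed (chainIdeal n) Z
  fibrant : PointedReedyFibrant (chainIdeal n) Z pointed
  α : S ⟶ Z
  weq : ∀ i, WeakEquivalence (α.app i)
  grid : SepGrid (chainIdeal n) Z pointed PUnit.{1} (fun _ => 0) n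

/-- The (long) Toda bracket of order `j + 2` of a map `h : X ⟶ S 0` and a strict chain complex
`S 0 ⟶ ⋯ ⟶ S (j + 2)`, i.e. of a string of `j + 3` maps: the set of all values of the last
separated operation, for all choices which make the lower order operations vanish. It is a set of
homotopy classes of maps into a model of the `(j + 1)`-fold loop object of `S (j + 2)`. -/
def TodaModel.bracket {j : ℕ} {S : Fin (j + 2 + 1) ⥤ E} (T : TodaModel S) {X : E}
    (h : X ⟶ S.obj 0) : Set (LeftHomotopyClass X (T.grid.at' (j + 1) (j + 2))) :=
  {c | ∃ κ : ∀ i : ℕ, X ⟶ T.grid.at' i (j + 2 + 1),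
    T.grid.IsThread (fun _ => h ≫ T.α.app 0) κ j ∧ c ∈ T.grid.sepOp j le_rfl (κ j)}

/-- `L` is a model of the loop object of `W`: the fiber of a fibration `P ⟶ W` with `P` weakly
contractible. -/
def IsLoopObject (W L : E) : Prop :=
  ∃ (P : E) (p : P ⟶ W) (l : L ⟶ P), Fibration p ∧ WeakEquivalence (0 : (0 : E) ⟶ P) ∧
    IsPullback l (0 : L ⟶ (0 : E)) p 0

/-- `L` is a model of the `m`-fold loop object of `W`. -/
def IsIterLoopObject : ℕ → E → E → Prop
  | 0, W, L => Nonempty (L ≅ W)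
  | m + 1, W, L => ∃ L' : E, IsIterLoopObject m W L' ∧ IsLoopObject L' L

variable {J : Type u} [Category.{v} J]

/-- A string of `n + 1` composable non-null maps `x ⟶ s_k ⟶ s_{k-1} ⟶ ⋯ ⟶ s_{k-n}` whose targets
have degrees `k, k - 1, …, k - n`. -/
structure TString (D : PointedIndexing J) (x : J) (k n : ℕ) where
  chain : Fin (n + 1) ⥤ D.Bdry x k
  head : x ⟶ (chain.obj 0).obj
  deg_eq : ∀ i : Fin (n + 1), D.deg (chain.obj i).obj + (i : ℕ) = k
  head_not_null : ¬ D.null head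
  not_null : ∀ i : Fin n,
    ¬ D.null (chain.map (homOfLE (Fin.castSucc_lt_succ (i := i)).le)).hom

/-- The first map of a string. -/
def TString.first {D : PointedIndexing J} {x : J} {k n : ℕ} (S : TString D x k n) : XTop D x k :=
  ⟨⟨S.chain.obj 0, S.head⟩, by simpa using S.deg_eq 0, S.head_not_null⟩

/-- A separation grid for the pointed diagram `Y` at `x`. -/
abbrev GridAt {D : PointedIndexing J} {x : J} {k : ℕ} (Y : D.Bdry x k ⥤ E)
    (hY : Pointed (D.bdryIdeal x k) Y) :=
  SepGrid (D.bdryIdeal x k) Y hY (XTop D x k) (fun e => e.1.1) k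

end Toda

end HigherOps

end

universe v₁ u₁

noncomputable section

namespace HigherOps

attribute [local instance] Classical.propDecidable

/-! ### Homotopy pullbacks -/

section HoPullbacks

variable {E : Type u₂} [Category.{v₂} E] [ModelCategory E]

/-! Full reducedness makes two things degenerate. First, every composite `x ⟶ s ⟶ v` with `|s| = k`
and `|v| < k` lowers degree by at least two and is null. The strict extension therefore induces the
zero map to the product of the matching objects (`PointwiseData.ρ_eq_zero`). Since the projection of
the target `F₂` of the total operation to that product is a fibration, homotopies lift, and the
total operation vanishes exactly when `(σ_f)` followed by the matching maps is null-homotopic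
(`PointwiseData.totalVanishes_iff`). The entry `F_x^{0,k}` is the same product, so this condition
says that `κ_0` becomes null in row `k` of column `0`. The row map `F_x^{k-1,k} ⟶ F_x^{0,k}` is a
fibration and the rectangle above it is a pullback. Hence a null map downstairs lifts to a null map
in column `k-1`, which together with `κ_0` defines `κ_{k-1}`, and the horizontal images of the
latter form the whole vanishing sequence. Conversely, the last vanishing condition maps to column
`0` (`SepGrid.exists_thread_iff`).

Secondly, a reduced matching object is the strict fibre of the product of the matching maps one
degree lower (`redMatch_isPullback`). This lets grids be built by recursion on degree. In such a
grid, pasting pullbacks shows that `F_z^{j+1,j+2}` is a homotopy pullback of two weakly contractible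
objects over `∏ F_s^{j,j+1}`, that is, a loop object of this product (`SepGrid.hoPullback`). By
induction `F_x^{j-1,j}` is, up to weak equivalence, the product of iterated loop objects over all
strings (`isWeakProd_of_isComponent`), and localization preserves finite products of fibrant objects
(`IsProd.localization`).

It remains to see that the projections carry values to Toda brackets. A grid restricted to a string
is no longer a separation grid, since its matching objects and products are wrong; a `PreGrid` keeps
what survives. A map of diagrams extends to a map of grids when the diagonal entries of the source
are cofibrant and the horizontal maps of the target are fibrations (`exists_gridMap`); over a weak
equivalence of diagrams it is an equivalence (`GridMap.weq`). The fibration condition fails in the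
leftmost column, and is restored by passing to a chain complex with one more term
(`exists_extended_grid`). This gives a zigzag: the given grid receives an equivalence from one with
cofibrant diagonals; the restriction of the latter to a string maps to an extended grid; and this
receives an equivalence from a grid that also maps to the one defining the bracket. Values are
pushed forward along maps of grids and lifted back along equivalences (`PreGrid.IsOpValue.push`,
`PreGrid.IsOpValue.exists_lift`). -/

lemma fibration_fst_of_isPullback {Q A B C : E} {fst : Q ⟶ C} {snd : Q ⟶ A} {f : C ⟶ B}
    {p : A ⟶ B} (h : IsPullback fst snd f p) [hp : Fibration p] : Fibration fst := by
  rw [fibration_iff] at hp ⊢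
  exact MorphismProperty.of_isPullback h.flip hp

lemma fibration_snd_of_isPullback {Q A B C : E} {fst : Q ⟶ C} {snd : Q ⟶ A} {f : C ⟶ B}
    {p : A ⟶ B} (h : IsPullback fst snd f p) [Fibration f] : Fibration snd :=
  fibration_fst_of_isPullback h.flip

lemma weq_fst_of_isPullback {Q A B C : E} {fst : Q ⟶ C} {snd : Q ⟶ A} {f : C ⟶ B}
    {p : A ⟶ B} (h : IsPullback fst snd f p) [Fibration p] [WeakEquivalence p] :
    WeakEquivalence fst := by
  rw [weakEquivalence_iff]
  exact (MorphismProperty.of_isPullback h.flip (mem_trivialFibrations p)).2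

lemma weq_snd_of_isPullback {Q A B C : E} {fst : Q ⟶ C} {snd : Q ⟶ A} {f : C ⟶ B}
    {p : A ⟶ B} (h : IsPullback fst snd f p) [Fibration f] [WeakEquivalence f] :
    WeakEquivalence snd :=
  weq_fst_of_isPullback h.flip

omit [ModelCategory E] in
lemma isPullback_of_comp {Q A A' B C R : E} {fst : Q ⟶ C} {snd : Q ⟶ A} {f : C ⟶ B}
    {p : A ⟶ B} (h : IsPullback fst snd f p) {r : A' ⟶ A} {q : A' ⟶ B} {a : R ⟶ C} {b : R ⟶ A'}
    (hR : IsPullback a b f q) (hq : r ≫ p = q) (t : R ⟶ Q) (ht : t ≫ fst = a)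
    (ht' : t ≫ snd = b ≫ r) : IsPullback t b snd r := by
  subst hq ht
  exact IsPullback.of_right hR ht' h

lemma exists_isPullback {A B C : E} (f : C ⟶ B) (p : A ⟶ B) :
    ∃ (Q : E) (fst : Q ⟶ C) (snd : Q ⟶ A), IsPullback fst snd f p :=
  ⟨_, _, _, IsPullback.of_hasPullback f p⟩

lemma isFibrant_over {B : E} (c : Over B) [Fibration c.hom] : IsFibrant c := by
  rw [isFibrant_iff_of_isTerminal (Over.mkIdTerminal.from c) Over.mkIdTerminal]
  refine (fibrations_over_iff _ _).2 ?_
  have : (Over.mkIdTerminal.from c).left = c.hom :=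
    (Category.comp_id _).symm.trans (Over.w (Over.mkIdTerminal.from c))
  rw [this]
  infer_instance

/-- Base change preserves weak equivalences between fibrations over a fixed base. -/
lemma weq_baseChange {A A' B C Q Q' : E} {f : C ⟶ B} {p : A ⟶ B} {p' : A' ⟶ B}
    {fst : Q ⟶ C} {snd : Q ⟶ A} {fst' : Q' ⟶ C} {snd' : Q' ⟶ A'}
    (h : IsPullback fst snd f p) (h' : IsPullback fst' snd' f p') [Fibration p] [Fibration p']
    (w : A ⟶ A') [WeakEquivalence w] (hw : w ≫ p' = p) (l : Q ⟶ Q') (hl : l ≫ fst' = fst)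
    (hl' : l ≫ snd' = snd ≫ w) : WeakEquivalence l := by
  let a : Over B := Over.mk p
  let a' : Over B := Over.mk p'
  let w' : a ⟶ a' := Over.homMk w hw
  have : Fibration a.hom := by assumption
  have : Fibration a'.hom := by assumption
  have := isFibrant_over a
  have := isFibrant_over a'
  have : WeakEquivalence w' := (weakEquivalences_over_iff _ _).2
    (inferInstanceAs (WeakEquivalence w))
  -- In `Over B` both fibrations are fibrant objects, so `w` is a section `i` of a trivial fibration
  -- `r` followed by a trivial fibration `q`; all of this survives base change along `f`.
  obtain ⟨b⟩ : Nonempty (FibrantBrownFactorization w') := inferInstance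
  let r : b.Z.left ⟶ A := b.r.left
  let i : A ⟶ b.Z.left := b.i.left
  let q : b.Z.left ⟶ A' := b.p.left
  have hir : i ≫ r = 𝟙 _ := (Over.comp_left _ _ _ _ _).symm.trans (by rw [b.i_r]; rfl)
  have hiq : i ≫ q = w := (Over.comp_left _ _ _ _ _).symm.trans (by rw [b.fac]; rfl)
  have hr : r ≫ p = b.Z.hom := Over.w b.r
  have hq : q ≫ p' = b.Z.hom := Over.w b.p
  have hi : i ≫ b.Z.hom = p := Over.w b.i
  have : Fibration r := inferInstanceAs (Fibration b.r.left)
  have : WeakEquivalence r := inferInstanceAs (WeakEquivalence b.r.left)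
  have : Fibration q := inferInstanceAs (Fibration b.p.left)
  have : WeakEquivalence q := inferInstanceAs (WeakEquivalence b.p.left)
  obtain ⟨R, c, d, hR⟩ := exists_isPullback f b.Z.hom
  let t : R ⟶ Q := h.lift c (d ≫ r) (by rw [Category.assoc, hr, hR.w])
  let t' : R ⟶ Q' := h'.lift c (d ≫ q) (by rw [Category.assoc, hq, hR.w])
  let s : Q ⟶ R := hR.lift fst (snd ≫ i) (by rw [Category.assoc, hi, h.w])
  have : WeakEquivalence t := weq_fst_of_isPullback
    (isPullback_of_comp h hR hr t (h.lift_fst _ _ _) (h.lift_snd _ _ _))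
  have : WeakEquivalence t' := weq_fst_of_isPullback
    (isPullback_of_comp h' hR hq t' (h'.lift_fst _ _ _) (h'.lift_snd _ _ _))
  have hst : s ≫ t = 𝟙 _ := h.hom_ext (by simp [s, t]) (by simp [s, t, hir])
  have : WeakEquivalence s := weakEquivalence_of_postcomp_of_fac hst
  have : s ≫ t' = l := h'.hom_ext (by simp [s, t', hl]) (by simp [s, t', hiq, hl'])
  rw [← this]
  infer_instance

/-- This presents the mapping path object of `f` as a base change of the path fibration over `B ⨯
B`, which shows that its two evaluations are jointly a fibration. -/
lemma isPullback_path {P A B C : E} (p₀ p₁ : P ⟶ B) (f : C ⟶ B) {a : A ⟶ C} {b : A ⟶ P}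
    (h : IsPullback a b f p₀) :
    IsPullback b (prod.lift a (b ≫ p₁)) (prod.lift p₀ p₁) (prod.map f (𝟙 B)) := by
  refine IsPullback.of_isLimit' ⟨?_⟩ (PullbackCone.IsLimit.mk _
    (fun s => h.lift (s.snd ≫ prod.fst) s.fst ?_) ?_ ?_ ?_)
  · rw [prod.lift_map, prod.comp_lift, h.w, Category.comp_id]
  · have := s.condition =≫ prod.fst
    rw [Category.assoc, Category.assoc, prod.lift_fst, prod.map_fst] at this
    rw [Category.assoc, this]
  · intro s
    exact h.lift_snd _ _ _
  · intro s
    have := s.condition =≫ prod.snd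
    rw [Category.assoc, Category.assoc, prod.lift_snd, prod.map_snd, Category.comp_id] at this
    refine Limits.prod.hom_ext ?_ ?_
    · rw [Category.assoc]
      exact (congrArg _ (prod.lift_fst _ _)).trans (h.lift_fst _ _ _)
    · rw [Category.assoc]
      exact (congrArg _ (prod.lift_snd _ _)).trans ((h.lift_snd_assoc _ _ _ _).trans this)
  · intro s m h1 h2
    have := h2 =≫ prod.fst
    rw [Category.assoc, prod.lift_fst] at this
    exact h.hom_ext (by rw [this, h.lift_fst]) (by rw [h1, h.lift_snd])

/-- Base change along a fibration preserves weak equivalences between fibrant objects. -/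
lemma weq_snd_of_weq {Q A B C : E} {fst : Q ⟶ C} {snd : Q ⟶ A} {f : C ⟶ B} {p : A ⟶ B}
    (h : IsPullback fst snd f p) [WeakEquivalence f] [Fibration p] [IsFibrant C] [IsFibrant B] :
    WeakEquivalence snd := by
  obtain ⟨P, _⟩ := PathObject.exists_very_good B
  obtain ⟨U, U₁, U₂, hU⟩ := exists_isPullback P.p₁ p
  have := fibration_fst_of_isPullback hU
  have := fibration_snd_of_isPullback hU
  have := weq_snd_of_isPullback hU
  obtain ⟨T, T₁, T₂, hT⟩ := exists_isPullback p (U₁ ≫ P.p₀)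
  have := fibration_fst_of_isPullback hT
  have := fibration_snd_of_isPullback hT
  let u : A ⟶ U := hU.lift (p ≫ P.ι) (𝟙 _) (by simp)
  let δ : A ⟶ T := hT.lift (𝟙 _) u (by simp [u])
  -- Factoring the graph of `u : A ⟶ U` over `B` gives an object with trivial fibrations to both `A`
  -- and `U`, hence a comparison of the two that is stable under base change.
  let F := MorphismProperty.factorizationData (trivialCofibrations E) (fibrations E) δ
  let ev : F.Z ⟶ A := F.p ≫ T₁
  let e : F.Z ⟶ U := F.p ≫ T₂
  have : WeakEquivalence u := weakEquivalence_of_postcomp_of_fac (g := U₂)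
    (fg := 𝟙 _) (by simp [u])
  have : WeakEquivalence e := weakEquivalence_of_precomp_of_fac (f := F.i) (fg := u)
    (by simp [e, δ])
  have hev : F.i ≫ ev = 𝟙 _ := by simp [ev, δ]
  have : WeakEquivalence ev := weakEquivalence_of_precomp_of_fac hev
  have : Fibration e := inferInstance
  have : Fibration ev := inferInstance
  obtain ⟨R, R₁, R₂, hR⟩ := exists_isPullback f (ev ≫ p)
  obtain ⟨N, N₁, N₂, hN⟩ := exists_isPullback f (U₁ ≫ P.p₀)
  obtain ⟨K, K₁, K₂, hK⟩ := exists_isPullback f P.p₀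
  have := weq_fst_of_isPullback hK
  let t : R ⟶ Q := h.lift R₁ (R₂ ≫ ev) (by rw [Category.assoc, hR.w])
  have he : e ≫ U₁ ≫ P.p₀ = ev ≫ p := by
    simp only [e, ev, Category.assoc, hT.w]
  let n : R ⟶ N := hN.lift R₁ (R₂ ≫ e) (by rw [Category.assoc, he, hR.w])
  have : WeakEquivalence t := weq_fst_of_isPullback
    (isPullback_of_comp h hR rfl t (h.lift_fst _ _ _) (h.lift_snd _ _ _))
  have : WeakEquivalence n := weq_fst_of_isPullback
    (isPullback_of_comp hN hR he n (hN.lift_fst _ _ _) (hN.lift_snd _ _ _))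
  -- `K` is the mapping path object of `f`. Evaluation at the far end is a fibration because `C` is
  -- fibrant, and a weak equivalence because `f` is.
  let k : K ⟶ B := K₂ ≫ P.p₁
  have : Fibration (prod.lift P.p₀ P.p₁) := inferInstanceAs (Fibration P.p)
  have : Fibration (prod.lift K₁ k) := fibration_snd_of_isPullback (isPullback_path P.p₀ P.p₁ f hK)
  have : Fibration k := by
    rw [← prod.lift_snd K₁ k]
    infer_instance
  let c : C ⟶ K := hK.lift (𝟙 _) (f ≫ P.ι) (by simp)
  have : WeakEquivalence c := weakEquivalence_of_postcomp_of_fac (g := K₁)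
    (fg := 𝟙 _) (by simp [c])
  have : WeakEquivalence k := weakEquivalence_of_precomp_of_fac (f := c) (fg := f)
    (by simp [c, k])
  let m : N ⟶ K := hK.lift N₁ (N₂ ≫ U₁) (by rw [Category.assoc, hN.w])
  have hm : IsPullback m N₂ K₂ U₁ :=
    isPullback_of_comp hK hN rfl m (hK.lift_fst _ _ _) (hK.lift_snd _ _ _)
  have : WeakEquivalence (N₂ ≫ U₂) := weq_snd_of_isPullback (f := k) (hm.paste_vert hU)
  let s : Q ⟶ R := hR.lift fst (snd ≫ F.i) (by
    rw [Category.assoc, reassoc_of% hev, h.w])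
  have : WeakEquivalence s := weakEquivalence_of_postcomp_of_fac (g := t) (fg := 𝟙 _)
    (h.hom_ext (by simp [s, t]) (by simp [s, t, hev]))
  -- Here `s` is a section of a trivial fibration, while `n` and `N₂ ≫ U₂` are weak equivalences.
  have hs : s ≫ n ≫ N₂ ≫ U₂ = snd := by
    simp [s, n, e, δ, u]
  rw [← hs]
  infer_instance

/-- A pullback square of fibrant objects in which one of the legs is a fibration. -/
structure HoPullback {Q A B C : E} (fst : Q ⟶ C) (snd : Q ⟶ A) (f : C ⟶ B) (p : A ⟶ B) : Prop where
  isPullback : IsPullback fst snd f p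
  fibrant_left : IsFibrant C
  fibrant_right : IsFibrant A
  fibrant_base : IsFibrant B
  fib : Fibration f ∨ Fibration p

namespace HoPullback

lemma flip {Q A B C : E} {fst : Q ⟶ C} {snd : Q ⟶ A} {f : C ⟶ B} {p : A ⟶ B}
    (h : HoPullback fst snd f p) : HoPullback snd fst p f :=
  ⟨h.1.flip, h.3, h.2, h.4, h.5.symm⟩

lemma isFibrant {Q A B C : E} {fst : Q ⟶ C} {snd : Q ⟶ A} {f : C ⟶ B} {p : A ⟶ B}
    (h : HoPullback fst snd f p) : IsFibrant Q := by
  have := h.2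
  have := h.3
  rcases h.5 with h5 | h5
  · have := fibration_snd_of_isPullback h.1
    exact isFibrant_of_fibration snd
  · have := fibration_fst_of_isPullback h.1
    exact isFibrant_of_fibration fst

/-- With fibrations on both sides the comparison splits in two: replacing `A` by the base change of
`A'` to `B` is a weak equivalence of fibrations over `B`, and what remains is a base change of `c`
along the fibration `fst'`. -/
lemma weq_aux {Q A B C Q' A' B' C' : E} {fst : Q ⟶ C} {snd : Q ⟶ A} {f : C ⟶ B} {p : A ⟶ B}
    {fst' : Q' ⟶ C'} {snd' : Q' ⟶ A'} {f' : C' ⟶ B'} {p' : A' ⟶ B'}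
    (h : IsPullback fst snd f p) (h' : IsPullback fst' snd' f' p') [IsFibrant B] [IsFibrant B']
    [IsFibrant C] [IsFibrant C'] [Fibration p] [Fibration p'] (l : Q ⟶ Q')
    (a : A ⟶ A') (b : B ⟶ B') (c : C ⟶ C')
    (hl : l ≫ fst' = fst ≫ c) (hl' : l ≫ snd' = snd ≫ a) (hf : f ≫ b = c ≫ f')
    (hp : p ≫ b = a ≫ p') [WeakEquivalence a] [WeakEquivalence b] [WeakEquivalence c] :
    WeakEquivalence l := by
  obtain ⟨V, V₁, V₂, hV⟩ := exists_isPullback b p'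
  have := fibration_fst_of_isPullback hV
  have : WeakEquivalence V₂ := weq_snd_of_weq hV
  let a' : A ⟶ V := hV.lift p a hp
  have : WeakEquivalence a' := weakEquivalence_of_postcomp_of_fac (hV.lift_snd p a hp)
  obtain ⟨M, M₁, M₂, hM⟩ := exists_isPullback f V₁
  let m : M ⟶ Q' := h'.lift (M₁ ≫ c) (M₂ ≫ V₂)
    (by rw [Category.assoc, Category.assoc, ← hf, reassoc_of% hM.w, hV.w])
  let n : Q ⟶ M := hM.lift fst (snd ≫ a') (by simp [a', h.w])
  have : WeakEquivalence n := weq_baseChange h hM a' (hV.lift_fst _ _ _) n (hM.lift_fst _ _ _)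
    (hM.lift_snd _ _ _)
  have hm : IsPullback m M₁ fst' c :=
    isPullback_of_comp h'.flip (hM.paste_vert hV).flip hf.symm m (by simp [m]) (by simp [m])
  have := fibration_fst_of_isPullback h'
  have : WeakEquivalence m := weq_snd_of_weq hm.flip
  have : n ≫ m = l := h'.hom_ext (by simp [n, m, hl]) (by simp [n, m, a', hl'])
  rw [← this]
  infer_instance

/-- If only the other leg of the source is a fibration, `p` is first replaced by a fibration. Base
change along the fibration `f` does not notice this, and the replacement maps to `p'` by lifting. -/
lemma weq_of_fibration {Q A B C Q' A' B' C' : E} {fst : Q ⟶ C} {snd : Q ⟶ A} {f : C ⟶ B}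
    {p : A ⟶ B} {fst' : Q' ⟶ C'} {snd' : Q' ⟶ A'} {f' : C' ⟶ B'} {p' : A' ⟶ B'}
    (h : HoPullback fst snd f p) (h' : HoPullback fst' snd' f' p') [Fibration p'] (l : Q ⟶ Q')
    (a : A ⟶ A') (b : B ⟶ B') (c : C ⟶ C')
    (hl : l ≫ fst' = fst ≫ c) (hl' : l ≫ snd' = snd ≫ a) (hf : f ≫ b = c ≫ f')
    (hp : p ≫ b = a ≫ p') [WeakEquivalence a] [WeakEquivalence b] [WeakEquivalence c] :
    WeakEquivalence l := by
  have := h.2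
  have := h.3
  have := h.4
  have := h'.2
  have := h'.4
  rcases h.5 with h5 | h5
  · let F := MorphismProperty.factorizationData (trivialCofibrations E) (fibrations E) p
    obtain ⟨M, M₁, M₂, hM⟩ := exists_isPullback f F.p
    have sq : CommSq a F.i p' (F.p ≫ b) := ⟨by simp [hp]⟩
    have := isFibrant_of_fibration F.p
    have : WeakEquivalence sq.lift := weakEquivalence_of_precomp_of_fac sq.fac_left
    let m : M ⟶ Q' := h'.1.lift (M₁ ≫ c) (M₂ ≫ sq.lift)
      (by rw [Category.assoc, Category.assoc, sq.fac_right, ← hf, reassoc_of% hM.w])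
    let n : Q ⟶ M := hM.lift fst (snd ≫ F.i) (by simp [h.1.w])
    have : WeakEquivalence m := weq_aux hM h'.1 m sq.lift b c (by simp [m]) (by simp [m]) hf
      sq.fac_right.symm
    have : WeakEquivalence n := weq_aux h.1.flip hM.flip n (𝟙 _) (𝟙 _) F.i (by simp [n])
      (by simp [n]) (by simp) (by simp)
    have : n ≫ m = l := h'.1.hom_ext (by simp [n, m, hl]) (by simp [n, m, hl'])
    rw [← this]
    infer_instance
  · exact weq_aux h.1 h'.1 l a b c hl hl' hf hp

/-- Homotopy pullbacks preserve weak equivalences. -/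
lemma weq {Q A B C Q' A' B' C' : E} {fst : Q ⟶ C} {snd : Q ⟶ A} {f : C ⟶ B} {p : A ⟶ B}
    {fst' : Q' ⟶ C'} {snd' : Q' ⟶ A'} {f' : C' ⟶ B'} {p' : A' ⟶ B'}
    (h : HoPullback fst snd f p) (h' : HoPullback fst' snd' f' p') (l : Q ⟶ Q')
    (a : A ⟶ A') (b : B ⟶ B') (c : C ⟶ C')
    (hl : l ≫ fst' = fst ≫ c) (hl' : l ≫ snd' = snd ≫ a) (hf : f ≫ b = c ≫ f')
    (hp : p ≫ b = a ≫ p') [WeakEquivalence a] [WeakEquivalence b] [WeakEquivalence c] :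
    WeakEquivalence l := by
  rcases h'.5 with h5 | h5
  · exact weq_of_fibration h.flip h'.flip l c b a hl' hl hp hf
  · exact weq_of_fibration h h' l a b c hl hl' hf hp

end HoPullback

end HoPullbacks

/-! ### Finite products -/

section Products

/-- The maps `p i : P ⟶ B i` exhibit `P` as a product. -/
def IsProd {E : Type u₂} [Category.{v₂} E] {ι : Type u₃} {P : E} {B : ι → E}
    (p : ∀ i, P ⟶ B i) : Prop :=
  Nonempty (IsLimit (Fan.mk P p))

namespace IsProd

variable {E : Type u₂} [Category.{v₂} E] {ι : Type u₃} {P : E} {B : ι → E} {p : ∀ i, P ⟶ B i}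

/-- The map to a product with given components. -/
def lift (h : IsProd p) {X : E} (f : ∀ i, X ⟶ B i) : X ⟶ P :=
  Fan.IsLimit.lift h.some f

@[simp]
lemma lift_fac (h : IsProd p) {X : E} (f : ∀ i, X ⟶ B i) (i : ι) : h.lift f ≫ p i = f i :=
  Fan.IsLimit.fac h.some f i

@[simp]
lemma lift_fac_assoc (h : IsProd p) {X : E} (f : ∀ i, X ⟶ B i) (i : ι) {Z : E} (g : B i ⟶ Z) :
    h.lift f ≫ p i ≫ g = f i ≫ g := by
  rw [← Category.assoc, lift_fac]

lemma hom_ext (h : IsProd p) {X : E} {f g : X ⟶ P} (w : ∀ i, f ≫ p i = g ≫ p i) : f = g :=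
  Fan.IsLimit.hom_ext h.some f g w

lemma mk' (l : ∀ {X : E}, (∀ i, X ⟶ B i) → (X ⟶ P))
    (hl : ∀ {X : E} (f : ∀ i, X ⟶ B i) (i : ι), l f ≫ p i = f i)
    (ext : ∀ {X : E} (f g : X ⟶ P), (∀ i, f ≫ p i = g ≫ p i) → f = g) : IsProd p :=
  ⟨Fan.IsLimit.mk _ (fun s => l s.proj) (fun s j => hl s.proj j)
    (fun s _ hm => ext _ _ fun i => (hm i).trans (hl s.proj i).symm)⟩

lemma pi (B : ι → E) [HasProduct B] : IsProd (Pi.π B) := ⟨productIsProduct B⟩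

lemma comp_iso (h : IsProd p) {P' : E} (e : P' ⟶ P) [IsIso e] : IsProd fun i => e ≫ p i :=
  mk' (fun f => h.lift f ≫ inv e) (fun f i => by simp)
    (fun f g hfg => by
      rw [← cancel_mono e]
      exact h.hom_ext fun i => by simpa using hfg i)

lemma iso_comp (h : IsProd p) {B' : ι → E} (e : ∀ i, B i ⟶ B' i) [∀ i, IsIso (e i)] :
    IsProd fun i => p i ≫ e i :=
  mk' (fun f => h.lift fun i => f i ≫ inv (e i)) (fun f i => by simp)
    (fun f g hfg => h.hom_ext fun i => by
      rw [← cancel_mono (e i)]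
      simpa using hfg i)

lemma sigma (h : IsProd p) {κ : ι → Type v₃} {A : ∀ i, κ i → E} {q : ∀ i (j : κ i), B i ⟶ A i j}
    (hq : ∀ i, IsProd (q i)) :
    IsProd (ι := Σ i, κ i) (B := fun x => A x.1 x.2) fun x => p x.1 ≫ q x.1 x.2 :=
  mk' (fun f => h.lift fun i => (hq i).lift fun j => f ⟨i, j⟩)
    (fun f x => by simp)
    (fun f g hfg => h.hom_ext fun i => (hq i).hom_ext fun j => by simpa using hfg ⟨i, j⟩)

lemma reindex (h : IsProd p) {κ : Type v₃} (e : κ → ι) (he : Function.Bijective e) :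
    IsProd fun k => p (e k) := by
  obtain ⟨e, rfl⟩ : ∃ e' : κ ≃ ι, e = e' := ⟨Equiv.ofBijective e he, rfl⟩
  refine mk' (fun f => h.lift fun i => f (e.symm i) ≫ eqToHom (by simp)) (fun f k => ?_)
    (fun f g hfg => h.hom_ext fun i => ?_)
  · rw [lift_fac]
    have : ∀ k' (hk : k' = k), f k' ≫ eqToHom (by rw [hk]) = f k := by
      rintro _ rfl
      simp
    exact this _ (by simp)
  · obtain ⟨k, rfl⟩ := e.surjective i
    exact hfg k

lemma isPullback {ι : Type u₃} {Q C A D : E} {Q' C' A' D' : ι → E}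
    {q : ∀ i, Q ⟶ Q' i} {c : ∀ i, C ⟶ C' i} {a : ∀ i, A ⟶ A' i} {d : ∀ i, D ⟶ D' i}
    (hq : IsProd q) (hc : IsProd c) (ha : IsProd a) (hd : IsProd d)
    {fst : Q ⟶ C} {snd : Q ⟶ A} {f : C ⟶ D} {g : A ⟶ D}
    {fst' : ∀ i, Q' i ⟶ C' i} {snd' : ∀ i, Q' i ⟶ A' i} {f' : ∀ i, C' i ⟶ D' i}
    {g' : ∀ i, A' i ⟶ D' i}
    (h1 : ∀ i, fst ≫ c i = q i ≫ fst' i) (h2 : ∀ i, snd ≫ a i = q i ≫ snd' i)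
    (h3 : ∀ i, f ≫ d i = c i ≫ f' i) (h4 : ∀ i, g ≫ d i = a i ≫ g' i)
    (h : ∀ i, IsPullback (fst' i) (snd' i) (f' i) (g' i)) : IsPullback fst snd f g := by
  refine ⟨⟨hd.hom_ext fun i => ?_⟩, ⟨PullbackCone.IsLimit.mk _
    (fun s => hq.lift fun i => (h i).lift (s.fst ≫ c i) (s.snd ≫ a i) ?_) ?_ ?_ ?_⟩⟩
  · rw [Category.assoc, Category.assoc, h3, h4, reassoc_of% (h1 i), reassoc_of% (h2 i), (h i).w]
  · rw [Category.assoc, Category.assoc, ← h3, ← h4, s.condition_assoc]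
  · intro s
    exact hc.hom_ext fun i => by rw [Category.assoc, h1]; simp
  · intro s
    exact ha.hom_ext fun i => by rw [Category.assoc, h2]; simp
  · intro s m hm hm'
    refine hq.hom_ext fun i => (h i).hom_ext ?_ ?_
    · rw [Category.assoc, ← h1, reassoc_of% hm]; simp
    · rw [Category.assoc, ← h2, reassoc_of% hm']; simp

variable [ModelCategory E] [Finite ι] {P' : E} {B' : ι → E} {p' : ∀ i, P' ⟶ B' i}

lemma factor (h : IsProd p) (h' : IsProd p') (l : P ⟶ P') (f : ∀ i, B i ⟶ B' i)
    (hl : ∀ i, l ≫ p' i = p i ≫ f i) :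
    ∃ (a : P ≅ ∏ᶜ B) (b : ∏ᶜ B' ≅ P'), l = a.hom ≫ Limits.Pi.map f ≫ b.hom := by
  refine ⟨⟨Pi.lift p, h.lift (Pi.π B), h.hom_ext fun i => ?_, Pi.hom_ext _ _ fun i => ?_⟩,
    ⟨h'.lift (Pi.π B'), Pi.lift p', Pi.hom_ext _ _ fun i => ?_, h'.hom_ext fun i => ?_⟩,
    h'.hom_ext fun i => ?_⟩
  all_goals simp [hl]

lemma fibration (h : IsProd p) (h' : IsProd p') (l : P ⟶ P') (f : ∀ i, B i ⟶ B' i)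
    (hl : ∀ i, l ≫ p' i = p i ≫ f i) (hf : ∀ i, Fibration (f i)) : Fibration l := by
  obtain ⟨a, b, rfl⟩ := factor h h' l f hl
  infer_instance

/-- Products of trivial fibrations are weak equivalences directly. A general weak equivalence of
fibrant objects is a section of a trivial fibration followed by a trivial fibration, and this form
is inherited by products. -/
lemma weq (h : IsProd p) (h' : IsProd p') (l : P ⟶ P') (f : ∀ i, B i ⟶ B' i)
    (hl : ∀ i, l ≫ p' i = p i ≫ f i) (hB : ∀ i, IsFibrant (B i)) (hB' : ∀ i, IsFibrant (B' i))
    (hf : ∀ i, WeakEquivalence (f i)) : WeakEquivalence l := by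
  obtain ⟨a, b, rfl⟩ := factor h h' l f hl
  have F : ∀ i, FibrantBrownFactorization (f i) := fun i => Classical.arbitrary _
  have hr : Limits.Pi.map (fun i => (F i).i) ≫ Limits.Pi.map (fun i => (F i).r) = 𝟙 _ :=
    Pi.hom_ext _ _ fun i => by simp
  have hp : Limits.Pi.map (fun i => (F i).i) ≫ Limits.Pi.map (fun i => (F i).p) =
    Limits.Pi.map f := Pi.hom_ext _ _ fun i => by simp
  have : WeakEquivalence (Limits.Pi.map (fun i => (F i).i)) :=
    weakEquivalence_of_postcomp_of_fac hr
  have : WeakEquivalence (Limits.Pi.map f) := by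
    rw [← hp]
    infer_instance
  infer_instance

lemma isFibrant (h : IsProd p) (hB : ∀ i, IsFibrant (B i)) : IsFibrant P := by
  have h' : IsProd (ι := ι) (B := fun _ => ⊤_ E) fun _ => 𝟙 (⊤_ E) :=
    mk' (fun _ => terminal.from _) (fun _ _ => Subsingleton.elim _ _)
      (fun _ _ _ => Subsingleton.elim _ _)
  rw [isFibrant_iff]
  exact h.fibration h' _ (fun i => terminal.from (B i)) (fun i => Subsingleton.elim _ _)
    (fun i => (isFibrant_iff _).1 (hB i))

end IsProd

end Products

/-! ### Maps in the homotopy category -/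

section Localization

variable {E : Type u₂} [Category.{v₂} E] [ModelCategory E]
variable {H : Type u₃} [Category.{v₃} H] (L : E ⥤ H) [L.IsLocalization (weakEquivalences E)]

include L in
lemma isIso_map_of_weq {A B : E} (f : A ⟶ B) [WeakEquivalence f] : IsIso (L.map f) :=
  Localization.inverts L (weakEquivalences E) f ((weakEquivalence_iff f).1 inferInstance)

/-- Out of a cofibrant object into a fibrant one, equality in the homotopy category is left
homotopy; a good cylinder then allows the homotopy to be covered starting at `a`. -/
lemma exists_lift_of_fibration {X A B : E} [IsCofibrant X] [IsFibrant B] (p : A ⟶ B) [Fibration p]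
    (a : X ⟶ A) (b : X ⟶ B) (h : L.map (a ≫ p) = L.map b) :
    ∃ a' : X ⟶ A, a' ≫ p = b ∧ LeftHomotopyRel a a' := by
  obtain ⟨P, _, ⟨h⟩⟩ := ((LeftHomotopyRel.iff_map_eq L _ _).2 h).exists_good_cylinder
  obtain ⟨a', h', h1⟩ := h.covering_homotopy p a
  refine ⟨a', ?_, h'.leftHomotopyRel⟩
  rw [← h'.h₁, Category.assoc, h1, h.h₁]

lemma map_eq_of_leftHomotopyRel {X A : E} {f g : X ⟶ A} (h : LeftHomotopyRel f g) :
    L.map f = L.map g :=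
  h.factorsThroughLocalization.map_eq _

/-- This is how choices are transported backwards along maps of grids: a strict lift through `p'` is
found whose image under `φ` agrees with `a` only in the homotopy category. -/
lemma exists_lift_of_weq {X A B A' B' : E} [IsCofibrant X] [IsFibrant A'] [IsFibrant B']
    {p : A ⟶ B} {p' : A' ⟶ B'} {φ : A' ⟶ A} {ψ : B' ⟶ B} [Fibration p']
    [WeakEquivalence φ] [WeakEquivalence ψ] (w : φ ≫ p = p' ≫ ψ)
    (a : X ⟶ A) (b : X ⟶ B') (h : L.map (a ≫ p) = L.map (b ≫ ψ)) :
    ∃ a' : X ⟶ A', a' ≫ p' = b ∧ L.map (a' ≫ φ) = L.map a := by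
  have := isIso_map_of_weq L φ
  have := isIso_map_of_weq L ψ
  obtain ⟨a₀, h₀⟩ := map_surjective_of_isLocalization L X A' (L.map a ≫ inv (L.map φ))
  have h1 : L.map (a₀ ≫ φ) = L.map a := by simp [h₀]
  obtain ⟨a', h2, h3⟩ := exists_lift_of_fibration L p' a₀ b (by
    rw [← cancel_mono (L.map ψ), ← L.map_comp, ← L.map_comp, ← h, Category.assoc, ← w,
      ← Category.assoc, L.map_comp, h1, L.map_comp])
  exact ⟨a', h2, by rw [← h1, L.map_comp, ← map_eq_of_leftHomotopyRel L h3, L.map_comp]⟩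

lemma exists_iso_cofibrant (A : H) : ∃ (X : E) (_ : IsCofibrant X), Nonempty (L.obj X ≅ A) := by
  have := Localization.essSurj L (weakEquivalences E)
  obtain ⟨X, _, p, _, _⟩ := CofibrantObject.HoCat.exists_resolution (L.objPreimage A)
  have := isIso_map_of_weq L p
  exact ⟨X, inferInstance, ⟨asIso (L.map p) ≪≫ L.objObjPreimageIso A⟩⟩

/-- The localization functor preserves finite products of fibrant objects. -/
lemma IsProd.localization {ι : Type u₁} [Finite ι] {P : E} {B : ι → E} {p : ∀ i, P ⟶ B i}
    (h : IsProd p) (hB : ∀ i, IsFibrant (B i)) : IsProd fun i => L.map (p i) := by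
  have := h.isFibrant hB
  -- Every object of `H` is represented by a cofibrant one, from which maps to the fibrant factors
  -- are represented by genuine maps.
  have key : ∀ (A : H) (f : ∀ i, A ⟶ L.obj (B i)), ∃ g : A ⟶ L.obj P,
      ∀ i, g ≫ L.map (p i) = f i := by
    intro A f
    obtain ⟨X, _, ⟨e⟩⟩ := exists_iso_cofibrant L A
    choose g hg using fun i => map_surjective_of_isLocalization L X (B i) (e.hom ≫ f i)
    refine ⟨e.inv ≫ L.map (h.lift g), fun i => ?_⟩
    rw [Category.assoc, ← L.map_comp, h.lift_fac, hg, e.inv_hom_id_assoc]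
  choose l hl using key
  refine IsProd.mk' (fun f => l _ f) (fun f i => hl _ f i) (fun {A} f g hfg => ?_)
  obtain ⟨X, _, ⟨e⟩⟩ := exists_iso_cofibrant L A
  rw [← cancel_epi e.hom]
  obtain ⟨f', hf'⟩ := map_surjective_of_isLocalization L X P (e.hom ≫ f)
  obtain ⟨g', hg'⟩ := map_surjective_of_isLocalization L X P (e.hom ≫ g)
  rw [← hf', ← hg', ← LeftHomotopyRel.iff_map_eq]
  -- For uniqueness the homotopies in the factors must share one cylinder in order to assemble into
  -- a homotopy in the product.
  obtain ⟨Q, _⟩ := Cylinder.exists_very_good X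
  have H : ∀ i, Q.LeftHomotopy (f' ≫ p i) (g' ≫ p i) := fun i =>
    ((LeftHomotopyRel.iff_map_eq L _ _).2 (by
      rw [L.map_comp, L.map_comp, hf', hg', Category.assoc, Category.assoc, hfg])).leftHomotopy Q
  exact ⟨Q, ⟨{ h := h.lift fun i => (H i).h
               h₀ := h.hom_ext fun i => by simp
               h₁ := h.hom_ext fun i => by simp }⟩⟩

variable [HasZeroObject E] [HasZeroMorphisms E]

instance : IsCofibrant (0 : E) := by
  rw [isCofibrant_iff_of_isInitial (𝟙 0) HasZeroObject.zeroIsInitial]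
  infer_instance

instance : IsFibrant (0 : E) := by
  rw [isFibrant_iff_of_isTerminal (𝟙 0) HasZeroObject.zeroIsTerminal]
  infer_instance

/-- Zero maps behave as such in the homotopy category: both sides factor through the image of `0`,
and since `0` is cofibrant and initial, it has only one map to a fibrant replacement of `B`. -/
lemma map_zero_comp {X A B : E} (c : L.obj A ⟶ L.obj B) :
    L.map (0 : X ⟶ A) ≫ c = L.map (0 : X ⟶ B) := by
  obtain ⟨B', j, hj, _, _⟩ : ∃ (B' : E) (j : B ⟶ B'), Cofibration j ∧ WeakEquivalence j ∧
      IsFibrant B' :=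
    ⟨_, FibrantObject.HoCat.iResolutionObj B, inferInstance, inferInstance, inferInstance⟩
  have := isIso_map_of_weq L j
  have key : ∀ f g : L.obj 0 ⟶ L.obj B, f = g := by
    intro f g
    rw [← cancel_mono (L.map j)]
    obtain ⟨f', hf'⟩ := map_surjective_of_isLocalization L _ _ (f ≫ L.map j)
    obtain ⟨g', hg'⟩ := map_surjective_of_isLocalization L _ _ (g ≫ L.map j)
    rw [← hf', ← hg', (isZero_zero E).eq_of_src f' g']
  have h1 : (0 : X ⟶ A) = (0 : X ⟶ 0) ≫ (0 : 0 ⟶ A) := by simp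
  have h2 : (0 : X ⟶ B) = (0 : X ⟶ 0) ≫ (0 : 0 ⟶ B) := by simp
  rw [h1, h2, L.map_comp, L.map_comp, Category.assoc]
  exact congrArg _ (key _ _)

lemma map_eq_of_contractible {X W : E} (hW : WeakEquivalence (0 : (0 : E) ⟶ W)) (f g : X ⟶ W) :
    L.map f = L.map g := by
  have : WeakEquivalence (0 : W ⟶ (0 : E)) :=
    weakEquivalence_of_precomp_of_fac (f := (0 : (0 : E) ⟶ W)) (fg := 𝟙 0)
      ((isZero_zero E).eq_of_src _ _)
  have := isIso_map_of_weq L (0 : W ⟶ (0 : E))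
  rw [← cancel_mono (L.map (0 : W ⟶ (0 : E))), ← L.map_comp, ← L.map_comp, comp_zero, comp_zero]

lemma weq_of_contractible {W W' : E} (hW : WeakEquivalence (0 : (0 : E) ⟶ W))
    (hW' : WeakEquivalence (0 : (0 : E) ⟶ W')) (f : W ⟶ W') : WeakEquivalence f :=
  weakEquivalence_of_precomp_of_fac (f := (0 : (0 : E) ⟶ W)) (fg := (0 : (0 : E) ⟶ W'))
    zero_comp

lemma contractible_of_isZero {W : E} (hW : IsZero W) : WeakEquivalence (0 : (0 : E) ⟶ W) := by
  have : IsIso (0 : (0 : E) ⟶ W) := ⟨0, (isZero_zero E).eq_of_src _ _, hW.eq_of_src _ _⟩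
  infer_instance

lemma isFibrant_of_isZero {W : E} (hW : IsZero W) : IsFibrant W := by
  have : IsIso (0 : W ⟶ (0 : E)) := ⟨0, hW.eq_of_src _ _, (isZero_zero E).eq_of_src _ _⟩
  exact isFibrant_of_fibration (0 : W ⟶ 0)

end Localization

/-! ### Reduced matching objects over fully reduced categories -/

section Reduced

/-- The axioms of a fully reduced pointed indexing category used for pointed diagrams. -/
structure GradedIdeal.Reduced {C : Type u} [Category.{v} C] (D : GradedIdeal C) : Prop where
  null_comp : ∀ {x y z : C} (f : x ⟶ y) (g : y ⟶ z), D.null f → D.null (f ≫ g)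
  deg_lt : ∀ {x y : C} (f : x ⟶ y), D.deg y < D.deg x ∨ ∃ h : x = y, f = eqToHom h
  reduced : ∀ {x y : C} (f : x ⟶ y), D.deg y + 2 ≤ D.deg x → D.null f

lemma PointedIndexing.bdryIdeal_reduced {J : Type u} [Category.{v} J] (D : PointedIndexing J)
    (hD : D.FullyReduced) (x : J) (k : ℕ) : (D.bdryIdeal x k).Reduced where
  null_comp f g h := D.null_postcomp f.hom g.hom h
  deg_lt {s t} f := by
    refine (D.deg_lt f.hom).imp id ?_
    rintro ⟨h, hf⟩
    obtain ⟨s, hs⟩ := s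
    obtain ⟨t, ht⟩ := t
    obtain rfl : s = t := h
    exact ⟨rfl, ObjectProperty.hom_ext _ hf⟩
  reduced f h := hD f.hom h

lemma chainIdeal_reduced (n : ℕ) : (chainIdeal n).Reduced where
  null_comp {x y z} f g h := by
    have := leOfHom g
    simp only [chainIdeal, Fin.le_def] at *
    omega
  deg_lt {x y} f := by
    have h := leOfHom f
    by_cases hxy : x = y
    · exact Or.inr ⟨hxy, Subsingleton.elim _ _⟩
    · refine Or.inl ?_
      simp only [chainIdeal, Fin.le_def, Fin.ext_iff] at *
      omega
  reduced {x y} f h := by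
    simp only [chainIdeal] at *
    omega

variable {C : Type u} [Category.{v} C] {D : GradedIdeal C}
variable {E : Type u₂} [Category.{v₂} E] [HasZeroMorphisms E] [HasFiniteLimits E]

/-- The projection of the reduced matching object to the coordinate of a map lowering degree
by one. -/
def redProj (D : GradedIdeal C) (Y : C ⥤ E) (s : C) (e : OutOne D s) :
    redMatch D Y s ⟶ Y.obj e.1.1 :=
  forget D Y s ≫ Pi.π (fun e : Out D s (D.deg s) => Y.obj e.1.1)
    ⟨e.1, by have := e.2.1; omega, e.2.2⟩

/-- By full reducedness a non-null map lowering degree lowers it by exactly one, so no other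
coordinates exist. -/
lemma redMatch_hom_ext (hD : D.Reduced) (Y : C ⥤ E) (s : C) {X : E} {f g : X ⟶ redMatch D Y s}
    (h : ∀ e, f ≫ redProj D Y s e = g ≫ redProj D Y s e) : f = g := by
  refine equalizer.hom_ext (Pi.hom_ext _ _ fun e => ?_)
  have he : D.deg e.1.1 + 1 = D.deg s := by
    by_contra hne
    exact e.2.2 (hD.reduced _ (by have := e.2.1; omega))
  simpa [redProj, forget] using h ⟨e.1, he, e.2.2⟩

variable {Y : C ⥤ E} (hY : Pointed D Y)

lemma matchMap_redProj (s : C) (e : OutOne D s) :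
    matchMap D Y hY s ≫ redProj D Y s e = Y.map e.1.2 :=
  redMatchLift_forget _ _ _ _ _ (fun f g _ _ => (Y.map_comp f g).symm) _

lemma comp_matchMap_eq_zero_iff {X : E} {s : C} (a : X ⟶ Y.obj s) :
    a ≫ matchMap D Y hY s = 0 ↔
      ∀ {t : C} (g : s ⟶ t), D.deg t < D.deg s → a ≫ Y.map g = 0 := by
  have key : ∀ e : Out D s (D.deg s), matchMap D Y hY s ≫ forget D Y s ≫ Pi.π _ e = Y.map e.1.2 :=
    fun e => redMatchLift_forget _ _ _ _ _ (fun f g _ _ => (Y.map_comp f g).symm) _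
  constructor
  · intro h t g ht
    by_cases hg : D.null g
    · rw [hY g hg, comp_zero]
    · rw [← key ⟨⟨t, g⟩, ht, hg⟩, reassoc_of% h, zero_comp]
  · intro h
    refine equalizer.hom_ext (Pi.hom_ext _ _ fun e => ?_)
    have := key e
    simp only [forget] at this
    simp only [Category.assoc, this, zero_comp]
    exact h _ e.2.1

lemma redProj_map (hD : D.Reduced) {s : C} (e : OutOne D s) {t : C} (g : e.1.1 ⟶ t)
    (ht : D.deg t < D.deg e.1.1) : redProj D Y s e ≫ Y.map g = 0 := by
  have he := e.2.1
  have h := equalizer.condition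
    (Pi.lift fun r : OutRel D s (D.deg s) =>
      Pi.π (fun e : Out D s (D.deg s) => Y.obj e.1.1) r.1 ≫ Y.map r.2.1.2)
    (Pi.lift fun r : OutRel D s (D.deg s) =>
      coord D Y s (D.deg s) (r.1.1.2 ≫ r.2.1.2) r.2.2)
  have h' := h =≫ Pi.π _ ⟨⟨e.1, by omega, e.2.2⟩, ⟨⟨t, g⟩, by simp only; omega⟩⟩
  simp only [Category.assoc, Pi.lift_π, coord] at h'
  rw [dif_pos (hD.reduced _ (by omega)), comp_zero] at h'
  exact (Category.assoc _ _ _).trans h'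

lemma redProj_matchMap (hD : D.Reduced) {s : C} (e : OutOne D s) :
    redProj D Y s e ≫ matchMap D Y hY e.1.1 = 0 :=
  (comp_matchMap_eq_zero_iff hY _).2 fun g ht => redProj_map hD e g ht

include hY in
-- After one step of degree one, any further lowering of degree makes the composite null. Thus the
-- compatibility conditions only say that each coordinate is killed by the matching map of its own
-- object.
lemma exists_redMatch_lift (hD : D.Reduced) {s : C} {X : E} (a : ∀ e : OutOne D s, X ⟶ Y.obj e.1.1)
    (ha : ∀ e, a e ≫ matchMap D Y hY e.1.1 = 0) :
    ∃ l : X ⟶ redMatch D Y s, ∀ e, l ≫ redProj D Y s e = a e := by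
  have hdeg : ∀ {t : C} (f : s ⟶ t), D.deg t < D.deg s → ¬ D.null f →
      D.deg t + 1 = D.deg s := fun f ht hf => by
    by_contra hne
    exact hf (hD.reduced _ (by omega))
  refine ⟨redMatchLift D Y s
    (fun {t} f ht => if h : D.null f then 0 else a ⟨⟨t, f⟩, hdeg f ht h, h⟩)
    (fun f ht h => dif_pos h) (fun {t t'} f g ht ht' => ?_), fun e => ?_⟩
  · by_cases hf : D.null f
    · rw [dif_pos hf, dif_pos (hD.null_comp f g hf), zero_comp]
    -- Either `g` lowers degree and both sides vanish, or it is an identity in the guise of an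
    -- `eqToHom`.
    · rcases hD.deg_lt g with hg | ⟨rfl, rfl⟩
      · have := hdeg f ht hf
        have h0 := (comp_matchMap_eq_zero_iff hY _).1 (ha ⟨⟨t, f⟩, this, hf⟩) g hg
        rw [dif_neg hf, dif_pos (hD.reduced _ (by omega))]
        exact h0
      · have : ∀ f' : s ⟶ t, f' = f →
            (if h : D.null f then (0 : X ⟶ Y.obj t) else a ⟨⟨t, f⟩, hdeg f ht h, h⟩) =
              if h : D.null f' then 0 else a ⟨⟨t, f'⟩, hdeg f' ht h, h⟩ := by
          rintro _ rfl
          rfl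
        simpa using this (f ≫ eqToHom rfl) (by simp)
  · refine (redMatchLift_forget _ _ _ _ _ _ _).trans ?_
    exact dif_neg e.2.2

/-- The matching object is the strict fibre of `∏ Y t ⟶ ∏ redMatch t` over targets one degree lower.
This identifies the corner of a grid with a matching object, and also yields fibrancy. -/
lemma redMatch_isPullback (hD : D.Reduced) (s : C) {P Q : E}
    {p : ∀ e : OutOne D s, P ⟶ Y.obj e.1.1} {q : ∀ e : OutOne D s, Q ⟶ redMatch D Y e.1.1}
    (hp : IsProd p) (hq : IsProd q) {Z : E} (hZ : IsZero Z) {f : redMatch D Y s ⟶ P}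
    (hf : ∀ e, f ≫ p e = redProj D Y s e) {m : P ⟶ Q}
    (hm : ∀ e, m ≫ q e = p e ≫ matchMap D Y hY e.1.1) :
    IsPullback (0 : redMatch D Y s ⟶ Z) f 0 m := by
  have H : ∀ (c : PullbackCone (0 : Z ⟶ Q) m) (e : OutOne D s),
      (c.snd ≫ p e) ≫ matchMap D Y hY e.1.1 = 0 := fun c e => by
    rw [Category.assoc, ← hm, ← c.condition_assoc]
    simp
  refine ⟨⟨hq.hom_ext fun e => ?_⟩, ⟨PullbackCone.IsLimit.mk _
    (fun c => (exists_redMatch_lift hY hD (fun e => c.snd ≫ p e) (H c)).choose)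
    (fun c => hZ.eq_of_tgt _ _) (fun c => hp.hom_ext fun e => ?_)
    (fun c m' _ hm' => redMatch_hom_ext hD Y s fun e => ?_)⟩⟩
  · rw [Category.assoc f, hm, reassoc_of% (hf e), redProj_matchMap hY hD]
    simp
  · rw [Category.assoc, hf]
    exact (exists_redMatch_lift hY hD (fun e => c.snd ≫ p e) (H c)).choose_spec e
  · rw [(exists_redMatch_lift hY hD (fun e => c.snd ≫ p e) (H c)).choose_spec e, ← hf,
      reassoc_of% hm']

end Reduced

section ReedyFibrant

variable {C : Type u} [Category.{v} C] {D : GradedIdeal C}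
variable {E : Type u₂} [Category.{v₂} E] [ModelCategory E] [HasZeroObject E] [HasZeroMorphisms E]
variable {Y : C ⥤ E} {hY : Pointed D Y}

instance finite_outOne (D : GradedIdeal C) (s : C) : Finite (OutOne D s) := by
  have := D.finite_out s
  infer_instance

/-- The map from the fibre to `0` is a base change of a product of matching maps, so no induction on
degree is needed. -/
lemma PointedReedyFibrant.isFibrant_redMatch (hfib : PointedReedyFibrant D Y hY) (hD : D.Reduced)
    (s : C) : IsFibrant (redMatch D Y s) := by
  have hp := IsProd.pi (fun e : OutOne D s => Y.obj e.1.1)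
  have hq := IsProd.pi (fun e : OutOne D s => redMatch D Y e.1.1)
  have h := redMatch_isPullback hY hD s hp hq (isZero_zero E) (f := hp.lift (redProj D Y s))
    (fun e => hp.lift_fac _ e) (m := hq.lift fun e => Pi.π _ e ≫ matchMap D Y hY e.1.1)
    (fun e => hq.lift_fac _ e)
  have := IsProd.fibration hp hq _ _ (fun e => hq.lift_fac _ e)
    (fun e : OutOne D s => hfib e.1.1)
  have := fibration_fst_of_isPullback h
  exact isFibrant_of_fibration (0 : redMatch D Y s ⟶ 0)

lemma PointedReedyFibrant.isFibrant (hfib : PointedReedyFibrant D Y hY) (hD : D.Reduced) (s : C) :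
    IsFibrant (Y.obj s) := by
  have := hfib.isFibrant_redMatch hD s
  have := hfib s
  exact isFibrant_of_fibration (matchMap D Y hY s)

end ReedyFibrant

/-! ### Grids -/

section GridMaps

variable {E : Type u₂} [Category.{v₂} E] (B : ℕᵒᵖ ⥤ ℕᵒᵖ ⥤ E)

@[simp]
lemma hor_refl (j i : ℕ) : hor B (le_refl j) i = 𝟙 _ := by
  simp [hor]

@[simp]
lemma ver_refl (j i : ℕ) : ver B j (le_refl i) = 𝟙 _ := by
  simp [ver]

lemma hor_comp {j j' j'' : ℕ} (h : j ≤ j') (h' : j' ≤ j'') (i : ℕ) :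
    hor B h' i ≫ hor B h i = hor B (h.trans h') i := by
  rw [hor, hor, ← NatTrans.comp_app, ← Functor.map_comp]
  rfl

lemma ver_comp (j : ℕ) {i i' i'' : ℕ} (h : i ≤ i') (h' : i' ≤ i'') :
    ver B j h' ≫ ver B j h = ver B j (h.trans h') := by
  rw [ver, ver, ← Functor.map_comp]
  rfl

lemma hor_ver {j j' i i' : ℕ} (h : j ≤ j') (h' : i ≤ i') :
    hor B h i' ≫ ver B j h' = ver B j' h' ≫ hor B h i :=
  ((B.map (homOfLE h).op).naturality _).symm

lemma isIso_hor_of_eq {j j' : ℕ} (h : j ≤ j') (hj : j = j') (i : ℕ) : IsIso (hor B h i) := by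
  subst hj
  rw [hor_refl]
  infer_instance

variable {B} in
/-- Squares of a grid paste to rectangles. -/
lemma isPullback_rectangle {d : ℕ}
    (sq : ∀ j i : ℕ, j + 1 ≤ i → i + 1 ≤ d →
      IsPullback (hor B (Nat.le_succ j) (i + 1)) (ver B (j + 1) (Nat.le_succ i))
        (ver B j (Nat.le_succ i)) (hor B (Nat.le_succ j) i))
    {j j' i i' : ℕ} (hj : j ≤ j') (hi : i ≤ i') (hji : j' ≤ i) (hd : i' ≤ d) :
    IsPullback (hor B hj i') (ver B j' hi) (ver B j hi) (hor B hj i) := by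
  have key : ∀ j : ℕ, j + 1 ≤ i →
      IsPullback (hor B (Nat.le_succ j) i') (ver B (j + 1) hi) (ver B j hi)
        (hor B (Nat.le_succ j) i) := by
    intro j hj
    induction i', hi using Nat.le_induction with
    | base =>
      rw [ver_refl, ver_refl]
      exact IsPullback.of_vert_isIso ⟨by simp⟩
    | succ i' hi ih =>
      have := (sq j i' (by omega) hd).paste_vert (ih (by omega))
      rwa [ver_comp, ver_comp] at this
  induction j', hj using Nat.le_induction with
  | base =>
    rw [hor_refl, hor_refl]
    exact IsPullback.of_horiz_isIso ⟨by simp⟩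
  | succ j' hj ih =>
    have := (key j' hji).paste_horiz (ih (by omega))
    rwa [hor_comp, hor_comp] at this

end GridMaps

/-! ### Fibrations and homotopy pullbacks in a separation grid -/

section GridFacts

variable {C : Type u} [Category.{v} C] {D : GradedIdeal C}
variable {E : Type u₂} [Category.{v₂} E] [ModelCategory E] [HasZeroObject E] [HasZeroMorphisms E]

lemma IsProd.contractible {ι : Type u₃} [Finite ι] {P : E} {B : ι → E} {p : ∀ i, P ⟶ B i}
    (h : IsProd p) (hB : ∀ i, IsFibrant (B i)) (hw : ∀ i, WeakEquivalence (0 : (0 : E) ⟶ B i)) :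
    WeakEquivalence (0 : (0 : E) ⟶ P) := by
  have h0 : IsProd (ι := ι) (B := fun _ => (0 : E)) fun _ => 𝟙 (0 : E) :=
    mk' (fun _ => 0) (fun _ _ => (isZero_zero E).eq_of_tgt _ _)
      (fun _ _ _ => (isZero_zero E).eq_of_tgt _ _)
  exact h0.weq h _ (fun i => (0 : (0 : E) ⟶ B i)) (fun i => by simp)
    (fun _ => inferInstance) hB hw

lemma famTgt_deg {I : Type (max u v)} {tgt : I → C} {k : ℕ} (htgt : ∀ e, D.deg (tgt e) = k)
    (z : Option C) (e : Fam D I z) : D.deg (famTgt D tgt z e) + 1 = nodeDeg D k z := by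
  cases z with
  | none => exact congrArg (· + 1) (htgt e)
  | some s => exact e.2.1

instance {I : Type (max u v)} [Finite I] (z : Option C) : Finite (Fam D I z) := by
  cases z with
  | none => assumption
  | some s => exact finite_outOne D s

namespace SepGrid

variable {Y : C ⥤ E} {hY : Pointed D Y} {I : Type (max u v)} {tgt : I → C} {k : ℕ}
variable (G : SepGrid D Y hY I tgt k)

lemma rectangle (z : Option C) {j j' i i' : ℕ} (hj : j ≤ j') (hi : i ≤ i') (hji : j' ≤ i)
    (hd : i' ≤ nodeDeg D k z) :
    IsPullback (hor (G.F z) hj i') (ver (G.F z) j' hi) (ver (G.F z) j hi) (hor (G.F z) hj i) :=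
  isPullback_rectangle (G.square z) hj hi hji hd

lemma top_isProd (z : Option C) (h : 1 ≤ nodeDeg D k z) : IsProd (G.top z) :=
  G.top_isLimit z h

lemma row_isProd (z : Option C) (i : ℕ) (h : i + 2 ≤ nodeDeg D k z) : IsProd (G.row z i) :=
  G.row_isLimit z i h

lemma fibration_hor_succ (z : Option C) {j i : ℕ} (h : j + 2 < nodeDeg D k z) (hi : j + 1 ≤ i)
    (hd : i ≤ nodeDeg D k z) : Fibration (hor (G.F z) (Nat.le_succ j) i) := by
  have := G.fib z j h
  exact fibration_fst_of_isPullback (G.rectangle z (Nat.le_succ j) hi le_rfl hd)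

lemma fibration_hor (z : Option C) {j j' i : ℕ} (hj : j ≤ j') (h : j' + 1 < nodeDeg D k z)
    (hi : j' ≤ i) (hd : i ≤ nodeDeg D k z) : Fibration (hor (G.F z) hj i) := by
  induction j', hj using Nat.le_induction with
  | base =>
    rw [hor_refl]
    infer_instance
  | succ j' hj ih =>
    have := ih (by omega) (by omega)
    have := G.fibration_hor_succ z (j := j') (i := i) (by omega) hi hd
    rw [← hor_comp _ hj (Nat.le_succ j')]
    infer_instance

lemma diag_contractible (z : Option C) {j : ℕ} (h : j + 2 ≤ nodeDeg D k z) :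
    WeakEquivalence (0 : (0 : E) ⟶ entry (G.F z) (j + 1) (j + 1)) := by
  rcases h.lt_or_eq with h | h
  · exact G.weq z j h
  · have := G.last z (by omega)
    rw [← h] at this
    exact contractible_of_isZero this

variable (hD : D.Reduced) (hfib : PointedReedyFibrant D Y hY) [Finite I]
  (htgt : ∀ e, D.deg (tgt e) = k)

include hfib htgt

/-- The vertical maps out of the top row are fibrations. -/
lemma fibration_ver (z : Option C) {j d : ℕ} (hd : d + 1 = nodeDeg D k z) (h : 1 ≤ d)
    (hj : j ≤ d) : Fibration (ver (G.F z) j (by omega : d ≤ nodeDeg D k z)) := by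
  -- The other columns are base changes of column `0`.
  suffices H : Fibration (ver (G.F z) 0 (by omega : d ≤ nodeDeg D k z)) from
    fibration_snd_of_isPullback (G.rectangle z (Nat.zero_le j) (hd ▸ Nat.le_succ d) hj le_rfl)
  obtain ⟨i, rfl⟩ := Nat.exists_eq_add_of_le' h
  have hdeg := famTgt_deg htgt z
  refine (G.top_isProd z (by omega)).fibration (G.row_isProd z i (by omega)) _ _
    (fun e => G.top_ver z i e (by omega) (by have := hdeg e; omega) (by have := hdeg e; omega))
    (fun e => ?_)
  have := hfib (famTgt D tgt z e)
  -- For this `i` the horizontal factor in `top_ver` is an isomorphism, so each component is a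
  -- matching map up to isomorphism.
  have hi : i = D.deg (famTgt D tgt z e) - 1 := by have := hdeg e; omega
  have := isIso_hor_of_eq (G.F (some (famTgt D tgt z e))) hi.le hi (D.deg (famTgt D tgt z e))
  infer_instance

include hD

/-- All entries of a separation grid are fibrant. -/
lemma isFibrant_entry (z : Option C) {j i : ℕ} (hj : j < nodeDeg D k z) (h1 : 1 ≤ i) (hi : j ≤ i)
    (hd : i ≤ nodeDeg D k z) : IsFibrant (entry (G.F z) j i) := by
  obtain ⟨d, hz⟩ : ∃ d, nodeDeg D k z = d := ⟨_, rfl⟩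
  induction d using Nat.strong_induction_on generalizing z j i with
  | _ d ih =>
  have hdeg := famTgt_deg htgt z
  have h0 : ∀ i, 1 ≤ i → i ≤ d → IsFibrant (entry (G.F z) 0 i) := by
    intro i h1 hi
    rcases hi.lt_or_eq with hi | rfl
    · obtain ⟨i, rfl⟩ := Nat.exists_eq_add_of_le' h1
      refine (G.row_isProd z i (by omega)).isFibrant fun e => ?_
      have := hdeg e
      have hn : nodeDeg D k (some (famTgt D tgt z e)) = D.deg (famTgt D tgt z e) := rfl
      exact ih (D.deg (famTgt D tgt z e)) (by omega) _ (by omega) (by omega) (by omega) le_rfl rfl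
    · rw [← hz]
      exact (G.top_isProd z (by omega)).isFibrant fun e => hfib.isFibrant hD _
  by_cases hjd : j + 1 < d
  · have := G.fibration_hor z (Nat.zero_le j) (by omega) hi hd
    have := h0 i h1 (by omega)
    exact isFibrant_of_fibration (hor (G.F z) (Nat.zero_le j) i)
  -- In the leftmost column the horizontal maps need not be fibrations; fibrancy comes instead from
  -- the vertical fibration onto the zero object.
  · rcases Nat.eq_zero_or_pos j with rfl | hj0
    · exact h0 i h1 (by omega)
    · have hz0 : IsFibrant (entry (G.F z) j j) := by
        have := G.last z (by omega)
        rw [show nodeDeg D k z - 1 = j by omega] at this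
        exact isFibrant_of_isZero this
      rcases hi.lt_or_eq with hi | rfl
      · obtain rfl : i = nodeDeg D k z := by omega
        have := G.fibration_ver hfib htgt z (d := j) (by omega) hj0 le_rfl
        exact isFibrant_of_fibration (ver (G.F z) j hi.le)
      · exact hz0

/-- The entry in column `j + 1` and row `j + 2` as a homotopy pullback. -/
lemma hoPullback (z : Option C) {j : ℕ} (h : j + 3 ≤ nodeDeg D k z) {Q W : E}
    {q : ∀ e : Fam D I z, Q ⟶ entry (G.F (some (famTgt D tgt z e))) (j + 1) (j + 1)}
    {w : ∀ e : Fam D I z, W ⟶ entry (G.F (some (famTgt D tgt z e))) j (j + 1)}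
    (hq : IsProd q) (hw : IsProd w)
    (hs : ∀ e : Fam D I z, j + 1 ≤ D.deg (famTgt D tgt z e))
    {b : entry (G.F z) (j + 1) (j + 2) ⟶ Q}
    (hb : ∀ e, b ≫ q e = hor (G.F z) (Nat.zero_le _) _ ≫ G.row z (j + 1) e ≫ ver _ _ (hs e))
    {f : entry (G.F z) (j + 1) (j + 1) ⟶ W}
    (hf : ∀ e, f ≫ w e = hor (G.F z) (Nat.zero_le _) _ ≫ G.row z j e ≫ ver _ _ (hs e))
    {p : Q ⟶ W} (hp : ∀ e, p ≫ w e = q e ≫ hor _ (Nat.le_succ j) _) :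
    HoPullback (ver (G.F z) (j + 1) (Nat.le_succ (j + 1))) b f p := by
  have hdeg := famTgt_deg htgt z
  have hn : ∀ e, nodeDeg D k (some (famTgt D tgt z e)) = D.deg (famTgt D tgt z e) := fun _ => rfl
  have h1 := G.rectangle z (Nat.zero_le (j + 1)) (Nat.le_succ (j + 1)) le_rfl (by omega)
  have hR := G.row_isProd z (j + 1) (by omega)
  have hR' := G.row_isProd z j (by omega)
  have h2 : IsPullback (hq.lift fun e => G.row z (j + 1) e ≫ ver _ _ (hs e))
      (ver (G.F z) 0 (Nat.le_succ (j + 1))) p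
      (hw.lift fun e => G.row z j e ≫ ver _ _ (hs e)) :=
    IsProd.isPullback hR hq hR' hw (fun e => hq.lift_fac _ e) (fun e => G.row_ver z j e h)
      hp (fun e => hw.lift_fac _ e) (fun e =>
        (G.rectangle (some (famTgt D tgt z e)) (Nat.le_succ j) (hs e) le_rfl (hn e).ge).flip)
  have h3 := h1.paste_horiz h2
  have hP := G.isFibrant_entry hD hfib htgt z (j := j + 1) (i := j + 1) (by omega) (by omega)
    le_rfl (by omega)
  refine ⟨?_, hP, hq.isFibrant fun e => ?_, hw.isFibrant fun e => ?_, ?_⟩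
  · refine IsPullback.flip ?_
    convert h3 using 1
    · exact hq.hom_ext fun e => by simp [hb]
    · exact hw.hom_ext fun e => by simp [hf]
  · have := hdeg e
    have := hn e
    exact G.isFibrant_entry hD hfib htgt _ (by omega) (by omega) (by omega) (by omega)
  · have := hdeg e
    have := hn e
    exact G.isFibrant_entry hD hfib htgt _ (by omega) (by omega) (by omega) (by omega)
  -- Away from the leftmost column of the targets, `p` is a product of horizontal fibrations. In
  -- that column `p` may fail to be a fibration, but then the maps out of the top rows of the
  -- targets make `f` one.
  · rcases h.lt_or_eq with h' | h'
    · refine Or.inr (hq.fibration hw p _ hp fun e => ?_)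
      have := hdeg e
      have := hn e
      exact G.fib _ j (by omega)
    · left
      have e1 : f = hor (G.F z) (Nat.zero_le _) _ ≫
          hw.lift fun e => G.row z j e ≫ ver _ _ (hs e) :=
        hw.hom_ext fun e => by simp [hf]
      have := G.fibration_hor z (Nat.zero_le (j + 1)) (by omega) le_rfl (by omega)
      have : Fibration (hw.lift fun e => G.row z j e ≫ ver _ _ (hs e)) :=
        hR'.fibration hw _ _ (fun e => hw.lift_fac _ e) fun e => by
          have := hdeg e
          have := hn e
          exact G.fibration_ver hfib htgt (some (famTgt D tgt z e)) (d := j + 1) (by omega)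
            (by omega) (by omega)
      rw [e1]
      infer_instance

end SepGrid

end GridFacts

/-! ### Construction of grids -/

section Construction

variable {E : Type u₂} [Category.{v₂} E]

lemma map_comp_eq (T : ℕᵒᵖ ⥤ E) {a b b' c : ℕᵒᵖ} (f : a ⟶ b) (g : b ⟶ c) (f' : a ⟶ b')
    (g' : b' ⟶ c) : T.map f ≫ T.map g = T.map f' ≫ T.map g' := by
  rw [← T.map_comp, ← T.map_comp, Subsingleton.elim (f ≫ g)]

lemma isIso_map_of_eq (T : ℕᵒᵖ ⥤ E) {a b : ℕᵒᵖ} (f : a ⟶ b) (h : a = b) : IsIso (T.map f) := by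
  subst h
  rw [Subsingleton.elim f (𝟙 _), T.map_id]
  infer_instance

/-- The shape of column `0` of a grid: a tower of lower rows with a separately given top entry
placed above it. The entries are recovered only up to isomorphism, to avoid equalities of objects.
-/
lemma exists_functor_of_sequence (n : ℕ) {d : ℕ} (hd : d = n + 1) (A : ℕ → E)
    (a : ∀ i, A (i + 1) ⟶ A i) (T : E) (t : T ⟶ A n) :
    ∃ (B : ℕᵒᵖ ⥤ E) (α : ∀ i, i ≤ n → (B.obj (op i) ≅ A i)) (τ : B.obj (op d) ≅ T),
      (∀ (i : ℕ) (h : i + 1 ≤ n), B.map (homOfLE (Nat.le_succ i)).op ≫ (α i (by omega)).hom =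
        (α (i + 1) h).hom ≫ a i) ∧
      B.map (homOfLE (by omega : n ≤ d)).op ≫ (α n le_rfl).hom = τ.hom ≫ t := by
  subst hd
  obtain ⟨X, hX, hX'⟩ : ∃ X : ℕ → E, (∀ i, i ≤ n → X i = A i) ∧ ∀ i, n < i → X i = T :=
    ⟨fun i => if i ≤ n then A i else T, fun i h => if_pos h, fun i h => if_neg (by omega)⟩
  obtain ⟨f, hf, hf'⟩ : ∃ f : ∀ i, X (i + 1) ⟶ X i,
      (∀ (i : ℕ) (h : i + 1 ≤ n), f i ≫ eqToHom (hX i (by omega)) = eqToHom (hX _ h) ≫ a i) ∧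
        f n ≫ eqToHom (hX n le_rfl) = eqToHom (hX' _ (Nat.lt_succ_self n)) ≫ t := by
    refine ⟨fun i =>
      if h : i + 1 ≤ n then eqToHom (hX _ h) ≫ a i ≫ eqToHom (hX i (by omega)).symm
      else if h' : i = n then
        eqToHom (hX' _ (by omega)) ≫ t ≫ eqToHom (by subst h'; exact (hX _ le_rfl).symm)
      else eqToHom ((hX' _ (by omega)).trans (hX' i (by omega)).symm), fun i h => ?_, ?_⟩
    · simp [h]
    · simp
  refine ⟨Functor.ofOpSequence f, fun i h => eqToIso (hX i h),
    eqToIso (hX' _ (Nat.lt_succ_self n)), fun i h => ?_, ?_⟩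
  · rw [Functor.ofOpSequence_map_homOfLE_succ]
    exact hf i h
  · rw [Functor.ofOpSequence_map_homOfLE_succ]
    exact hf'

/-- The new column is the pullback, in the category of towers, of the tower `i ↦ T (max i m)` along
the constant tower on `p`. The rows below `m` are irrelevant, and the entry in row `m` is `P`
itself. -/
lemma exists_column [HasPullbacks E] (T : ℕᵒᵖ ⥤ E) (m : ℕ) {P : E} (p : P ⟶ T.obj (op m)) :
    ∃ (T' : ℕᵒᵖ ⥤ E) (f : T' ⟶ T) (e : T'.obj (op m) ≅ P), f.app (op m) = e.hom ≫ p ∧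
      ∀ i, m ≤ i → IsPullback (f.app (op (i + 1))) (T'.map (homOfLE (Nat.le_succ i)).op)
        (T.map (homOfLE (Nat.le_succ i)).op) (f.app (op i)) := by
  let sh : ℕ ⥤ ℕ := Monotone.functor (f := fun i => max i m) (fun i j h => max_le_max_right m h)
  let a : sh.op ⋙ T ⟶ (Functor.const _).obj (T.obj (op m)) :=
    { app := fun i => T.map (homOfLE (le_max_right i.unop m)).op
      naturality := fun i j g => by
        rw [Functor.const_obj_map, ← T.map_id]
        exact map_comp_eq T _ _ _ _ }
  let b : sh.op ⋙ T ⟶ T :=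
    { app := fun i => T.map (homOfLE (le_max_left i.unop m)).op
      naturality := fun i j g => map_comp_eq T _ _ _ _ }
  let q : (Functor.const ℕᵒᵖ).obj P ⟶ (Functor.const _).obj (T.obj (op m)) :=
    (Functor.const _).map p
  have hpb := IsPullback.of_hasPullback a q
  have hev : ∀ i : ℕ, IsPullback ((pullback.fst a q).app (op i)) ((pullback.snd a q).app (op i))
      (a.app (op i)) p := fun i => hpb.map ((evaluation _ _).obj (op i))
  have hfb : ∀ i (hi : m ≤ i), IsPullback ((pullback.fst a q ≫ b).app (op i))
      ((pullback.snd a q).app (op i)) (T.map (homOfLE hi).op) p := fun i hi => by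
    have : IsIso (b.app (op i)) := isIso_map_of_eq T _ (congrArg op (max_eq_left hi))
    refine IsPullback.of_iso (hev i) (Iso.refl _) (asIso (b.app (op i))) (Iso.refl _) (Iso.refl _)
      ?_ ?_ ?_ ?_
    · simp
    · simp
    · exact (Category.comp_id _).trans
        ((congrArg T.map (Subsingleton.elim _ _)).trans (T.map_comp _ _))
    · simp
  have hm : IsIso ((pullback.snd a q).app (op m)) := by
    have := isIso_map_of_eq T (homOfLE (le_refl m)).op rfl
    exact (hfb m le_rfl).isIso_snd_of_isIso
  refine ⟨pullback a q, pullback.fst a q ≫ b, asIso ((pullback.snd a q).app (op m)), ?_,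
    fun i hi => ?_⟩
  · have h := (hfb m le_rfl).w
    rw [Subsingleton.elim (homOfLE (le_refl m)).op (𝟙 _), T.map_id, Category.comp_id] at h
    exact h
  · have h := hfb (i + 1) (by omega)
    have h1 : T.map (homOfLE (Nat.le_succ i)).op ≫ T.map (homOfLE hi).op =
        T.map (homOfLE (by omega : m ≤ i + 1)).op := by
      rw [← T.map_comp]
      rfl
    have h2 : (pullback a q).map (homOfLE (Nat.le_succ i)).op ≫ (pullback.snd a q).app (op i) =
        (pullback.snd a q).app (op (i + 1)) := by
      rw [(pullback.snd a q).naturality]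
      simp
    rw [← h1, ← h2] at h
    exact (IsPullback.of_right h.flip ((pullback.fst a q ≫ b).naturality _) (hfb i hi).flip).flip

variable [ModelCategory E] [HasZeroObject E] [HasZeroMorphisms E]

/-- Every column of entries extends to a grid in which the entries on the diagonal come from
factorizations. -/
lemma exists_grid (T : ℕᵒᵖ ⥤ E) (d : ℕ) :
    ∃ (B : ℕᵒᵖ ⥤ ℕᵒᵖ ⥤ E) (_ : B.obj (op 0) ≅ T),
      (∀ j i : ℕ, j + 1 ≤ i →
        IsPullback (hor B (Nat.le_succ j) (i + 1)) (ver B (j + 1) (Nat.le_succ i))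
          (ver B j (Nat.le_succ i)) (hor B (Nat.le_succ j) i)) ∧
      (∀ j, j + 2 < d → WeakEquivalence (0 : (0 : E) ⟶ entry B (j + 1) (j + 1)) ∧
        IsCofibrant (entry B (j + 1) (j + 1)) ∧ Fibration (hor B (Nat.le_succ j) (j + 1))) ∧
      ∀ j, d ≤ j + 2 → IsZero (entry B (j + 1) (j + 1)) := by
  have step : ∀ (j : ℕ) (T : ℕᵒᵖ ⥤ E), ∃ (T' : ℕᵒᵖ ⥤ E) (f : T' ⟶ T),
      (∀ i, j + 1 ≤ i → IsPullback (f.app (op (i + 1))) (T'.map (homOfLE (Nat.le_succ i)).op)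
        (T.map (homOfLE (Nat.le_succ i)).op) (f.app (op i))) ∧
      (j + 2 < d → WeakEquivalence (0 : (0 : E) ⟶ T'.obj (op (j + 1))) ∧
        IsCofibrant (T'.obj (op (j + 1))) ∧ Fibration (f.app (op (j + 1)))) ∧
      (d ≤ j + 2 → IsZero (T'.obj (op (j + 1)))) := by
    intro j T
    -- Within this range the diagonal entry is a path object factored from zero, cofibrant because
    -- it receives a trivial cofibration from `0`; beyond it the zero object is used.
    by_cases h : j + 2 < d
    · let F := MorphismProperty.factorizationData (trivialCofibrations E) (fibrations E)
        (0 : (0 : E) ⟶ T.obj (op (j + 1)))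
      obtain ⟨T', f, e, he, hT'⟩ := exists_column T (j + 1) F.p
      have h1 : Cofibration F.i := ⟨F.hi.1⟩
      have h2 : WeakEquivalence F.i := ⟨F.hi.2⟩
      have h3 : Fibration F.p := ⟨F.hp⟩
      have h4 : (0 : (0 : E) ⟶ T'.obj (op (j + 1))) = F.i ≫ e.inv :=
        (isZero_zero E).eq_of_src _ _
      refine ⟨T', f, hT', fun _ => ⟨?_, ?_, ?_⟩, fun h' => absurd h (by omega)⟩
      · rw [h4]
        infer_instance
      · exact isCofibrant_of_cofibration (F.i ≫ e.inv)
      · rw [he]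
        infer_instance
    · obtain ⟨T', f, e, he, hT'⟩ := exists_column T (j + 1) (0 : (0 : E) ⟶ _)
      exact ⟨T', f, hT', fun h' => absurd h' h, fun _ => (isZero_zero E).of_iso e⟩
  choose next f h1 h2 h3 using step
  let X : ℕ → ℕᵒᵖ ⥤ E := fun j => Nat.rec T next j
  have hmap : ∀ j, (Functor.ofOpSequence (X := X) fun j => f j (X j)).map
      (homOfLE (Nat.le_succ j)).op = f j (X j) := fun j =>
    Functor.ofOpSequence_map_homOfLE_succ (X := X) (fun j => f j (X j)) j
  refine ⟨Functor.ofOpSequence (X := X) fun j => f j (X j), Iso.refl _, fun j i hi => ?_,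
    fun j hj => ?_, fun j hj => h3 j (X j) hj⟩
  · rw [hor, hor, hmap]
    exact h1 j (X j) i hi
  · rw [hor, hmap]
    exact h2 j (X j) hj

end Construction

/-! ### The conditions on a grid at a single node -/

section Nodes

/-- Well-founded recursion on `r` in which a choice has to exist only when all earlier choices are
good. An arbitrary value stands in otherwise, and induction shows that it is never taken. -/
lemma exists_section {α : Type u₁} (r : α → ℕ) {A : α → Type v₁} [∀ z, Nonempty (A z)]
    (Good : ∀ z, A z → (∀ w, r w < r z → A w) → Prop)
    (h : ∀ z (low : ∀ w, r w < r z → A w),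
      (∀ w hw, Good w (low w hw) fun w' hw' => low w' (hw'.trans hw)) → ∃ a, Good z a low) :
    ∃ f : ∀ z, A z, ∀ z, Good z (f z) fun w _ => f w := by
  let step : ∀ z, (∀ w, r w < r z → A w) → A z := fun z low =>
    if H : ∃ a, Good z a low then H.choose else Classical.arbitrary _
  let f := WellFounded.fix (C := A) (InvImage.wf r Nat.lt_wfRel.wf) step
  have hf : ∀ z, f z = step z fun w _ => f w := fun z =>
    WellFounded.fix_eq (C := A) (InvImage.wf r Nat.lt_wfRel.wf) step z
  refine ⟨f, fun z => ?_⟩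
  obtain ⟨n, hn⟩ : ∃ n, r z = n := ⟨_, rfl⟩
  induction n using Nat.strong_induction_on generalizing z with
  | _ n ih =>
  have H : ∃ a, Good z a fun w _ => f w := h z _ fun w hw => ih (r w) (hn ▸ hw) w rfl
  have e : f z = H.choose := (hf z).trans (dif_pos H)
  rw [e]
  exact H.choose_spec

variable {E : Type u₂} [Category.{v₂} E] [ModelCategory E] [HasZeroObject E] [HasZeroMorphisms E]
variable {C : Type u} [Category.{v} C] (D : GradedIdeal C)
variable (Y : C ⥤ E) (hY : Pointed D Y) {I : Type (max u v)} (tgt : I → C) (k : ℕ)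

/-- The object which the entry in the upper left corner of the grid of a node has to be. -/
def cornerMatch : Option C → E
  | none => 0
  | some s => redMatch D Y s

/-- The coordinates of this object. -/
def cornerProj : (z : Option C) → (e : Fam D I z) → (cornerMatch D Y z ⟶ Y.obj (famTgt D tgt z e))
  | none, _ => 0
  | some s, e => redProj D Y s e

/-- The data of a separation grid at a single node. -/
structure NodeData (z : Option C) where
  F : ℕᵒᵖ ⥤ ℕᵒᵖ ⥤ E
  top : ∀ e : Fam D I z, entry F 0 (nodeDeg D k z) ⟶ Y.obj (famTgt D tgt z e)
  mat : cornerMatch D Y z ⟶ entry F (nodeDeg D k z - 1) (nodeDeg D k z)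

instance (z : Option C) : Nonempty (NodeData D Y tgt k z) :=
  ⟨⟨(Functor.const _).obj ((Functor.const _).obj 0), fun _ => 0, 0⟩⟩

variable {D Y tgt k}

/-- The properties of a separation grid at a single node, relative to the grids of the targets of
the node. -/
structure NodeData.Good {z : Option C} (a : NodeData D Y tgt k z)
    (b : ∀ e : Fam D I z, NodeData D Y tgt k (some (famTgt D tgt z e))) : Prop where
  square : ∀ j i : ℕ, j + 1 ≤ i → i + 1 ≤ nodeDeg D k z →
    IsPullback (hor a.F (Nat.le_succ j) (i + 1)) (ver a.F (j + 1) (Nat.le_succ i))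
      (ver a.F j (Nat.le_succ i)) (hor a.F (Nat.le_succ j) i)
  free : ∀ j : ℕ, j + 2 < nodeDeg D k z →
    WeakEquivalence (0 : (0 : E) ⟶ entry a.F (j + 1) (j + 1)) ∧
      IsCofibrant (entry a.F (j + 1) (j + 1)) ∧ Fibration (hor a.F (Nat.le_succ j) (j + 1))
  last : 2 ≤ nodeDeg D k z → IsZero (entry a.F (nodeDeg D k z - 1) (nodeDeg D k z - 1))
  top_isProd : 1 ≤ nodeDeg D k z → IsProd a.top
  row : ∃ row : ∀ (i : ℕ) (e : Fam D I z),
      entry a.F 0 (i + 1) ⟶ entry (b e).F i (D.deg (famTgt D tgt z e)),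
    (∀ i, i + 2 ≤ nodeDeg D k z → IsProd (row i)) ∧
    (∀ (i : ℕ) (e : Fam D I z), i + 3 ≤ nodeDeg D k z →
      ver a.F 0 (Nat.le_succ (i + 1)) ≫ row i e =
        row (i + 1) e ≫ hor (b e).F (Nat.le_succ i) _) ∧
    ∀ (i : ℕ) (e : Fam D I z) (hi : i + 2 ≤ nodeDeg D k z)
      (h : i ≤ D.deg (famTgt D tgt z e) - 1),
      ver a.F 0 (by omega : i + 1 ≤ nodeDeg D k z) ≫ row i e =
        a.top e ≫ matchMap D Y hY (famTgt D tgt z e) ≫ (b e).mat ≫ hor (b e).F h _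
  mat_isIso : 1 ≤ nodeDeg D k z → z.isSome → IsIso a.mat
  mat_proj : 1 ≤ nodeDeg D k z → z.isSome → ∀ e,
    a.mat ≫ hor a.F (Nat.zero_le _) _ ≫ a.top e = cornerProj D Y tgt z e

omit [HasZeroObject E] in
lemma isZero_redMatch (hD : D.Reduced) {s : C} (hs : D.deg s = 0) : IsZero (redMatch D Y s) := by
  rw [IsZero.iff_id_eq_zero]
  refine redMatch_hom_ext hD Y s fun e => ?_
  have := e.2.1
  omega

/-- The pullback rectangle from the corner to column `0` has a zero object at its bottom left, so it
exhibits the corner as the same fibre which describes the matching object. -/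
lemma exists_corner_iso (hD : D.Reduced) {s : C} (hs : 1 ≤ D.deg s) {B : ℕᵒᵖ ⥤ ℕᵒᵖ ⥤ E}
    (sq : ∀ j i : ℕ, j + 1 ≤ i → i + 1 ≤ D.deg s →
      IsPullback (hor B (Nat.le_succ j) (i + 1)) (ver B (j + 1) (Nat.le_succ i))
        (ver B j (Nat.le_succ i)) (hor B (Nat.le_succ j) i))
    (last : 2 ≤ D.deg s → IsZero (entry B (D.deg s - 1) (D.deg s - 1)))
    {p : ∀ e : OutOne D s, entry B 0 (D.deg s) ⟶ Y.obj e.1.1} (hp : IsProd p)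
    (hq : 2 ≤ D.deg s → ∃ q : ∀ e : OutOne D s, entry B 0 (D.deg s - 1) ⟶ redMatch D Y e.1.1,
      IsProd q ∧ ∀ e, ver B 0 (Nat.sub_le _ _) ≫ q e = p e ≫ matchMap D Y hY e.1.1) :
    ∃ m : redMatch D Y s ⟶ entry B (D.deg s - 1) (D.deg s), IsIso m ∧
      ∀ e, m ≫ hor B (Nat.zero_le _) (D.deg s) ≫ p e = redProj D Y s e := by
  rcases hs.lt_or_eq with h2 | h1
  · obtain ⟨q, hq, hv⟩ := hq h2
    have h := redMatch_isPullback hY hD s hp hq (last h2) (f := hp.lift (redProj D Y s))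
      (fun e => hp.lift_fac _ e) hv
    have h' := isPullback_rectangle sq (Nat.zero_le (D.deg s - 1)) (Nat.sub_le (D.deg s) 1) le_rfl
      le_rfl
    rw [(last h2).eq_of_src (hor B (Nat.zero_le _) _) 0] at h'
    refine ⟨(h.isoIsPullback _ _ h'.flip).hom, inferInstance, fun e => ?_⟩
    rw [IsPullback.isoIsPullback_hom_snd_assoc, hp.lift_fac]
  -- In degree one all targets have zero matching object, so the fibre is the full product, and the
  -- leftmost column is column `0`.
  · have hq : IsProd fun e : OutOne D s => (0 : (0 : E) ⟶ redMatch D Y e.1.1) := by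
      have hz : ∀ e : OutOne D s, IsZero (redMatch D Y e.1.1) := fun e =>
        isZero_redMatch hD (by have := e.2.1; omega)
      exact IsProd.mk' (fun _ => 0) (fun f i => (hz i).eq_of_tgt _ _)
        (fun f g _ => (isZero_zero E).eq_of_tgt _ _)
    have hz : ∀ e : OutOne D s, IsZero (redMatch D Y e.1.1) := fun e =>
      isZero_redMatch hD (by have := e.2.1; omega)
    have h := redMatch_isPullback hY hD s hp hq (isZero_zero E) (f := hp.lift (redProj D Y s))
      (fun e => hp.lift_fac _ e) (m := 0) (fun e => (hz e).eq_of_tgt _ _)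
    have : IsIso (0 : (0 : E) ⟶ 0) := by
      rw [(isZero_zero E).eq_of_src 0 (𝟙 (0 : E))]
      infer_instance
    have := h.isIso_snd_of_isIso
    have := isIso_hor_of_eq B (Nat.zero_le (D.deg s - 1)) (by omega) (D.deg s)
    refine ⟨hp.lift (redProj D Y s) ≫ inv (hor B (Nat.zero_le (D.deg s - 1)) (D.deg s)),
      inferInstance, fun e => ?_⟩
    simp

end Nodes

/-! ### Existence of separation grids, by recursion on the degree of the node -/

section ExistsGrid

variable {E : Type u₂} [Category.{v₂} E] [ModelCategory E] [HasZeroObject E] [HasZeroMorphisms E]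
variable {C : Type u} [Category.{v} C] {D : GradedIdeal C}
variable {Y : C ⥤ E} {hY : Pointed D Y} {I : Type (max u v)} [Finite I] {tgt : I → C} {k : ℕ}

lemma NodeData.exists_column_zero (htgt : ∀ e, D.deg (tgt e) = k) (z : Option C) {n : ℕ}
    (hn : nodeDeg D k z = n + 1)
    (b : ∀ e : Fam D I z, NodeData D Y tgt k (some (famTgt D tgt z e))) :
    ∃ (T : ℕᵒᵖ ⥤ E) (top : ∀ e : Fam D I z, T.obj (op (nodeDeg D k z)) ⟶ Y.obj (famTgt D tgt z e))
      (row : ∀ (i : ℕ) (e : Fam D I z),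
        T.obj (op (i + 1)) ⟶ entry (b e).F i (D.deg (famTgt D tgt z e))),
      IsProd top ∧ (∀ i, i + 1 ≤ n → IsProd (row i)) ∧
      (∀ (i : ℕ) (e : Fam D I z), i + 2 ≤ n →
        T.map (homOfLE (Nat.le_succ (i + 1))).op ≫ row i e =
          row (i + 1) e ≫ hor (b e).F (Nat.le_succ i) _) ∧
      ∀ (i : ℕ) (e : Fam D I z) (_ : i + 1 = n) (h : i ≤ D.deg (famTgt D tgt z e) - 1),
        T.map (homOfLE (by omega : i + 1 ≤ nodeDeg D k z)).op ≫ row i e =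
          top e ≫ matchMap D Y hY (famTgt D tgt z e) ≫ (b e).mat ≫ hor (b e).F h _ := by
  have hdeg := famTgt_deg htgt z
  let A : ℕ → E := fun i => match i with
    | 0 => 0
    | i + 1 => ∏ᶜ fun e : Fam D I z => entry (b e).F i (D.deg (famTgt D tgt z e))
  let a : ∀ i, A (i + 1) ⟶ A i := fun i => match i with
    | 0 => 0
    | i + 1 => Limits.Pi.map fun e => hor (b e).F (Nat.le_succ i) _
  let t : (∏ᶜ fun e : Fam D I z => Y.obj (famTgt D tgt z e)) ⟶ A n := match n, hn with
    | 0, _ => 0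
    | m + 1, hn => Limits.Pi.map fun e => matchMap D Y hY (famTgt D tgt z e) ≫ (b e).mat ≫
        hor (b e).F (by
          have := hdeg e
          change m ≤ D.deg (famTgt D tgt z e) - 1
          omega) _
  obtain ⟨T, α, τ, h1, h2⟩ := exists_functor_of_sequence n hn A a _ t
  obtain ⟨row, hrow⟩ : ∃ row : ∀ (i : ℕ) (e : Fam D I z),
      T.obj (op (i + 1)) ⟶ entry (b e).F i (D.deg (famTgt D tgt z e)),
      ∀ (i : ℕ) (h : i + 1 ≤ n), row i = fun e => (α (i + 1) h).hom ≫
        Pi.π (fun e : Fam D I z => entry (b e).F i (D.deg (famTgt D tgt z e))) e :=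
    ⟨fun i => if h : i + 1 ≤ n then fun e => (α (i + 1) h).hom ≫
      Pi.π (fun e : Fam D I z => entry (b e).F i (D.deg (famTgt D tgt z e))) e else fun _ => 0,
      fun i h => dif_pos h⟩
  refine ⟨T, fun e => τ.hom ≫ Pi.π _ e, row, (IsProd.pi _).comp_iso τ.hom, fun i h => ?_,
    fun i e h => ?_, fun i e hi h => ?_⟩
  · rw [hrow i h]
    exact (IsProd.pi _).comp_iso (α (i + 1) h).hom
  · rw [hrow i (by omega), hrow (i + 1) (by omega), ← Category.assoc, h1 (i + 1) h,
      Category.assoc, Category.assoc]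
    refine congrArg _ ?_
    exact Pi.map_π _ _
  · subst hi
    rw [hrow i le_rfl, reassoc_of% h2, Category.assoc]
    refine congrArg _ ?_
    exact Pi.map_π _ _

lemma NodeData.exists_good (hD : D.Reduced) (htgt : ∀ e, D.deg (tgt e) = k) (z : Option C)
    (b : ∀ e : Fam D I z, NodeData D Y tgt k (some (famTgt D tgt z e)))
    (hb : ∀ e, 1 ≤ D.deg (famTgt D tgt z e) → IsIso (b e).mat) :
    ∃ a : NodeData D Y tgt k z, a.Good hY b := by
  have hdeg := famTgt_deg htgt z
  rcases Nat.eq_zero_or_pos (nodeDeg D k z) with h0 | h0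
  · refine ⟨Classical.arbitrary _, ⟨?_, ?_, ?_, ?_, ⟨fun _ _ => 0, ?_, ?_, ?_⟩, ?_, ?_⟩⟩ <;>
      intros <;> omega
  obtain ⟨n, hn⟩ := Nat.exists_eq_add_of_le' h0
  obtain ⟨T, top, row, hT, hr, hrv, htv⟩ := exists_column_zero (hY := hY) htgt z hn b
  obtain ⟨B, iso, sq, free, last⟩ := exists_grid T (nodeDeg D k z)
  have hlast : 2 ≤ nodeDeg D k z → IsZero (entry B (nodeDeg D k z - 1) (nodeDeg D k z - 1)) := by
    intro h
    have := last (nodeDeg D k z - 2) (by omega)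
    rwa [show nodeDeg D k z - 2 + 1 = nodeDeg D k z - 1 by omega] at this
  have hnat : ∀ {i i' : ℕ} (h : i ≤ i'), ver B 0 h ≫ iso.hom.app (op i) =
      iso.hom.app (op i') ≫ T.map (homOfLE h).op := fun h => iso.hom.naturality _
  let top' : ∀ e : Fam D I z, entry B 0 (nodeDeg D k z) ⟶ Y.obj (famTgt D tgt z e) :=
    fun e => iso.hom.app (op (nodeDeg D k z)) ≫ top e
  have hT' : IsProd top' := hT.comp_iso (iso.hom.app (op (nodeDeg D k z)))
  let row' : ∀ (i : ℕ) (e : Fam D I z), entry B 0 (i + 1) ⟶ _ :=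
    fun i e => iso.hom.app (op (i + 1)) ≫ row i e
  have hr' : ∀ i, i + 1 ≤ n → IsProd (row' i) := fun i h =>
    (hr i h).comp_iso (iso.hom.app (op (i + 1)))
  have hrv' : ∀ (i : ℕ) (e : Fam D I z), i + 2 ≤ n →
      ver B 0 (Nat.le_succ (i + 1)) ≫ row' i e = row' (i + 1) e ≫ hor (b e).F (Nat.le_succ i) _ := by
    intro i e h
    simp only [row']
    rw [← Category.assoc, hnat, Category.assoc, hrv i e h, Category.assoc]
  have hrv2 : ∀ (i m : ℕ) (e : Fam D I z) (him : i ≤ m), m + 1 ≤ n →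
      ver B 0 (Nat.succ_le_succ him) ≫ row' i e = row' m e ≫ hor (b e).F him _ := by
    intro i m e him hm
    induction m, him using Nat.le_induction with
    | base => simp
    | succ m him ih =>
      rw [← ver_comp B 0 (Nat.succ_le_succ him) (Nat.le_succ (m + 1)), Category.assoc,
        ih (by omega), ← Category.assoc, hrv' m e (by omega), Category.assoc, hor_comp]
  have htv' : ∀ (i : ℕ) (e : Fam D I z) (hi : i + 2 ≤ nodeDeg D k z)
      (h : i ≤ D.deg (famTgt D tgt z e) - 1),
      ver B 0 (by omega : i + 1 ≤ nodeDeg D k z) ≫ row' i e =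
        top' e ≫ matchMap D Y hY (famTgt D tgt z e) ≫ (b e).mat ≫ hor (b e).F h _ := by
    intro i e hi h
    -- The construction of the column relates the top entry only to row `n = m + 1`, where `m` is
    -- the last column of the targets; the lower rows follow by descending column `0`.
    obtain ⟨m, rfl⟩ : ∃ m, n = m + 1 := ⟨n - 1, by omega⟩
    have hm : m ≤ D.deg (famTgt D tgt z e) - 1 := by have := hdeg e; omega
    rw [← ver_comp B 0 (by omega : i + 1 ≤ m + 1) (by omega), Category.assoc,
      hrv2 i m e (by omega) le_rfl]
    simp only [row', top', Category.assoc]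
    rw [← Category.assoc, hnat, Category.assoc, reassoc_of% (htv m e rfl hm)]
    have aux : ∀ {P₁ P₂ P₃ P₄ P₅ P₆ : E} (a₁ : P₁ ⟶ P₂) (a₂ : P₂ ⟶ P₃) (a₃ : P₃ ⟶ P₄)
        (a₄ : P₄ ⟶ P₅) (a₅ : P₅ ⟶ P₆) (a₆ : P₄ ⟶ P₆), a₄ ≫ a₅ = a₆ →
          (a₁ ≫ a₂ ≫ a₃ ≫ a₄) ≫ a₅ = a₁ ≫ a₂ ≫ a₃ ≫ a₆ := by
      rintro _ _ _ _ _ _ a₁ a₂ a₃ a₄ a₅ _ rfl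
      simp
    exact congrArg _ (aux _ _ _ _ _ _ (hor_comp (b e).F _ _ _))
  obtain ⟨mat, hmat⟩ : ∃ mat : cornerMatch D Y z ⟶ entry B (nodeDeg D k z - 1) (nodeDeg D k z),
      z.isSome → IsIso mat ∧ ∀ e, mat ≫ hor B (Nat.zero_le _) _ ≫ top' e =
        cornerProj D Y tgt z e := by
    cases z with
    | none => exact ⟨0, fun h => absurd h (by simp)⟩
    | some s =>
      -- The corner isomorphisms already known for the targets are inverted, so that row `n` of
      -- column `0` becomes a product of matching objects.
      obtain ⟨m, h1, h2⟩ := exists_corner_iso (hY := hY) hD h0 (fun j i h _ => sq j i h) hlast hT'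
        (fun h => by
          have hn' : D.deg s = n + 1 := hn
          have hi : ∀ e : OutOne D s,
              n - 1 = nodeDeg D k (some (famTgt D tgt (some s) e)) - 1 := fun e => by
            have := hdeg e
            change n - 1 = D.deg (famTgt D tgt (some s) e) - 1
            omega
          have hk : D.deg s - 1 = n - 1 + 1 := by omega
          let w : ∀ e : Fam D I (some s),
              redMatch D Y e.1.1 ⟶ entry (b e).F (n - 1) (D.deg e.1.1) :=
            fun e => (b e).mat ≫ hor (b e).F (hi e).le _
          have hiso : ∀ e : Fam D I (some s), IsIso (w e) := fun e => by
            have h1 := hb e (by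
              have := hdeg e
              omega)
            have h2 := isIso_hor_of_eq (b e).F (hi e).le (hi e)
              (nodeDeg D k (some (famTgt D tgt (some s) e)))
            exact @IsIso.comp_isIso _ _ _ _ _ _ _ h1 h2
          have hver := isIso_map_of_eq (B.obj (op 0)) (homOfLE hk.ge).op (congrArg op hk)
          obtain ⟨w', hw'⟩ : ∃ w' : ∀ e : Fam D I (some s),
              entry (b e).F (n - 1) (D.deg (famTgt D tgt (some s) e)) ≅
                redMatch D Y (famTgt D tgt (some s) e), ∀ e, (w' e).inv = w e :=
            ⟨fun e => (@asIso _ _ _ _ (w e) (hiso e)).symm, fun e => rfl⟩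
          refine ⟨fun e => ver B 0 hk.ge ≫ row' (n - 1) e ≫ (w' e).hom, ?_, fun e => ?_⟩
          · exact ((hr' (n - 1) (by omega)).iso_comp fun e => (w' e).hom).comp_iso (ver B 0 hk.ge)
          · rw [← Category.assoc, ver_comp]
            refine (Category.assoc _ _ _).symm.trans ((Iso.eq_comp_inv (w' e)).1 ?_)
            refine (htv' (n - 1) e (by omega) (hi e).le).trans ?_
            exact (Category.assoc _ _ _).symm.trans (congrArg _ (hw' e).symm))
      exact ⟨m, fun _ => ⟨h1, h2⟩⟩
  exact ⟨⟨B, top', mat⟩, fun j i h _ => sq j i h, free, hlast, fun _ => hT',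
    ⟨row', fun i hi => hr' i (by omega), fun i e h => hrv' i e (by omega), htv'⟩,
    fun _ h => (hmat h).1, fun _ h => (hmat h).2⟩

/-- A separation grid is free if the objects chosen on its diagonals are cofibrant. -/
def SepGrid.Free (G : SepGrid D Y hY I tgt k) : Prop :=
  ∀ (z : Option C) (j : ℕ), j + 2 < nodeDeg D k z → IsCofibrant (entry (G.F z) (j + 1) (j + 1))

lemma exists_free_sepGrid (hY : Pointed D Y) (hD : D.Reduced) (htgt : ∀ e, D.deg (tgt e) = k) :
    ∃ G : SepGrid D Y hY I tgt k, G.Free := by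
  have hlt : ∀ (z : Option C) (e : Fam D I z),
      nodeDeg D k (some (famTgt D tgt z e)) < nodeDeg D k z := fun z e => by
    have := famTgt_deg htgt z e
    change D.deg _ < _
    omega
  obtain ⟨f, hf⟩ := exists_section (nodeDeg D k) (A := NodeData D Y tgt k)
    (fun z a low => a.Good hY fun e => low _ (hlt z e))
    (fun z low h => NodeData.exists_good hD htgt z _ fun e he =>
      (h _ (hlt z e)).mat_isIso he rfl)
  choose row h1 h2 h3 using fun z => (hf z).row
  have hm : ∀ s, 1 ≤ D.deg s → IsIso (f (some s)).mat := fun s hs => (hf (some s)).mat_isIso hs rfl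
  exact ⟨{
    F := fun z => (f z).F
    square := fun z => (hf z).square
    weq := fun z j h => ((hf z).free j h).1
    fib := fun z j h => ((hf z).free j h).2.2
    last := fun z => (hf z).last
    top := fun z => (f z).top
    top_isLimit := fun z => (hf z).top_isProd
    row := row
    row_isLimit := h1
    row_ver := h2
    matIso := fun s hs => @asIso _ _ _ _ (f (some s)).mat (hm s hs)
    matIso_forget := fun s hs e => (hf (some s)).mat_proj hs rfl e
    top_ver := fun z i e hi _ h => h3 z i e hi h }, fun z j h => ((hf z).free j h).2.1⟩

end ExistsGrid

/-! ### Maps of grids -/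

section PreGrids

lemma exists_seq {A : ℕ → Type u₁} (Good : ∀ j, A j → Prop) (Rel : ∀ j, A j → A (j + 1) → Prop)
    (a : A 0) (ha : Good 0 a) (step : ∀ j a, Good j a → ∃ a', Good (j + 1) a' ∧ Rel j a a') :
    ∃ f : ∀ j, A j, f 0 = a ∧ (∀ j, Good j (f j)) ∧ ∀ j, Rel j (f j) (f (j + 1)) := by
  choose next h1 h2 using step
  let f : ∀ j, {a : A j // Good j a} := fun j =>
    Nat.rec ⟨a, ha⟩ (fun j p => ⟨next j p.1 p.2, h1 j p.1 p.2⟩) j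
  exact ⟨fun j => (f j).1, rfl, fun j => (f j).2, fun j => h2 j _ (f j).2⟩

/-- The index of a row, where `none` stands for the top row. -/
abbrev rowIdx (d : ℕ) : Option ℕ → ℕ
  | none => d
  | some i => i

/-- The rows which a map of grids respects in column `j` of a node of degree `d`. -/
def ValidRow (d j : ℕ) : Option ℕ → Prop
  | none => j < d
  | some i => 1 ≤ i ∧ j ≤ i ∧ i < d

lemma ValidRow.of_succ {d j : ℕ} {ρ : Option ℕ} (h : ValidRow d (j + 1) ρ) : ValidRow d j ρ := by
  cases ρ <;> simp only [ValidRow] at * <;> omega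

lemma ValidRow.lt {d j : ℕ} {ρ : Option ℕ} (h : ValidRow d j ρ) : j < d := by
  cases ρ <;> simp only [ValidRow] at * <;> omega

lemma ValidRow.le {d d' j : ℕ} (hd : d ≤ d') {ρ : Option ℕ} (h : ValidRow d j ρ) :
    j ≤ rowIdx d' ρ := by
  cases ρ <;> simp only [ValidRow, rowIdx] at * <;> omega

lemma ValidRow.le_height {d d' j : ℕ} (hd : d ≤ d') {ρ : Option ℕ} (h : ValidRow d j ρ) :
    rowIdx d' ρ ≤ d' := by
  cases ρ <;> simp only [ValidRow, rowIdx] at * <;> omega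

variable {C : Type u} [Category.{v} C] (D : GradedIdeal C)
variable {E : Type u₂} [Category.{v₂} E] [HasZeroMorphisms E]

/-- The part of a separation grid which is natural in the indexing category. The grid of a node
may have more rows than the degree of the node. -/
structure PreGrid {I : Type (max u v)} (tgt : I → C) (k : ℕ) (Y : C ⥤ E) where
  F : Option C → ℕᵒᵖ ⥤ ℕᵒᵖ ⥤ E
  ht : Option C → ℕ
  le_ht : ∀ z, nodeDeg D k z ≤ ht z
  top : ∀ (z : Option C) (e : Fam D I z), entry (F z) 0 (ht z) ⟶ Y.obj (famTgt D tgt z e)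
  row : ∀ (z : Option C) (i : ℕ) (e : Fam D I z),
    entry (F z) 0 (i + 1) ⟶
      entry (F (some (famTgt D tgt z e))) i (ht (some (famTgt D tgt z e)))
  square : ∀ (z : Option C) (j i : ℕ), j + 1 ≤ i → i + 1 ≤ ht z →
    IsPullback (hor (F z) (Nat.le_succ j) (i + 1)) (ver (F z) (j + 1) (Nat.le_succ i))
      (ver (F z) j (Nat.le_succ i)) (hor (F z) (Nat.le_succ j) i)
  row_ver : ∀ (z : Option C) (i : ℕ) (e : Fam D I z), i + 3 ≤ nodeDeg D k z →
    ver (F z) 0 (Nat.le_succ (i + 1)) ≫ row z i e =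
      row z (i + 1) e ≫ hor (F (some (famTgt D tgt z e))) (Nat.le_succ i) _
  row_top : ∀ (z : Option C) (i : ℕ) (e : Fam D I z) (e' : OutOne D (famTgt D tgt z e))
    (_ : i + 2 ≤ nodeDeg D k z) (h : i + 1 ≤ ht z),
    ver (F z) 0 h ≫ row z i e ≫ hor (F (some (famTgt D tgt z e))) (Nat.zero_le i) _ ≫
      top (some (famTgt D tgt z e)) e' = top z e ≫ Y.map e'.1.2
  row_zero : ∀ (z : Option C) (i : ℕ) (e : Fam D I z) (_ : i + 2 ≤ nodeDeg D k z) (_ : 1 ≤ i)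
    (h : i + 1 ≤ ht z) (h' : i ≤ ht (some (famTgt D tgt z e))),
    ver (F z) 0 h ≫ row z i e ≫ ver (F (some (famTgt D tgt z e))) i h' = 0

variable {D} {I : Type (max u v)} {tgt : I → C} {k : ℕ} {Y : C ⥤ E}

lemma PreGrid.rectangle (A : PreGrid D tgt k Y) (z : Option C) {j j' i i' : ℕ} (hj : j ≤ j')
    (hi : i ≤ i') (hji : j' ≤ i) (hd : i' ≤ A.ht z) :
    IsPullback (hor (A.F z) hj i') (ver (A.F z) j' hi) (ver (A.F z) j hi) (hor (A.F z) hj i) :=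
  isPullback_rectangle (A.square z) hj hi hji hd

/-- The rows of column `0` are products. -/
structure PreGrid.HasProducts (A : PreGrid D tgt k Y) : Prop where
  top : ∀ z, 1 ≤ nodeDeg D k z → IsProd (A.top z)
  row : ∀ (z : Option C) (i : ℕ), i + 2 ≤ nodeDeg D k z → IsProd (A.row z i)

variable {Y' : C ⥤ E} (A : PreGrid D tgt k Y) (B : PreGrid D tgt k Y') (β : Y ⟶ Y')

/-- Maps between the entries of the grids of a node. -/
abbrev NodeMap (z : Option C) : Type (max v₂) :=
  ∀ (j : ℕ) (ρ : Option ℕ), entry (A.F z) j (rowIdx (A.ht z) ρ) ⟶ entry (B.F z) j (rowIdx (B.ht z) ρ)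

variable {A B} in
/-- Compatibility of the maps at a node with those at the targets of the node. -/
structure NodeMap.Good {z : Option C} (φ : NodeMap A B z)
    (low : ∀ e : Fam D I z, NodeMap A B (some (famTgt D tgt z e))) : Prop where
  hor : ∀ (j : ℕ) (ρ : Option ℕ), ValidRow (nodeDeg D k z) (j + 1) ρ →
    φ (j + 1) ρ ≫ hor (B.F z) (Nat.le_succ j) _ = hor (A.F z) (Nat.le_succ j) _ ≫ φ j ρ
  ver : ∀ (j i : ℕ) (ρ : Option ℕ), ValidRow (nodeDeg D k z) j (some i) →
    ValidRow (nodeDeg D k z) j ρ → ∀ (h : i ≤ rowIdx (A.ht z) ρ) (h' : i ≤ rowIdx (B.ht z) ρ),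
      φ j ρ ≫ ver (B.F z) j h' = ver (A.F z) j h ≫ φ j (some i)
  top : 1 ≤ nodeDeg D k z → ∀ e, φ 0 none ≫ B.top z e = A.top z e ≫ β.app _
  row : ∀ (i : ℕ) (e : Fam D I z), i + 2 ≤ nodeDeg D k z →
    φ 0 (some (i + 1)) ≫ B.row z i e = A.row z i e ≫ low e i none

/-- A map of grids. -/
structure GridMap where
  app : ∀ z, NodeMap A B z
  good : ∀ z, NodeMap.Good β (app z) fun _ => app _

variable {A B β}

/-- A map on the single diagonal entry determines the next column, because every entry above it is a
pullback of that entry and the previous column. -/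
lemma exists_nodeMap_column {z : Option C} {j : ℕ} (hj : j + 2 ≤ nodeDeg D k z)
    (c : ∀ ρ, entry (A.F z) j (rowIdx (A.ht z) ρ) ⟶ entry (B.F z) j (rowIdx (B.ht z) ρ))
    (hc : ∀ (i : ℕ) (ρ : Option ℕ), ValidRow (nodeDeg D k z) j (some i) →
      ValidRow (nodeDeg D k z) j ρ → ∀ (h : i ≤ rowIdx (A.ht z) ρ) (h' : i ≤ rowIdx (B.ht z) ρ),
        c ρ ≫ ver (B.F z) j h' = ver (A.F z) j h ≫ c (some i))
    (hp : ∃ p : entry (A.F z) (j + 1) (j + 1) ⟶ entry (B.F z) (j + 1) (j + 1),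
      p ≫ hor (B.F z) (Nat.le_succ j) _ = hor (A.F z) (Nat.le_succ j) _ ≫ c (some (j + 1))) :
    ∃ c' : ∀ ρ, entry (A.F z) (j + 1) (rowIdx (A.ht z) ρ) ⟶
        entry (B.F z) (j + 1) (rowIdx (B.ht z) ρ),
      (∀ (i : ℕ) (ρ : Option ℕ), ValidRow (nodeDeg D k z) (j + 1) (some i) →
        ValidRow (nodeDeg D k z) (j + 1) ρ →
        ∀ (h : i ≤ rowIdx (A.ht z) ρ) (h' : i ≤ rowIdx (B.ht z) ρ),
          c' ρ ≫ ver (B.F z) (j + 1) h' = ver (A.F z) (j + 1) h ≫ c' (some i)) ∧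
      ∀ ρ, ValidRow (nodeDeg D k z) (j + 1) ρ →
        c' ρ ≫ hor (B.F z) (Nat.le_succ j) _ = hor (A.F z) (Nat.le_succ j) _ ≫ c ρ := by
  obtain ⟨p, hp⟩ := hp
  have key : ∀ ρ, ∃ c' : entry (A.F z) (j + 1) (rowIdx (A.ht z) ρ) ⟶
      entry (B.F z) (j + 1) (rowIdx (B.ht z) ρ), ValidRow (nodeDeg D k z) (j + 1) ρ →
      c' ≫ hor (B.F z) (Nat.le_succ j) _ = hor (A.F z) (Nat.le_succ j) _ ≫ c ρ ∧
      ∀ (h : j + 1 ≤ rowIdx (A.ht z) ρ) (h' : j + 1 ≤ rowIdx (B.ht z) ρ),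
        c' ≫ ver (B.F z) (j + 1) h' = ver (A.F z) (j + 1) h ≫ p := by
    intro ρ
    by_cases hρ : ValidRow (nodeDeg D k z) (j + 1) ρ
    · have hA := hρ.le (A.le_ht z)
      have hB := hρ.le (B.le_ht z)
      have hpb := B.rectangle z (Nat.le_succ j) hB le_rfl (hρ.le_height (B.le_ht z))
      have w : (hor (A.F z) (Nat.le_succ j) _ ≫ c ρ) ≫ ver (B.F z) j hB =
          (ver (A.F z) (j + 1) hA ≫ p) ≫ hor (B.F z) (Nat.le_succ j) _ := by
        rw [Category.assoc, Category.assoc, hp,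
          hc (j + 1) ρ ⟨by omega, by omega, by omega⟩ hρ.of_succ hA hB, ← Category.assoc, hor_ver,
          Category.assoc]
      exact ⟨hpb.lift _ _ w, fun _ => ⟨hpb.lift_fst _ _ w, fun _ _ => hpb.lift_snd _ _ w⟩⟩
    · exact ⟨0, fun h => absurd h hρ⟩
  choose c' hc' using key
  refine ⟨c', fun i ρ hi hρ h h' => ?_, fun ρ hρ => (hc' ρ hρ).1⟩
  have hpb := B.rectangle z (Nat.le_succ j) hi.2.1 le_rfl (by have := B.le_ht z; have := hi.2.2; omega)
  refine hpb.hom_ext ?_ ?_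
  · rw [Category.assoc, Category.assoc, ← hor_ver, (hc' (some i) hi).1, ← Category.assoc,
      (hc' ρ hρ).1, Category.assoc, hc i ρ hi.of_succ hρ.of_succ h h', ← Category.assoc, hor_ver,
      Category.assoc]
  · rw [Category.assoc, Category.assoc, ver_comp, (hc' (some i) hi).2 hi.2.1 hi.2.1,
      (hc' ρ hρ).2 (hi.2.1.trans h) (hi.2.1.trans h'), ← Category.assoc, ver_comp]

/-- The maps between the entries of column zero. -/
lemma exists_nodeMap_column_zero (hB : B.HasProducts) (hdeg : ∀ (z : Option C) (e : Fam D I z),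
      D.deg (famTgt D tgt z e) + 1 = nodeDeg D k z) (z : Option C)
    (low : ∀ e : Fam D I z, NodeMap A B (some (famTgt D tgt z e)))
    (hlow : ∀ e, ∃ low', NodeMap.Good β (low e) low') :
    ∃ c : ∀ ρ, entry (A.F z) 0 (rowIdx (A.ht z) ρ) ⟶ entry (B.F z) 0 (rowIdx (B.ht z) ρ),
      (∀ (i : ℕ) (ρ : Option ℕ), ValidRow (nodeDeg D k z) 0 (some i) →
        ValidRow (nodeDeg D k z) 0 ρ → ∀ (h : i ≤ rowIdx (A.ht z) ρ) (h' : i ≤ rowIdx (B.ht z) ρ),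
          c ρ ≫ ver (B.F z) 0 h' = ver (A.F z) 0 h ≫ c (some i)) ∧
      (1 ≤ nodeDeg D k z → ∀ e, c none ≫ B.top z e = A.top z e ≫ β.app _) ∧
      ∀ (i : ℕ) (e : Fam D I z), i + 2 ≤ nodeDeg D k z →
        c (some (i + 1)) ≫ B.row z i e = A.row z i e ≫ low e i none := by
  obtain ⟨t, ht⟩ : ∃ t : entry (A.F z) 0 (A.ht z) ⟶ entry (B.F z) 0 (B.ht z),
      1 ≤ nodeDeg D k z → ∀ e, t ≫ B.top z e = A.top z e ≫ β.app _ := by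
    by_cases h : 1 ≤ nodeDeg D k z
    · exact ⟨(hB.top z h).lift fun e => A.top z e ≫ β.app _, fun _ e => (hB.top z h).lift_fac _ e⟩
    · exact ⟨0, fun h' => absurd h' h⟩
  have : ∀ i, ∃ t : entry (A.F z) 0 (i + 1) ⟶ entry (B.F z) 0 (i + 1),
      i + 2 ≤ nodeDeg D k z → ∀ e, t ≫ B.row z i e = A.row z i e ≫ low e i none := by
    intro i
    by_cases h : i + 2 ≤ nodeDeg D k z
    · exact ⟨(hB.row z i h).lift fun e => A.row z i e ≫ low e i none,
        fun _ e => (hB.row z i h).lift_fac _ e⟩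
    · exact ⟨0, fun h' => absurd h' h⟩
  choose r hr using this
  let c : ∀ ρ, entry (A.F z) 0 (rowIdx (A.ht z) ρ) ⟶ entry (B.F z) 0 (rowIdx (B.ht z) ρ) :=
    fun ρ => match ρ with
    | none => t
    | some 0 => 0
    | some (i + 1) => r i
  have hn : ∀ e : Fam D I z, nodeDeg D k (some (famTgt D tgt z e)) = D.deg (famTgt D tgt z e) :=
    fun _ => rfl
  have hrow : ∀ i (h : i + 3 ≤ nodeDeg D k z), r (i + 1) ≫ ver (B.F z) 0 (Nat.le_succ (i + 1)) =
      ver (A.F z) 0 (Nat.le_succ (i + 1)) ≫ r i := by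
    intro i h
    refine (hB.row z i (by omega)).hom_ext fun e => ?_
    obtain ⟨low', hl⟩ := hlow e
    rw [Category.assoc, Category.assoc, hr i (by omega), B.row_ver z i e h, ← Category.assoc,
      hr (i + 1) (by omega), Category.assoc, ← Category.assoc (ver _ _ _), A.row_ver z i e h,
      Category.assoc]
    refine congrArg _ (hl.hor i none ?_)
    have := hdeg z e
    have := hn e
    simp only [ValidRow]
    omega
  -- The target entry is tested by its pullback rectangle: in column `0` the two sides agree by
  -- `row_top` and naturality of `β`, and in row `i` both vanish by `row_zero`. For `i = 0` the
  -- first test suffices.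
  have htop : ∀ i (_ : i + 2 ≤ nodeDeg D k z) (h : i + 1 ≤ A.ht z) (h' : i + 1 ≤ B.ht z),
      t ≫ ver (B.F z) 0 h' = ver (A.F z) 0 h ≫ r i := by
    intro i hi h h'
    refine (hB.row z i hi).hom_ext fun e => ?_
    obtain ⟨low', hl⟩ := hlow e
    have h1 := hdeg z e
    have h2 := hn e
    have h3 := A.le_ht (some (famTgt D tgt z e))
    have h4 := B.le_ht (some (famTgt D tgt z e))
    rw [Category.assoc, Category.assoc, hr i hi e]
    have hcol : ∀ j (hj : j ≤ i), low e i none ≫ hor (B.F _) hj _ = hor (A.F _) hj _ ≫ low e j none := by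
      intro j hj
      induction i, hj using Nat.le_induction with
      | base => simp
      | succ i hj ih =>
        rw [← hor_comp _ hj (Nat.le_succ i), ← Category.assoc,
          hl.hor i none (by simp only [ValidRow]; omega), Category.assoc,
          ih (by omega) (by omega) (by omega), ← Category.assoc, hor_comp]
    have htop0 : ∀ e' : OutOne D (famTgt D tgt z e), (t ≫ ver (B.F z) 0 h' ≫ B.row z i e) ≫ hor (B.F _) (Nat.zero_le i) _ ≫
        B.top (some (famTgt D tgt z e)) e' = (ver (A.F z) 0 h ≫ A.row z i e ≫ low e i none) ≫
          hor (B.F _) (Nat.zero_le i) _ ≫ B.top (some (famTgt D tgt z e)) e' := by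
      intro e'
      simp only [Category.assoc]
      have h5 := A.row_top z i e e' hi h =≫ β.app _
      have h6 := hl.top (by omega) e'
      have h7 := hcol 0 (Nat.zero_le i)
      have h8 := ht (by omega) e =≫ Y'.map e'.1.2
      simp only [Category.assoc] at h5 h8
      refine (congrArg (fun u => t ≫ u) (B.row_top z i e e' hi h')).trans (h8.trans ?_)
      rw [← β.naturality]
      refine ((Category.assoc _ _ _).symm.trans h5.symm).trans ?_
      refine congrArg _ (congrArg _ ?_)
      have h9 := congrArg (fun t => hor (A.F _) (Nat.zero_le i) _ ≫ t) h6
      refine h9.symm.trans ?_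
      have h10 := h7.symm =≫ B.top (some (famTgt D tgt z e)) e'
      simp only [Category.assoc] at h10
      exact h10
    have hext : (t ≫ ver (B.F z) 0 h' ≫ B.row z i e) ≫ hor (B.F _) (Nat.zero_le i) _ =
        (ver (A.F z) 0 h ≫ A.row z i e ≫ low e i none) ≫ hor (B.F _) (Nat.zero_le i) _ := by
      refine (hB.top _ (by omega)).hom_ext fun e' => ?_
      exact (Category.assoc _ _ _).trans ((htop0 e').trans (Category.assoc _ _ _).symm)
    rcases Nat.eq_zero_or_pos i with rfl | hi0
    · simpa using hext
    · refine (B.rectangle (some (famTgt D tgt z e)) (Nat.zero_le i) (by omega) le_rfl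
        le_rfl).hom_ext hext ?_
      simp only [Category.assoc]
      have hv := hl.ver i i none ⟨by omega, by omega, by omega⟩ (by simp only [ValidRow]; omega)
        (by simp only [rowIdx]; omega) (by simp only [rowIdx]; omega)
      rw [B.row_zero z i e hi hi0 h', comp_zero, hv]
      have := A.row_zero z i e hi hi0 h (by omega) =≫ low e i (some i)
      simp only [Category.assoc, zero_comp] at this
      exact this.symm
  refine ⟨c, fun i ρ hi hρ h h' => ?_, ht, fun i e h => hr i h e⟩
  obtain ⟨i, rfl⟩ := Nat.exists_eq_add_of_le' hi.1
  have hi2 := hi.2.2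
  cases ρ with
  | none => exact htop i (by omega) h h'
  | some i' =>
    have h1 : i + 1 ≤ i' := h
    have key : ∀ n (hn : i ≤ n), n + 1 < nodeDeg D k z →
        r n ≫ ver (B.F z) 0 (Nat.succ_le_succ hn) = ver (A.F z) 0 (Nat.succ_le_succ hn) ≫ r i := by
      intro n hn
      induction n, hn using Nat.le_induction with
      | base => simp
      | succ n hn ih =>
        intro hn2
        rw [← ver_comp _ 0 (Nat.succ_le_succ hn) (Nat.le_succ (n + 1)), ← Category.assoc,
          hrow n (by omega), Category.assoc, ih (by omega), ← Category.assoc, ver_comp]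
    obtain ⟨n, rfl⟩ := Nat.exists_eq_add_of_le' hρ.1
    exact key n (by omega) hρ.2.2

/-- A map of diagrams extends to a map of grids, if the objects on the diagonals of the source are
zero or can be lifted to those of the target. -/
lemma exists_gridMap [HasZeroObject E] [ModelCategory E] (hB : B.HasProducts)
    (hdeg : ∀ (z : Option C) (e : Fam D I z), D.deg (famTgt D tgt z e) + 1 = nodeDeg D k z)
    (hfree : ∀ (z : Option C) (j : ℕ), j + 2 ≤ nodeDeg D k z →
      IsZero (entry (A.F z) (j + 1) (j + 1)) ∨
        (WeakEquivalence (0 : (0 : E) ⟶ entry (A.F z) (j + 1) (j + 1)) ∧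
          IsCofibrant (entry (A.F z) (j + 1) (j + 1)) ∧
            Fibration (hor (B.F z) (Nat.le_succ j) (j + 1)))) :
    Nonempty (GridMap A B β) := by
  suffices H : _ by
    obtain ⟨f, hf⟩ := exists_section (nodeDeg D k) (A := NodeMap A B)
      (fun z φ low => φ.Good β fun e => low _ (Nat.lt_of_succ_le (hdeg z e).le)) H
    exact ⟨⟨f, hf⟩⟩
  intro z low hlow
  obtain ⟨c, h1, h2, h3⟩ := exists_nodeMap_column_zero (β := β) hB hdeg z
    (fun e => low _ (Nat.lt_of_succ_le (hdeg z e).le)) (fun e => ⟨_, hlow _ _⟩)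
  obtain ⟨φ, h0, hv, hh⟩ := exists_seq
    (A := fun j => ∀ ρ, entry (A.F z) j (rowIdx (A.ht z) ρ) ⟶ entry (B.F z) j (rowIdx (B.ht z) ρ))
    (fun j c => ∀ (i : ℕ) (ρ : Option ℕ), ValidRow (nodeDeg D k z) j (some i) →
        ValidRow (nodeDeg D k z) j ρ → ∀ (h : i ≤ rowIdx (A.ht z) ρ) (h' : i ≤ rowIdx (B.ht z) ρ),
          c ρ ≫ ver (B.F z) j h' = ver (A.F z) j h ≫ c (some i))
    (fun j c c' => ∀ ρ, ValidRow (nodeDeg D k z) (j + 1) ρ →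
        c' ρ ≫ hor (B.F z) (Nat.le_succ j) _ = hor (A.F z) (Nat.le_succ j) _ ≫ c ρ)
    c h1 (fun j c hc => by
      by_cases hj : j + 2 ≤ nodeDeg D k z
      · refine exists_nodeMap_column hj c hc ?_
        rcases hfree z j hj with hz | ⟨hw, hcof, hfib⟩
        · exact ⟨0, hz.eq_of_src _ _⟩
        · have : Cofibration (0 : (0 : E) ⟶ entry (A.F z) (j + 1) (j + 1)) :=
            (isCofibrant_iff_of_isInitial _ HasZeroObject.zeroIsInitial).1 hcof
          have sq : CommSq (0 : (0 : E) ⟶ entry (B.F z) (j + 1) (j + 1))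
              (0 : (0 : E) ⟶ entry (A.F z) (j + 1) (j + 1)) (hor (B.F z) (Nat.le_succ j) _)
              (hor (A.F z) (Nat.le_succ j) _ ≫ c (some (j + 1))) := ⟨by simp⟩
          have := ModelCategory.cm4a (0 : (0 : E) ⟶ entry (A.F z) (j + 1) (j + 1))
            (hor (B.F z) (Nat.le_succ j) (j + 1))
          exact ⟨sq.lift, sq.fac_right⟩
      · exact ⟨fun _ => 0, fun i ρ h => absurd h.lt (by omega),
          fun ρ h => absurd h.lt (by omega)⟩)
  subst h0
  exact ⟨φ, fun j => hh j, fun j i ρ => hv j i ρ, h2, h3⟩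

end PreGrids

/-! ### Homotopy invariance of grids -/

section FullGrids

variable {C : Type u} [Category.{v} C] {D : GradedIdeal C}
variable {E : Type u₂} [Category.{v₂} E] [ModelCategory E] [HasZeroObject E] [HasZeroMorphisms E]
variable {I : Type (max u v)} {tgt : I → C} {k : ℕ} {Y Y' : C ⥤ E}

lemma ValidRow.mono {d d' j : ℕ} (hd : d ≤ d') {ρ : Option ℕ} (h : ValidRow d j ρ) :
    ValidRow d' j ρ := by
  cases ρ <;> simp only [ValidRow] at * <;> omega

/-- The homotopical properties of the entries of a separation grid. -/
structure PreGrid.Full (A : PreGrid D tgt k Y) : Prop where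
  hasProducts : A.HasProducts
  fibrant_obj : ∀ t, IsFibrant (Y.obj t)
  fibrant : ∀ (z : Option C) (j i : ℕ), j < nodeDeg D k z → 1 ≤ i → j ≤ i → i ≤ A.ht z →
    IsFibrant (entry (A.F z) j i)
  contractible : ∀ (z : Option C) (j : ℕ), j + 2 ≤ nodeDeg D k z →
    WeakEquivalence (0 : (0 : E) ⟶ entry (A.F z) (j + 1) (j + 1))
  fib : ∀ (z : Option C) (j : ℕ), j + 2 < nodeDeg D k z →
    Fibration (hor (A.F z) (Nat.le_succ j) (j + 1))
  cartesian : ∀ (z : Option C) (j : ℕ) (ρ : Option ℕ), ValidRow (nodeDeg D k z) (j + 1) ρ →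
    ∀ h : j + 1 ≤ rowIdx (A.ht z) ρ,
      HoPullback (hor (A.F z) (Nat.le_succ j) (rowIdx (A.ht z) ρ)) (ver (A.F z) (j + 1) h)
        (ver (A.F z) j h) (hor (A.F z) (Nat.le_succ j) (j + 1))

lemma PreGrid.Full.fibration_hor {A : PreGrid D tgt k Y} (hA : A.Full) (z : Option C) {j i : ℕ}
    (h : j + 2 < nodeDeg D k z) (hi : j + 1 ≤ i) (hd : i ≤ A.ht z) :
    Fibration (hor (A.F z) (Nat.le_succ j) i) := by
  have := hA.fib z j h
  exact fibration_fst_of_isPullback (A.rectangle z (Nat.le_succ j) hi le_rfl hd)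

/-- A map of grids over a weak equivalence of diagrams is a weak equivalence. -/
lemma GridMap.weq {A : PreGrid D tgt k Y} {B : PreGrid D tgt k Y'} {β : Y ⟶ Y'}
    [∀ z : Option C, Finite (Fam D I z)]
    (hdeg : ∀ (z : Option C) (e : Fam D I z), D.deg (famTgt D tgt z e) + 1 = nodeDeg D k z)
    (Φ : GridMap A B β) (hA : A.Full) (hB : B.Full) (hβ : ∀ t, WeakEquivalence (β.app t))
    (z : Option C) (j : ℕ) (ρ : Option ℕ) (hρ : ValidRow (nodeDeg D k z) j ρ) :
    WeakEquivalence (Φ.app z j ρ) := by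
  obtain ⟨d, hz⟩ : ∃ d, nodeDeg D k z = d := ⟨_, rfl⟩
  induction d using Nat.strong_induction_on generalizing z j ρ with
  | _ d ih =>
  have hn : ∀ e : Fam D I z, nodeDeg D k (some (famTgt D tgt z e)) = D.deg (famTgt D tgt z e) :=
    fun _ => rfl
  -- Induction on degree settles column `0`. Each further column is a homotopy pullback of the
  -- previous one along a map from a contractible diagonal entry.
  induction j generalizing ρ with
  | zero =>
    cases ρ with
    | none =>
      exact (hA.hasProducts.top z hρ.lt).weq (hB.hasProducts.top z hρ.lt) _ _
        ((Φ.good z).top hρ.lt) (fun e => hA.fibrant_obj _) (fun e => hB.fibrant_obj _)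
        (fun e => hβ _)
    | some i =>
      obtain ⟨i, rfl⟩ := Nat.exists_eq_add_of_le' hρ.1
      have hi : i + 2 ≤ nodeDeg D k z := hρ.2.2
      have h1 := fun e => hdeg z e
      have h2 := fun e : Fam D I z => A.le_ht (some (famTgt D tgt z e))
      have h3 := fun e : Fam D I z => B.le_ht (some (famTgt D tgt z e))
      refine (hA.hasProducts.row z i hi).weq (hB.hasProducts.row z i hi) _ _
        (fun e => (Φ.good z).row i e hi) (fun e => hA.fibrant _ _ _ ?_ ?_ ?_ le_rfl)
        (fun e => hB.fibrant _ _ _ ?_ ?_ ?_ le_rfl)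
        (fun e => ih (D.deg (famTgt D tgt z e)) ?_ _ _ _ ?_ rfl)
      all_goals
        have := h1 e
        have := h2 e
        have := h3 e
        have := hn e
        try simp only [ValidRow]
        omega
  | succ j ihj =>
    have hj : j + 2 ≤ nodeDeg D k z := hρ.lt
    have := weq_of_contractible (hA.contractible z j hj) (hB.contractible z j hj)
      (Φ.app z (j + 1) (some (j + 1)))
    have h1 := ihj ρ hρ.of_succ
    have hv : ValidRow (nodeDeg D k z) j (some (j + 1)) := ⟨by omega, by omega, hj⟩
    have h2 := ihj (some (j + 1)) hv
    have hv' : ValidRow (nodeDeg D k z) (j + 1) (some (j + 1)) := ⟨by omega, le_rfl, hj⟩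
    have h3 := hρ.le (A.le_ht z)
    have h4 := hρ.le (B.le_ht z)
    exact (hA.cartesian z j ρ hρ h3).weq (hB.cartesian z j ρ hρ h4) _
      (Φ.app z (j + 1) (some (j + 1))) (Φ.app z j (some (j + 1))) (Φ.app z j ρ)
      ((Φ.good z).hor j ρ hρ) ((Φ.good z).ver (j + 1) (j + 1) ρ hv' hρ h3 h4)
      ((Φ.good z).ver j (j + 1) ρ hv hρ.of_succ h3 h4).symm
      ((Φ.good z).hor j (some (j + 1)) hv').symm

end FullGrids

/-! ### Restriction of grids along functors -/

section Restriction

variable {C : Type u} [Category.{v} C] {D : GradedIdeal C}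
variable {E : Type u₂} [Category.{v₂} E] [ModelCategory E] [HasZeroObject E] [HasZeroMorphisms E]
variable {I : Type (max u v)} {tgt : I → C} {k : ℕ} {Y : C ⥤ E} {hY : Pointed D Y}

omit [ModelCategory E] [HasZeroObject E] in
-- The map passes through the zero object in the corner. For the grid of a target this yields the
-- condition `row_zero`, which replaces the factorization through the matching object.
lemma hor_ver_eq_zero (B : ℕᵒᵖ ⥤ ℕᵒᵖ ⥤ E) {i m d : ℕ} (hz : IsZero (entry B m m)) (hi : i ≤ m)
    (hm : m ≤ d) : hor B hi d ≫ ver B i (hi.trans hm) = 0 := by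
  rw [← ver_comp B i hi hm, ← Category.assoc, hor_ver, hz.eq_of_tgt (ver B m hm) 0, zero_comp,
    zero_comp]

/-- The natural part of a separation grid. -/
def SepGrid.toPreGrid (G : SepGrid D Y hY I tgt k)
    (htgt : ∀ e, D.deg (tgt e) = k) : PreGrid D tgt k Y where
  F := G.F
  ht := nodeDeg D k
  le_ht _ := le_rfl
  top := G.top
  row := G.row
  square := G.square
  row_ver := G.row_ver
  row_top z i e e' hi h := by
    have hdeg := famTgt_deg htgt z e
    have hs : 1 ≤ D.deg (famTgt D tgt z e) := by omega
    have h1 := G.top_ver z i e hi hs (by omega) =≫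
      (hor _ (Nat.zero_le i) _ ≫ G.top (some (famTgt D tgt z e)) e')
    simp only [Category.assoc] at h1
    refine h1.trans (congrArg _ ?_)
    have h2 := G.matIso_forget _ hs e'
    have h3 := congrArg (fun t => matchMap D Y hY _ ≫ t) h2
    refine Eq.trans ?_ (h3.trans (matchMap_redProj hY _ e'))
    refine congrArg _ (congrArg _ ?_)
    exact (Category.assoc _ _ _).symm.trans
      (congrArg (fun t => t ≫ G.top (some (famTgt D tgt z e)) e') (hor_comp _ _ _ _))
  row_zero z i e hi h1 h h' := by
    have hdeg := famTgt_deg htgt z e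
    have hs : 1 ≤ D.deg (famTgt D tgt z e) := by omega
    have h2 := G.top_ver z i e hi hs (by omega) =≫ ver _ i h'
    simp only [Category.assoc] at h2
    have hz := G.last (some (famTgt D tgt z e)) (by change 2 ≤ D.deg _; omega)
    have h3 := hor_ver_eq_zero (G.F (some (famTgt D tgt z e))) hz (i := i)
      (by change i ≤ D.deg (famTgt D tgt z e) - 1; omega) (Nat.sub_le _ 1)
    refine h2.trans ?_
    have h4 := congrArg (fun t => G.top z e ≫ matchMap D Y hY _ ≫ (G.matIso _ hs).hom ≫ t) h3
    refine h4.trans ?_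
    exact (congrArg (fun t => G.top z e ≫ t) ((congrArg (fun t => matchMap D Y hY _ ≫ t)
      comp_zero).trans comp_zero)).trans comp_zero

lemma SepGrid.toPreGrid_full [Finite I] (G : SepGrid D Y hY I tgt k) (hD : D.Reduced)
    (hfib : PointedReedyFibrant D Y hY) (htgt : ∀ e, D.deg (tgt e) = k) :
    (G.toPreGrid htgt).Full where
  hasProducts := ⟨G.top_isProd, G.row_isProd⟩
  fibrant_obj t := hfib.isFibrant hD t
  fibrant z j i hj h1 hi hd := G.isFibrant_entry hD hfib htgt z hj h1 hi hd
  contractible z j h := G.diag_contractible z h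
  fib z j h := G.fib z j h
  cartesian z j ρ hρ h := by
    have hle : rowIdx (nodeDeg D k z) ρ ≤ nodeDeg D k z := hρ.le_height le_rfl
    have hj := hρ.lt
    refine ⟨G.rectangle z (Nat.le_succ j) h le_rfl hle,
      G.isFibrant_entry hD hfib htgt z (by omega) (by omega) (by omega) hle,
      G.isFibrant_entry hD hfib htgt z (by omega) (by omega) (by omega) (by omega),
      G.isFibrant_entry hD hfib htgt z (by omega) (by omega) (by omega) (by omega), ?_⟩
    by_cases hj' : j + 2 < nodeDeg D k z
    · exact Or.inr (G.fib z j hj')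
    · left
      cases ρ with
      | none => exact G.fibration_ver hfib htgt z (d := j + 1) (by omega) (by omega) (by omega)
      | some i =>
        obtain rfl : i = j + 1 := by
          have := hρ.2
          omega
        change Fibration (ver (G.F z) j (le_refl (j + 1)))
        rw [ver_refl]
        infer_instance

namespace PreGrid

/-- Restriction of a grid along a map of the indexing sets at the extra node. -/
def comapHead (A : PreGrid D tgt k Y) {I' : Type (max u v)} (hd : I' → I) :
    PreGrid D (fun e => tgt (hd e)) k Y where
  F := A.F
  ht := A.ht
  le_ht z := match z with
    | none => A.le_ht none
    | some s => A.le_ht (some s)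
  top z := match z with
    | none => fun e => A.top none (hd e)
    | some s => fun e => A.top (some s) e
  row z := match z with
    | none => fun i e => A.row none i (hd e)
    | some s => fun i e => A.row (some s) i e
  square := A.square
  row_ver z := match z with
    | none => fun i e => A.row_ver none i (hd e)
    | some s => fun i e => A.row_ver (some s) i e
  row_top z := match z with
    | none => fun i e => A.row_top none i (hd e)
    | some s => fun i e => A.row_top (some s) i e
  row_zero z := match z with
    | none => fun i e => A.row_zero none i (hd e)
    | some s => fun i e => A.row_zero (some s) i e

lemma Full.comapHead {A : PreGrid D tgt k Y} (hA : A.Full) {I' : Type (max u v)} {hd : I' → I}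
    (h : Function.Bijective hd) : (A.comapHead hd).Full where
  hasProducts :=
    { top := fun z => match z with
        | none => fun hz => (hA.hasProducts.top none hz).reindex hd h
        | some s => hA.hasProducts.top (some s)
      row := fun z => match z with
        | none => fun i hz => (hA.hasProducts.row none i hz).reindex hd h
        | some s => hA.hasProducts.row (some s) }
  fibrant_obj := hA.fibrant_obj
  fibrant := hA.fibrant
  contractible := hA.contractible
  fib := hA.fib
  cartesian := hA.cartesian

variable {C' : Type} [SmallCategory C'] {D' : GradedIdeal C'} {k' : ℕ} {K : C' ⥤ C}
variable {I' : Type} {tgt' : I' → C'}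

/-- The conditions under which a grid can be restricted along a functor. -/
structure Restrictable (D : GradedIdeal C) (k : ℕ) (D' : GradedIdeal C') (k' : ℕ) (K : C' ⥤ C) :
    Prop where
  deg_le : ∀ t, D'.deg t ≤ D.deg (K.obj t)
  le : k' ≤ k
  map : ∀ {s t : C'} (f : s ⟶ t), D'.deg t + 1 = D'.deg s → ¬ D'.null f →
    D.deg (K.obj t) + 1 = D.deg (K.obj s) ∧ ¬ D.null (K.map f)

/-- The map of indexing sets given by such a functor. -/
def Restrictable.out (h : Restrictable D k D' k' K) (s : C') (e : OutOne D' s) :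
    OutOne D (K.obj s) :=
  ⟨⟨K.obj e.1.1, K.map e.1.2⟩, h.map e.1.2 e.2.1 e.2.2⟩

lemma Restrictable.nodeDeg_le (h : Restrictable D k D' k' K) (z : Option C') :
    nodeDeg D' k' z ≤ nodeDeg D k (z.map K.obj) := by
  cases z with
  | none => exact Nat.succ_le_succ h.le
  | some s => exact h.deg_le s

variable (h : Restrictable D k D' k' K)
  (A : PreGrid D (I := ULift.{max u v} I') (fun e => K.obj (tgt' e.down)) k Y)

/-- Restriction of a grid along a functor. -/
def comap : PreGrid D' tgt' k' (K ⋙ Y) where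
  F z := A.F (z.map K.obj)
  ht z := A.ht (z.map K.obj)
  le_ht z := (h.nodeDeg_le z).trans (A.le_ht _)
  top z := match z with
    | none => fun e => A.top none ⟨e⟩
    | some s => fun e => A.top (some (K.obj s)) (h.out s e)
  row z := match z with
    | none => fun i e => A.row none i ⟨e⟩
    | some s => fun i e => A.row (some (K.obj s)) i (h.out s e)
  square z := A.square (z.map K.obj)
  row_ver z := match z with
    | none => fun i e hi => A.row_ver none i ⟨e⟩ (hi.trans (h.nodeDeg_le none))
    | some s => fun i e hi => A.row_ver (some (K.obj s)) i (h.out s e)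
        (hi.trans (h.nodeDeg_le (some s)))
  row_top z := match z with
    | none => fun i e e' hi hh => A.row_top none i ⟨e⟩ (h.out _ e')
        (hi.trans (h.nodeDeg_le none)) hh
    | some s => fun i e e' hi hh => A.row_top (some (K.obj s)) i (h.out s e) (h.out _ e')
        (hi.trans (h.nodeDeg_le (some s))) hh
  row_zero z := match z with
    | none => fun i e hi => A.row_zero none i ⟨e⟩ (hi.trans (h.nodeDeg_le none))
    | some s => fun i e hi => A.row_zero (some (K.obj s)) i (h.out s e)
        (hi.trans (h.nodeDeg_le (some s)))

variable {A}

/-- Bijectivity keeps column `0` a product. It holds for truncations of chains; for a string in a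
general category it may fail, and then the restriction serves only as the source of maps of grids.
-/
lemma Full.comap (hA : A.Full)
    (hout : ∀ s, 1 ≤ D'.deg s → Function.Bijective (h.out s)) : (A.comap h).Full where
  hasProducts :=
    { top := fun z => match z with
        | none => fun hz => (hA.hasProducts.top none (hz.trans (h.nodeDeg_le none))).reindex ULift.up
            ULift.up_bijective
        | some s => fun hz => (hA.hasProducts.top (some (K.obj s))
            (hz.trans (h.nodeDeg_le (some s)))).reindex (h.out s) (hout s hz)
      row := fun z => match z with
        | none => fun i hz =>
            (hA.hasProducts.row none i (hz.trans (h.nodeDeg_le none))).reindex ULift.up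
              ULift.up_bijective
        | some s => fun i hz => (hA.hasProducts.row (some (K.obj s)) i
            (hz.trans (h.nodeDeg_le (some s)))).reindex (h.out s)
              (hout s (le_trans (by omega) hz)) }
  fibrant_obj t := hA.fibrant_obj _
  fibrant z j i hj := hA.fibrant _ j i (hj.trans_le (h.nodeDeg_le z))
  contractible z j hj := hA.contractible _ j (hj.trans (h.nodeDeg_le z))
  fib z j hj := hA.fib _ j (hj.trans_le (h.nodeDeg_le z))
  cartesian z j ρ hρ := hA.cartesian _ j ρ (hρ.mono (h.nodeDeg_le z))

end PreGrid

end Restriction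

/-! ### Transport of values of separated operations along maps of grids -/

section Transport

variable {C : Type u} [Category.{v} C] {D : GradedIdeal C}
variable {E : Type u₂} [Category.{v₂} E] [ModelCategory E] [HasZeroObject E] [HasZeroMorphisms E]
variable {H : Type u₃} [Category.{v₃} H] (L : E ⥤ H)
variable {I : Type (max u v)} {tgt : I → C} {k : ℕ} {Y Y' : C ⥤ E} {X : E}

/-- `θ` is a value of the separated operation of order `j + 2` determined by `κ_0, …, κ_j`. -/
structure PreGrid.IsOpValue (A : PreGrid D tgt k Y) (σ : ∀ e : I, X ⟶ Y.obj (tgt e)) (j : ℕ)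
    (κ : ∀ i : ℕ, X ⟶ entry (A.F none) i (A.ht none))
    (θ : X ⟶ entry (A.F none) (j + 1) (j + 2)) : Prop where
  start : ∀ e : I, κ 0 ≫ A.top none e = σ e
  lift : ∀ i : ℕ, i < j → κ (i + 1) ≫ hor (A.F none) (Nat.le_succ i) _ = κ i
  vanish : ∀ (i : ℕ) (h : i + 1 ≤ A.ht none), 1 ≤ i → i ≤ j →
    L.map (κ i ≫ ver (A.F none) i h) = L.map 0
  value : ∀ h : j + 2 ≤ A.ht none,
    θ ≫ hor (A.F none) (Nat.le_succ j) (j + 2) = κ j ≫ ver (A.F none) j h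

variable {A : PreGrid D tgt k Y} {B : PreGrid D tgt k Y'} {β : Y ⟶ Y'}
variable {L} [L.IsLocalization (weakEquivalences E)] {j : ℕ}

/-- No equivalence is needed here: the squares commute strictly and zero in the homotopy category is
preserved by every map. -/
lemma PreGrid.IsOpValue.push {σ : ∀ e : I, X ⟶ Y.obj (tgt e)}
    {κ : ∀ i : ℕ, X ⟶ entry (A.F none) i (A.ht none)}
    {θ : X ⟶ entry (A.F none) (j + 1) (j + 2)} (h : A.IsOpValue L σ j κ θ) (hj : j + 2 ≤ k)
    (Φ : GridMap A B β) :
    B.IsOpValue L (fun e => σ e ≫ β.app _) j (fun i => κ i ≫ Φ.app none i none)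
      (θ ≫ Φ.app none (j + 1) (some (j + 2))) := by
  have hA : k + 1 ≤ A.ht none := A.le_ht none
  have hB : k + 1 ≤ B.ht none := B.le_ht none
  have v1 : ∀ i, i ≤ j → ValidRow (k + 1) i none := fun i hi => by simp only [ValidRow]; omega
  have v2 : ∀ i, 1 ≤ i → i ≤ j + 1 → ValidRow (k + 1) i (some (i + 1)) :=
    fun i h hi => by simp only [ValidRow]; omega
  have v3 : ValidRow (k + 1) j (some (j + 2)) := by simp only [ValidRow]; omega
  refine ⟨fun e => ?_, fun i hi => ?_, fun i hi h1 h2 => ?_, fun hh => ?_⟩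
  · rw [Category.assoc, (Φ.good none).top (Nat.le_add_left _ _) e, ← Category.assoc, h.start]
    rfl
  · rw [Category.assoc, (Φ.good none).hor i none (v1 _ hi), ← Category.assoc, h.lift i hi]
  · have h3 := (Φ.good none).ver i (i + 1) none (v2 i h1 (by omega)) (v1 i h2)
      (by simp only [rowIdx]; omega) hi
    rw [Category.assoc, h3, ← Category.assoc, L.map_comp, h.vanish i _ h1 h2, map_zero_comp]
  · have h3 := (Φ.good none).ver j (j + 2) none v3 (v1 j le_rfl) (by simp only [rowIdx]; omega) hh
    rw [Category.assoc, (Φ.good none).hor j (some (j + 2)) (v2 (j + 1) (by omega) le_rfl),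
      ← Category.assoc, h.value (by omega), Category.assoc, Category.assoc, h3]

/-- The `κ_i` are lifted one after another. Each must strictly lift the one already chosen, which
the horizontal fibrations permit, while agreement with the given sequence is only up to homotopy.
Vanishing is reflected because equivalences become invertible. -/
lemma PreGrid.IsOpValue.exists_lift [IsCofibrant X] {σ : ∀ e : I, X ⟶ Y'.obj (tgt e)}
    {κ : ∀ i : ℕ, X ⟶ entry (B.F none) i (B.ht none)}
    {θ : X ⟶ entry (B.F none) (j + 1) (j + 2)} (h : B.IsOpValue L σ j κ θ) (hj : j + 2 ≤ k)
    (Φ : GridMap A B β) (hA : A.Full) (hB : B.Full)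
    (hΦ : ∀ j ρ, ValidRow (k + 1) j ρ → WeakEquivalence (Φ.app none j ρ))
    (σ' : ∀ e : I, X ⟶ Y.obj (tgt e)) (hσ : ∀ e, σ' e ≫ β.app _ = σ e) :
    ∃ κ' θ', A.IsOpValue L σ' j κ' θ' ∧
      L.map (θ' ≫ Φ.app none (j + 1) (some (j + 2))) = L.map θ := by
  have hA' : k + 1 ≤ A.ht none := A.le_ht none
  have hB' : k + 1 ≤ B.ht none := B.le_ht none
  have v1 : ∀ i, i ≤ j → ValidRow (k + 1) i none := fun i hi => by simp only [ValidRow]; omega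
  have v2 : ∀ i, 1 ≤ i → i ≤ j + 1 → ValidRow (k + 1) i (some (i + 1)) :=
    fun i h hi => by simp only [ValidRow]; omega
  have v3 : ValidRow (k + 1) j (some (j + 2)) := by simp only [ValidRow]; omega
  have htop := hA.hasProducts.top none (Nat.le_add_left _ _)
  have htop' := hB.hasProducts.top none (Nat.le_add_left _ _)
  obtain ⟨a₀, ha₀⟩ : ∃ a₀ : X ⟶ entry (A.F none) 0 (A.ht none), ∀ e : I,
      a₀ ≫ A.top none e = σ' e := ⟨htop.lift σ', htop.lift_fac σ'⟩
  -- Both are determined by their coordinates, so the start of the sequence matches strictly.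
  have e0 : a₀ ≫ Φ.app none 0 none = κ 0 := htop'.hom_ext fun e =>
    (Category.assoc _ _ _).trans
      ((congrArg (a₀ ≫ ·) ((Φ.good none).top (Nat.le_add_left _ _) e)).trans
        ((Category.assoc _ _ _).symm.trans ((congrArg (· ≫ β.app (tgt e)) (ha₀ e)).trans
          ((hσ e).trans (h.start e).symm))))
  obtain ⟨κ', k0, k1, k2⟩ := exists_seq
    (A := fun i => X ⟶ entry (A.F none) i (A.ht none))
    (fun i a => i ≤ j → L.map (a ≫ Φ.app none i none) = L.map (κ i))
    (fun i a a' => i < j → a' ≫ hor (A.F none) (Nat.le_succ i) _ = a)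
    a₀ (fun _ => congrArg L.map e0) (fun i a ha => by
      by_cases hi : i < j
      · have := hΦ _ _ (v1 i hi.le)
        have := hΦ _ _ (v1 (i + 1) hi)
        have : Fibration (hor (A.F none) (Nat.le_succ i) (A.ht none)) :=
          hA.fibration_hor none (by simp only [nodeDeg]; omega) (by omega) le_rfl
        have : IsFibrant (entry (A.F none) (i + 1) (A.ht none)) :=
          hA.fibrant none _ _ (by simp only [nodeDeg]; omega) (by omega) (by omega) le_rfl
        have : IsFibrant (entry (A.F none) i (A.ht none)) :=
          hA.fibrant none _ _ (by simp only [nodeDeg]; omega) (by omega) (by omega) le_rfl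
        obtain ⟨a', h1, h2⟩ := exists_lift_of_weq L
          ((Φ.good none).hor i none (v1 (i + 1) hi)) (κ (i + 1)) a
          (by rw [h.lift i hi]; exact (ha hi.le).symm)
        exact ⟨a', fun _ => h2, fun _ => h1⟩
      · exact ⟨0, fun h => absurd h (by omega), fun h => absurd h hi⟩)
  have := hΦ _ _ (v2 (j + 1) (by omega) le_rfl)
  have := hΦ _ _ v3
  have : Fibration (hor (A.F none) (Nat.le_succ j) (j + 2)) :=
    hA.fibration_hor none (by simp only [nodeDeg]; omega) (by omega) (by omega)
  have : IsFibrant (entry (A.F none) (j + 1) (rowIdx (A.ht none) (some (j + 1 + 1)))) :=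
    hA.fibrant none _ _ (by simp only [nodeDeg]; omega) (by simp) (by simp) (by simp only [rowIdx]; omega)
  have : IsFibrant (entry (A.F none) j (rowIdx (A.ht none) (some (j + 1 + 1)))) :=
    hA.fibrant none _ _ (by simp only [nodeDeg]; omega) (by simp) (by simp only [rowIdx]; omega)
      (by simp only [rowIdx]; omega)
  have hle : j + 2 ≤ A.ht none := by omega
  obtain ⟨θ', h1, h2⟩ := exists_lift_of_weq L
    ((Φ.good none).hor j (some (j + 2)) (v2 (j + 1) (by omega) le_rfl)) θ
    (κ' j ≫ ver (A.F none) j hle) (by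
      have h3 := (Φ.good none).ver j (j + 2) none v3 (v1 j le_rfl) hle
        (by simp only [rowIdx]; omega)
      rw [h.value (by omega), Category.assoc, ← h3, ← Category.assoc, L.map_comp, L.map_comp,
        k1 j le_rfl])
  refine ⟨κ', θ', ⟨fun e => by rw [k0, ha₀], fun i hi => k2 i hi, fun i hi h3 h4 => ?_,
    fun _ => h1⟩, h2⟩
  have := hΦ _ _ (v2 i h3 (by omega))
  have := isIso_map_of_weq L (Φ.app none i (some (i + 1)))
  have h5 := (Φ.good none).ver i (i + 1) none (v2 i h3 (by omega)) (v1 i h4) hi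
      (by simp only [rowIdx]; omega)
  rw [← cancel_mono (L.map (Φ.app none i (some (i + 1)))), ← L.map_comp, Category.assoc, ← h5,
    ← Category.assoc, L.map_comp, k1 i h4, ← L.map_comp, h.vanish i (by omega) h3 h4, map_zero_comp]

end Transport

/-! ### Uniqueness of loop objects -/

section Loops

variable {E : Type u₂} [Category.{v₂} E] [ModelCategory E] [HasZeroObject E] [HasZeroMorphisms E]

/-- Fibrant objects connected by a zigzag of weak equivalences. -/
def WeakEqv : E → E → Prop :=
  Relation.EqvGen fun A B => IsFibrant A ∧ IsFibrant B ∧ ∃ f : A ⟶ B, WeakEquivalence f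

omit [HasZeroObject E] [HasZeroMorphisms E] in
lemma WeakEqv.of_weq {A B : E} (hA : IsFibrant A) (hB : IsFibrant B) (f : A ⟶ B)
    [WeakEquivalence f] : WeakEqv A B :=
  .rel _ _ ⟨hA, hB, f, inferInstance⟩

omit [HasZeroObject E] [HasZeroMorphisms E] in
lemma WeakEqv.isFibrant {A B : E} (h : WeakEqv A B) : IsFibrant A ↔ IsFibrant B := by
  induction h with
  | rel _ _ h => exact ⟨fun _ => h.2.1, fun _ => h.1⟩
  | refl => rfl
  | symm _ _ _ ih => exact ih.symm
  | trans _ _ _ _ _ h h' => exact h.trans h'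

/-- `A` is the homotopy pullback of two weakly contractible objects over `W`. -/
def IsWeakLoop (W A : E) : Prop :=
  ∃ (P Q : E) (fst : A ⟶ P) (snd : A ⟶ Q) (f : P ⟶ W) (p : Q ⟶ W), HoPullback fst snd f p ∧
    WeakEquivalence (0 : (0 : E) ⟶ P) ∧ WeakEquivalence (0 : (0 : E) ⟶ Q)

/-- The path fibration. -/
def pathData (W : E) :=
  MorphismProperty.factorizationData (trivialCofibrations E) (fibrations E) (0 : (0 : E) ⟶ W)

/-- A loop object. -/
abbrev loopObj (W : E) : E := pullback (pathData W).p (pathData W).p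

lemma pathData_contractible (W : E) : WeakEquivalence (0 : (0 : E) ⟶ (pathData W).Z) := by
  have : WeakEquivalence (pathData W).i := by
    unfold pathData
    infer_instance
  rwa [(isZero_zero E).eq_of_src (0 : (0 : E) ⟶ (pathData W).Z) (pathData W).i]

lemma loopObj_hoPullback {W : E} (hW : IsFibrant W) :
    HoPullback (pullback.fst (pathData W).p (pathData W).p) (pullback.snd _ _) (pathData W).p
      (pathData W).p := by
  have : Fibration (pathData W).p := by
    unfold pathData
    infer_instance
  have : IsFibrant (pathData W).Z := isFibrant_of_fibration (pathData W).p
  exact ⟨IsPullback.of_hasPullback _ _, this, this, hW, Or.inl inferInstance⟩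

/-- An arbitrary contractible object over `W'` and the chosen path fibration of `W` are compared
through a common fibration over `W'`, which the latter reaches by lifting from `0`. -/
lemma exists_path_replacement {W W' P : E} (g : W ⟶ W') (f : P ⟶ W')
    (hP : WeakEquivalence (0 : (0 : E) ⟶ P)) :
    ∃ (P' : E) (i : P ⟶ P') (p : P' ⟶ W') (l : (pathData W).Z ⟶ P'), WeakEquivalence i ∧
      Fibration p ∧ WeakEquivalence l ∧ i ≫ p = f ∧ l ≫ p = (pathData W).p ≫ g := by
  let F := MorphismProperty.factorizationData (trivialCofibrations E) (fibrations E) f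
  have hi : Cofibration (pathData W).i := by
    unfold pathData
    infer_instance
  have hw : WeakEquivalence (pathData W).i := by
    unfold pathData
    infer_instance
  have sq : CommSq (0 : (0 : E) ⟶ F.Z) (pathData W).i F.p ((pathData W).p ≫ g) :=
    ⟨(isZero_zero E).eq_of_src _ _⟩
  have hF : WeakEquivalence (0 : (0 : E) ⟶ F.Z) := by
    rw [← zero_comp (f := F.i)]
    infer_instance
  have := ModelCategory.cm4a (pathData W).i F.p
  exact ⟨F.Z, F.i, F.p, sq.lift, inferInstance, inferInstance,
    weq_of_contractible (pathData_contractible W) hF _, F.fac, sq.fac_right⟩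

/-- Replacing both legs as above gives a pullback to which `loopObj W` and `A` both map by
comparisons of homotopy pullbacks. -/
lemma IsWeakLoop.weakEqv_of_weq {W W' A : E} (hW : IsFibrant W) (g : W ⟶ W')
    [WeakEquivalence g] (hA : IsWeakLoop W' A) : WeakEqv (loopObj W) A := by
  obtain ⟨P, Q, fst, snd, f, p, h, hP, hQ⟩ := hA
  obtain ⟨P', i, f', l, hi, hf', hl, h1, h2⟩ := exists_path_replacement g f hP
  obtain ⟨Q', j, p', m, hj, hp', hm, h3, h4⟩ := exists_path_replacement g p hQ
  have h0 := loopObj_hoPullback hW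
  have := h.fibrant_base
  have : IsFibrant P' := isFibrant_of_fibration f'
  have : IsFibrant Q' := isFibrant_of_fibration p'
  have hN : HoPullback (pullback.fst f' p') (pullback.snd f' p') f' p' :=
    ⟨IsPullback.of_hasPullback _ _, inferInstance, inferInstance, inferInstance,
      Or.inl inferInstance⟩
  let a : A ⟶ pullback f' p' := hN.1.lift (fst ≫ i) (snd ≫ j) (by simp [h1, h3, h.1.w])
  let b : loopObj W ⟶ pullback f' p' := hN.1.lift (pullback.fst _ _ ≫ l) (pullback.snd _ _ ≫ m)
    (by simp only [Category.assoc, h2, h4, reassoc_of% h0.1.w])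
  have : WeakEquivalence a := h.weq hN a j (𝟙 _) i (hN.1.lift_fst _ _ _) (hN.1.lift_snd _ _ _)
    (by simp [h1]) (by simp [h3])
  have : WeakEquivalence b := h0.weq hN b m g l (hN.1.lift_fst _ _ _) (hN.1.lift_snd _ _ _)
    h2.symm h4.symm
  exact (WeakEqv.of_weq h0.isFibrant hN.isFibrant b).trans _ _ _
    (WeakEqv.of_weq h.isFibrant hN.isFibrant a).symm

lemma IsWeakLoop.loopObj {W : E} (hW : IsFibrant W) : IsWeakLoop W (loopObj W) :=
  ⟨_, _, _, _, _, _, loopObj_hoPullback hW, pathData_contractible W, pathData_contractible W⟩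

lemma WeakEqv.loopObj {W W' : E} (h : WeakEqv W W') (hW : IsFibrant W) :
    WeakEqv (loopObj W) (loopObj W') := by
  induction h with
  | rel _ _ h =>
    obtain ⟨h1, h2, g, _⟩ := h
    exact (IsWeakLoop.loopObj h2).weakEqv_of_weq h1 g
  | refl => exact .refl _
  | symm A B h ih => exact (ih ((WeakEqv.isFibrant h).2 hW)).symm
  | trans A B _ h _ ih ih' => exact (ih hW).trans _ _ _ (ih' ((WeakEqv.isFibrant h).1 hW))

lemma IsWeakLoop.weakEqv {W W' A : E} (hA : IsWeakLoop W A) (h : WeakEqv W W') :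
    WeakEqv A (HigherOps.loopObj W') := by
  have hW : IsFibrant W := by
    obtain ⟨P, Q, fst, snd, f, p, h, hP, hQ⟩ := hA
    exact h.fibrant_base
  exact (hA.weakEqv_of_weq hW (𝟙 W)).symm.trans _ _ _ (h.loopObj hW)

lemma isFibrant_loopObj {W : E} (hW : IsFibrant W) : IsFibrant (loopObj W) :=
  (loopObj_hoPullback hW).isFibrant

lemma isFibrant_iterate_loopObj (m : ℕ) {W : E} (hW : IsFibrant W) :
    IsFibrant (loopObj^[m] W) := by
  induction m with
  | zero => exact hW
  | succ m ih =>
    rw [Function.iterate_succ_apply']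
    exact isFibrant_loopObj ih

lemma WeakEqv.iterate_loopObj (m : ℕ) {W W' : E} (h : WeakEqv W W') (hW : IsFibrant W) :
    WeakEqv (HigherOps.loopObj^[m] W) (HigherOps.loopObj^[m] W') := by
  induction m with
  | zero => exact h
  | succ m ih =>
    rw [Function.iterate_succ_apply', Function.iterate_succ_apply']
    exact ih.loopObj (isFibrant_iterate_loopObj m hW)

/-- A fibre is a homotopy pullback with `0` as one of its contractible corners. Fibrancy of the
intermediate loop objects is not assumed but is carried along the zigzag. -/
lemma IsIterLoopObject.weakEqv {m : ℕ} {W A : E} (h : IsIterLoopObject m W A) (hW : IsFibrant W) :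
    WeakEqv A (loopObj^[m] W) := by
  induction m generalizing A with
  | zero =>
    obtain ⟨e⟩ : Nonempty (A ≅ W) := h
    have : IsFibrant A := isFibrant_of_fibration e.hom
    exact WeakEqv.of_weq (B := W) this hW e.hom
  | succ m ih =>
    obtain ⟨A', hA', P, p, l, hp, hP, hpb⟩ := h
    have h1 := ih hA'
    have : IsFibrant A' := h1.isFibrant.2 (isFibrant_iterate_loopObj m hW)
    have : IsFibrant P := isFibrant_of_fibration p
    rw [Function.iterate_succ_apply']
    exact IsWeakLoop.weakEqv ⟨P, 0, l, 0, p, 0, ⟨hpb, inferInstance, inferInstance, inferInstance,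
      Or.inl hp⟩, hP, contractible_of_isZero (isZero_zero E)⟩ h1

variable {H : Type u₃} [Category.{v₃} H] (L : E ⥤ H) [L.IsLocalization (weakEquivalences E)]

include L in
omit [HasZeroObject E] [HasZeroMorphisms E] in
lemma WeakEqv.nonempty_iso {A B : E} (h : WeakEqv A B) : Nonempty (L.obj A ≅ L.obj B) := by
  induction h with
  | rel _ _ h =>
    obtain ⟨_, _, f, _⟩ := h
    have := isIso_map_of_weq L f
    exact ⟨asIso (L.map f)⟩
  | refl => exact ⟨Iso.refl _⟩
  | symm _ _ _ ih => exact ⟨ih.some.symm⟩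
  | trans _ _ _ _ _ h h' => exact ⟨h.some ≪≫ h'.some⟩

end Loops

/-! ### Decomposition into products of iterated loop objects -/

section WeakProducts

variable {E : Type u₂} [Category.{v₂} E] [ModelCategory E]

/-- The maps `φ i : A ⟶ B i` exhibit `A` as a product up to weak equivalence. -/
def IsWeakProd {ι : Type u₁} {A : E} {B : ι → E} (φ : ∀ i, A ⟶ B i) : Prop :=
  ∃ (P : E) (p : ∀ i, P ⟶ B i) (l : A ⟶ P), IsProd p ∧ WeakEquivalence l ∧ ∀ i, l ≫ p i = φ i

lemma IsWeakProd.localization {ι : Type u₁} [Finite ι] {A : E} {B : ι → E} {φ : ∀ i, A ⟶ B i}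
    (h : IsWeakProd φ) {H : Type u₃} [Category.{v₃} H] (L : E ⥤ H)
    [L.IsLocalization (weakEquivalences E)] (hB : ∀ i, IsFibrant (B i)) :
    IsProd fun i => L.map (φ i) := by
  obtain ⟨P, p, l, hp, hl, h1⟩ := h
  have := isIso_map_of_weq L l
  have h2 := (hp.localization L hB).comp_iso (L.map l)
  simpa only [← L.map_comp, h1] using h2

variable [HasZeroObject E] [HasZeroMorphisms E]

/-- The square `F P Q W` maps to a homotopy pullback of weakly contractible objects, through the
given maps at the corners `F` and `W`. -/
def IsLoopStep {F P Q W B V : E} (fst : F ⟶ P) (snd : F ⟶ Q) (f : P ⟶ W) (p : Q ⟶ W) (φ : F ⟶ B)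
    (ψ : W ⟶ V) : Prop :=
  ∃ (P' Q' : E) (fst' : B ⟶ P') (snd' : B ⟶ Q') (f' : P' ⟶ V) (p' : Q' ⟶ V) (a : P ⟶ P')
    (c : Q ⟶ Q'), HoPullback fst' snd' f' p' ∧ Fibration p' ∧
      WeakEquivalence (0 : (0 : E) ⟶ P') ∧ WeakEquivalence (0 : (0 : E) ⟶ Q') ∧
      φ ≫ fst' = fst ≫ a ∧ φ ≫ snd' = snd ≫ c ∧ f ≫ ψ = a ≫ f' ∧ p ≫ ψ = c ≫ p'

/-- Looping commutes with products: the product of the squares for the `B i j` is again a homotopy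
pullback with contractible corners, over a base equivalent to `W`. The comparison is an equivalence
at the three corners, hence on pullbacks. -/
lemma IsWeakProd.loopStep {ι : Type u₁} {κ : ι → Type u₁} [Finite ι] [∀ i, Finite (κ i)]
    {F P Q W : E} {fst : F ⟶ P} {snd : F ⟶ Q} {f : P ⟶ W} {p : Q ⟶ W}
    (h : HoPullback fst snd f p) {Q₁ W₁ : ι → E} {q : ∀ i, Q ⟶ Q₁ i} {w : ∀ i, W ⟶ W₁ i}
    {p₁ : ∀ i, Q₁ i ⟶ W₁ i} (hq : IsProd q) (hw : IsProd w) (hp : ∀ i, p ≫ w i = q i ≫ p₁ i)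
    (hP : WeakEquivalence (0 : (0 : E) ⟶ P)) (hQf : ∀ i, IsFibrant (Q₁ i))
    (hQ : ∀ i, WeakEquivalence (0 : (0 : E) ⟶ Q₁ i)) (hW : ∀ i, IsFibrant (W₁ i))
    {B V : ∀ i, κ i → E} {φ : ∀ i j, F ⟶ B i j} {ψ : ∀ i j, W₁ i ⟶ V i j}
    (hψ : ∀ i, IsWeakProd (ψ i))
    (hs : ∀ i j, IsLoopStep fst (snd ≫ q i) (f ≫ w i) (p₁ i) (φ i j) (ψ i j)) :
    IsWeakProd fun x : Σ i, κ i => φ x.1 x.2 := by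
  choose P' Q' fst' snd' f' p' a c hB hp' hP' hQ' e1 e2 e3 e4 using fun x : Σ i, κ i => hs x.1 x.2
  choose R r l hr hl e5 using hψ
  have hR : ∀ i, IsFibrant (R i) := fun i => (hr i).isFibrant fun j => (hB ⟨i, j⟩).fibrant_base
  have hRR := IsProd.pi R
  have hV := hRR.sigma hr
  have hPP := IsProd.pi P'
  have hQQ := IsProd.pi Q'
  have hBB := IsProd.pi fun x : Σ i, κ i => B x.1 x.2
  let fst₂ := hPP.lift fun x => Pi.π (fun x : Σ i, κ i => B x.1 x.2) x ≫ fst' x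
  let snd₂ := hQQ.lift fun x => Pi.π (fun x : Σ i, κ i => B x.1 x.2) x ≫ snd' x
  let f₂ := hV.lift fun x => Pi.π P' x ≫ f' x
  let p₂ := hV.lift fun x => Pi.π Q' x ≫ p' x
  have h2 : HoPullback fst₂ snd₂ f₂ p₂ :=
    ⟨IsProd.isPullback hBB hPP hQQ hV (fun x => hPP.lift_fac _ x) (fun x => hQQ.lift_fac _ x)
      (fun x => hV.lift_fac _ x) (fun x => hV.lift_fac _ x) (fun x => (hB x).1),
      hPP.isFibrant fun x => (hB x).2, hQQ.isFibrant fun x => (hB x).3,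
      hV.isFibrant fun x => (hB x).4,
      Or.inr (hQQ.fibration hV p₂ p' (fun x => hV.lift_fac _ x) hp')⟩
  have w1 : WeakEquivalence (hRR.lift fun i => w i ≫ l i) :=
    hw.weq hRR _ l (fun i => hRR.lift_fac _ i) hW hR hl
  have w2 : WeakEquivalence (hPP.lift a) :=
    weq_of_contractible hP (hPP.contractible (fun x => (hB x).2) hP') _
  have w3 : WeakEquivalence (hQQ.lift fun x => q x.1 ≫ c x) :=
    weq_of_contractible (hq.contractible hQf hQ) (hQQ.contractible (fun x => (hB x).3) hQ') _
  refine ⟨_, _, hBB.lift fun x => φ x.1 x.2, hBB, ?_, fun x => hBB.lift_fac _ x⟩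
  refine h.weq h2 _ (hQQ.lift fun x => q x.1 ≫ c x) (hRR.lift fun i => w i ≫ l i) (hPP.lift a)
    ?_ ?_ ?_ ?_
  · exact hPP.hom_ext fun x => by simp [fst₂, e1]
  · exact hQQ.hom_ext fun x => by simp [snd₂, e2]
  · refine hV.hom_ext fun x => ?_
    have := e3 x
    simp only [Category.assoc] at this
    simp [f₂, e5, this]
  · refine hV.hom_ext fun x => ?_
    simp [p₂, e5, reassoc_of% hp x.1, e4]

end WeakProducts

/-! ### Strings as successive choices of arrows -/

section Paths

variable {C : Type u} [Category.{v} C] (D : GradedIdeal C)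

/-- Strings of `m` non-null maps lowering degree by one, starting at `s`. -/
def OPath : ℕ → C → Type (max u v)
  | 0, _ => PUnit
  | m + 1, s => Σ e : OutOne D s, OPath m e.1.1

instance (m : ℕ) (s : C) : Finite (OPath D m s) := by
  induction m generalizing s with
  | zero => exact inferInstanceAs (Finite PUnit)
  | succ m ih =>
    have := finite_outOne D s
    exact inferInstanceAs (Finite (Σ e : OutOne D s, OPath D m e.1.1))

/-- The consecutive maps of a string are non-null and lower degree by one. -/
def GoodString : ∀ {m : ℕ}, ComposableArrows C m → Prop
  | 0, _ => True
  | _ + 1, F => (D.deg (F.obj' 1) + 1 = D.deg (F.obj' 0) ∧ ¬ D.null (F.map' 0 1)) ∧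
      GoodString F.δ₀

/-- The maps of a string. -/
def pathOf : ∀ {m : ℕ} (F : ComposableArrows C m), GoodString D F → OPath D m (F.obj' 0)
  | 0, _, _ => PUnit.unit
  | _ + 1, F, h => ⟨⟨⟨F.obj' 1, F.map' 0 1⟩, h.1⟩, pathOf F.δ₀ h.2⟩

lemma goodString_iff {m : ℕ} (F : ComposableArrows C m) :
    GoodString D F ↔ ∀ i (hi : i < m), D.deg (F.obj' (i + 1)) + 1 = D.deg (F.obj' i) ∧
      ¬ D.null (F.map' i (i + 1)) := by
  induction m with
  | zero => exact ⟨fun _ i hi => absurd hi (by omega), fun _ => trivial⟩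
  | succ m ih =>
    rw [GoodString, ih]
    constructor
    · rintro ⟨h1, h2⟩ i hi
      cases i with
      | zero => exact h1
      | succ i => exact h2 i (by omega)
    · exact fun h => ⟨h 0 (by omega), fun i hi => h (i + 1) (by omega)⟩

/-- Equality is taken in a sigma type since the starting object is itself part of what is recovered.
-/
lemma pathOf_injective {m : ℕ} {F G : ComposableArrows C m} (hF : GoodString D F)
    (hG : GoodString D G)
    (h : (⟨F.obj' 0, pathOf D F hF⟩ : Σ s, OPath D m s) = ⟨G.obj' 0, pathOf D G hG⟩) : F = G := by
  induction m with
  | zero => exact ComposableArrows.ext₀ (Sigma.mk.inj_iff.1 h).1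
  | succ m ih =>
    obtain ⟨F₀, X, f, rfl⟩ := F.precomp_surjective
    obtain ⟨G₀, X', g, rfl⟩ := G.precomp_surjective
    obtain ⟨h1, h2⟩ := Sigma.mk.inj_iff.1 h
    change X = X' at h1
    subst h1
    obtain ⟨h3, h4⟩ := Sigma.mk.inj_iff.1 (eq_of_heq h2)
    obtain ⟨h5, h6⟩ := Sigma.mk.inj_iff.1 (Subtype.ext_iff.1 h3)
    obtain rfl : F₀ = G₀ := ih hF.2 hG.2 (Sigma.ext h5 h4)
    have : f = g := eq_of_heq h6
    rw [this]

lemma pathOf_surjective {m : ℕ} (s : C) (π : OPath D m s) :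
    ∃ (F : ComposableArrows C m) (hF : GoodString D F),
      (⟨F.obj' 0, pathOf D F hF⟩ : Σ s, OPath D m s) = ⟨s, π⟩ := by
  induction m generalizing s with
  | zero => exact ⟨.mk₀ s, trivial, rfl⟩
  | succ m ih =>
    obtain ⟨⟨⟨t, f⟩, he⟩, π⟩ := π
    obtain ⟨F, hF, h⟩ := ih t π
    obtain ⟨h1, h2⟩ := Sigma.mk.inj_iff.1 h
    change F.left = t at h1
    subst h1
    obtain rfl := eq_of_heq h2
    exact ⟨F.precomp f, ⟨he, hF⟩, rfl⟩

variable {D} {C' : Type} [SmallCategory C'] {D' : GradedIdeal C'} {k k' : ℕ} {K : C' ⥤ C}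

/-- The image of a string. -/
def OPath.map (h : PreGrid.Restrictable D k D' k' K) : ∀ (m : ℕ) (s : C'),
    OPath D' m s → OPath D m (K.obj s)
  | 0, _, _ => PUnit.unit
  | m + 1, s, π => ⟨h.out s π.1, OPath.map h m _ π.2⟩

lemma OPath.map_pathOf (h : PreGrid.Restrictable D k D' k' K) {m : ℕ} (F : ComposableArrows C' m)
    (hF : GoodString D' F) (hF' : GoodString D (F ⋙ K)) :
    OPath.map h m _ (pathOf D' F hF) = pathOf D (F ⋙ K) hF' := by
  induction m with
  | zero => rfl
  | succ m ih => exact Sigma.ext rfl (heq_of_eq (ih F.δ₀ hF.2 hF'.2))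

end Paths

/-! ### Projections to iterated loop objects -/

section Components

variable {C : Type u} [Category.{v} C] {D : GradedIdeal C}
variable {E : Type u₂} [Category.{v₂} E] [ModelCategory E] [HasZeroObject E] [HasZeroMorphisms E]
variable {I : Type (max u v)} {tgt : I → C} {k : ℕ} {Y : C ⥤ E}

/-- Maps from `F_z^{r,r+1}` to iterated loop objects, compatible with the description of
`F_z^{r,r+1}` as an iterated homotopy pullback, at a string of maps out of `z`. -/
def IsComponent (A : PreGrid D tgt k Y) : ∀ (r : ℕ) (z : Option C) (e : Fam D I z),
    OPath D (r + 1) (famTgt D tgt z e) → ∀ B : E, (entry (A.F z) r (r + 1) ⟶ B) → Prop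
  | 0, z, e, π, B, φ => IsFibrant B ∧ ∃ w : Y.obj π.1.1.1 ⟶ B, WeakEquivalence w ∧
      φ = A.row z 0 e ≫ A.top (some (famTgt D tgt z e)) π.1 ≫ w
  | r + 1, z, e, π, _, φ => ∃ (V : E) (ψ : entry (A.F (some (famTgt D tgt z e))) r (r + 1) ⟶ V),
      IsComponent A r (some (famTgt D tgt z e)) π.1 π.2 V ψ ∧
      ∀ h : r + 1 ≤ A.ht (some (famTgt D tgt z e)),
        IsLoopStep (ver (A.F z) (r + 1) (Nat.le_succ (r + 1)))
          (hor (A.F z) (Nat.zero_le _) (r + 2) ≫ A.row z (r + 1) e ≫ ver _ (r + 1) h)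
          (hor (A.F z) (Nat.zero_le _) (r + 1) ≫ A.row z r e ≫ ver _ r h)
          (hor (A.F (some (famTgt D tgt z e))) (Nat.le_succ r) (r + 1)) φ ψ

lemma IsComponent.isFibrant {A : PreGrid D tgt k Y} {r : ℕ} {z : Option C} {e : Fam D I z}
    {π : OPath D (r + 1) (famTgt D tgt z e)} {B : E} {φ : entry (A.F z) r (r + 1) ⟶ B}
    (hA : ∀ e, r ≤ A.ht (some (famTgt D tgt z e)))
    (h : IsComponent A r z e π B φ) : IsFibrant B := by
  cases r with
  | zero => exact h.1
  | succ r =>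
    obtain ⟨V, ψ, -, h⟩ := h
    obtain ⟨_, _, _, _, _, _, _, _, h, -⟩ := h (hA e)
    exact h.isFibrant

/-- `F_z^{r,r+1}` is the product of iterated loop objects, up to weak equivalence. -/
lemma isWeakProd_of_isComponent [Finite I] {hY : Pointed D Y} (G : SepGrid D Y hY I tgt k)
    (hD : D.Reduced) (hfib : PointedReedyFibrant D Y hY) (htgt : ∀ e, D.deg (tgt e) = k)
    (r : ℕ) (z : Option C) (hz : r + 2 ≤ nodeDeg D k z)
    {B : ∀ e : Fam D I z, OPath D (r + 1) (famTgt D tgt z e) → E}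
    {φ : ∀ e π, entry (G.F z) r (r + 1) ⟶ B e π}
    (h : ∀ e π, IsComponent (G.toPreGrid htgt) r z e π (B e π) (φ e π)) :
    IsWeakProd fun x : Σ e : Fam D I z, OPath D (r + 1) (famTgt D tgt z e) => φ x.1 x.2 := by
  have hdeg := famTgt_deg (D := D) htgt z
  induction r generalizing z with
  | zero =>
    choose hB w hw e1 using h
    have h1 := G.row_isProd z 0 hz
    have h2 : ∀ e : Fam D I z, IsProd (G.top (some (famTgt D tgt z e))) := fun e =>
      G.top_isProd (some (famTgt D tgt z e)) (by have := hdeg e; change 1 ≤ D.deg _; omega)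
    -- The entry `F_z^{0,1}` is a product of products, indexed by pairs `z ⟶ s ⟶ t`; a path of
    -- length one differs from its arrow only by a trailing unit.
    have h3 := (h1.sigma h2).reindex
      (fun x : Σ e : Fam D I z, OPath D 1 (famTgt D tgt z e) =>
        (⟨x.1, x.2.1⟩ : Σ e : Fam D I z, Fam D I (some (famTgt D tgt z e))))
      ⟨fun x y hxy => by
        obtain ⟨e, π, u⟩ := x
        obtain ⟨e', π', u'⟩ := y
        obtain ⟨rfl, h4⟩ := Sigma.mk.inj_iff.1 hxy
        obtain rfl := eq_of_heq h4
        rfl, fun x => ⟨⟨x.1, x.2, PUnit.unit⟩, rfl⟩⟩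
    have h4 := IsProd.pi fun x : Σ e : Fam D I z, OPath D 1 (famTgt D tgt z e) => B x.1 x.2
    refine ⟨_, _, h4.lift fun x => φ x.1 x.2, h4, ?_, fun x => h4.lift_fac _ x⟩
    exact h3.weq h4 _ (fun x => w x.1 x.2)
      (fun x => (h4.lift_fac _ x).trans ((e1 x.1 x.2).trans (Category.assoc _ _ _).symm))
      (fun x => hfib.isFibrant hD _) (fun x => hB x.1 x.2) (fun x => hw x.1 x.2)
  | succ r ih =>
    choose V ψ hψ hs using h
    have hn : ∀ e, nodeDeg D k (some (famTgt D tgt z e)) = D.deg (famTgt D tgt z e) := fun _ => rfl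
    have hle : ∀ e : Fam D I z, r + 1 ≤ D.deg (famTgt D tgt z e) := fun e => by
      have := hdeg e
      omega
    have hq := IsProd.pi fun e : Fam D I z =>
      entry (G.F (some (famTgt D tgt z e))) (r + 1) (r + 1)
    have hw := IsProd.pi fun e : Fam D I z => entry (G.F (some (famTgt D tgt z e))) r (r + 1)
    have h1 := G.hoPullback hD hfib htgt z hz hq hw hle (fun e => hq.lift_fac _ e)
      (fun e => hw.lift_fac _ e) (fun e => hw.lift_fac _ e)
    have h2 := IsWeakProd.loopStep h1 hq hw (fun e => hw.lift_fac _ e)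
      (G.diag_contractible z (by omega))
      (fun e => G.isFibrant_entry hD hfib htgt _ (by have := hdeg e; have := hn e; omega) (by omega)
        le_rfl (hle e))
      (fun e => G.diag_contractible _ (by have := hdeg e; have := hn e; omega))
      (fun e => G.isFibrant_entry hD hfib htgt _ (by have := hdeg e; have := hn e; omega) (by omega)
        (by omega) (hle e))
      (φ := fun e (π : Σ e' : OutOne D (famTgt D tgt z e), OPath D (r + 1) e'.1.1) => φ e π)
      (ψ := fun e (π : Σ e' : OutOne D (famTgt D tgt z e), OPath D (r + 1) e'.1.1) => ψ e π)
      (fun e => ih (some (famTgt D tgt z e)) (by have := hdeg e; have := hn e; omega)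
        (fun e' π => hψ e ⟨e', π⟩) (famTgt_deg htgt _))
      (fun e π => by
        have h3 := hs e π (hle e)
        refine Eq.mpr ?_ h3
        congr 1
        · exact hq.lift_fac _ e
        · exact hw.lift_fac _ e)
    exact h2

end Components

/-! ### Components obtained from maps of grids over linear categories -/

section ComponentsOfMaps

variable {C : Type u} [Category.{v} C] {D : GradedIdeal C}
variable {E : Type u₂} [Category.{v₂} E] [ModelCategory E] [HasZeroObject E] [HasZeroMorphisms E]
variable {I : Type (max u v)} {tgt : I → C} {k : ℕ} {Y Y' : C ⥤ E}

omit [ModelCategory E] [HasZeroObject E] [HasZeroMorphisms E] in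
lemma IsProd.isIso_of_unique {ι : Type u₁} {P : E} {B : ι → E} {p : ∀ i, P ⟶ B i} (h : IsProd p)
    (i : ι) (hi : ∀ j, j = i) : IsIso (p i) := by
  refine ⟨h.lift fun j => eqToHom (by rw [hi j]), h.hom_ext fun j => ?_, ?_⟩
  · obtain rfl := hi j
    simp
  · simp

omit [HasZeroObject E] [HasZeroMorphisms E] in
lemma exists_weq_of_iso {F P Q R Q' R' : E} (p : P ⟶ Q) (hp : IsIso p) (q : Q ⟶ R) (hq : IsIso q)
    {φ : F ⟶ P} {a : F ⟶ Q'} {ψ : Q' ⟶ Q} {b : Q' ⟶ R'} {β : R' ⟶ R} (h : φ ≫ p = a ≫ ψ)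
    (h' : ψ ≫ q = b ≫ β) (hβ : WeakEquivalence β) :
    ∃ w : R' ⟶ P, WeakEquivalence w ∧ φ = a ≫ b ≫ w :=
  ⟨β ≫ inv q ≫ inv p, inferInstance, by
    rw [← Category.assoc b, ← h', ← cancel_mono p, h]
    simp⟩

/-- With a single arrow out of each node the products in column `0` are isomorphisms, so the squares
of the node and of its target paste directly. The hypothesis on fibrations includes the leftmost
column and provides the fibration leg. -/
lemma PreGrid.Full.hoPullback {B : PreGrid D tgt k Y} (hB : B.Full)
    (hdeg : ∀ (z : Option C) (e : Fam D I z), D.deg (famTgt D tgt z e) + 1 = nodeDeg D k z)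
    (hfib : ∀ (z : Option C) (j : ℕ), j + 2 ≤ nodeDeg D k z →
      Fibration (hor (B.F z) (Nat.le_succ j) (j + 1)))
    (z : Option C) (e : Fam D I z) (he : ∀ e', e' = e) {j : ℕ} (hz : j + 3 ≤ nodeDeg D k z)
    (hs : j + 1 ≤ B.ht (some (famTgt D tgt z e))) :
    HoPullback (ver (B.F z) (j + 1) (Nat.le_succ (j + 1)))
      (hor (B.F z) (Nat.zero_le _) (j + 2) ≫ B.row z (j + 1) e ≫ ver _ (j + 1) hs)
      (hor (B.F z) (Nat.zero_le _) (j + 1) ≫ B.row z j e ≫ ver _ j hs)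
      (hor (B.F (some (famTgt D tgt z e))) (Nat.le_succ j) (j + 1)) := by
  have h0 := hdeg z e
  have h0' : nodeDeg D k (some (famTgt D tgt z e)) = D.deg (famTgt D tgt z e) := rfl
  have hz' := B.le_ht z
  have h1 := B.rectangle z (Nat.zero_le (j + 1)) (Nat.le_succ (j + 1)) le_rfl (by omega)
  have := (hB.hasProducts.row z (j + 1) (by omega)).isIso_of_unique e he
  have := (hB.hasProducts.row z j (by omega)).isIso_of_unique e he
  have h2 : IsPullback (B.row z (j + 1) e) (ver (B.F z) 0 (Nat.le_succ (j + 1)))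
      (hor _ (Nat.le_succ j) _) (B.row z j e) :=
    IsPullback.of_horiz_isIso ⟨(B.row_ver z j e hz).symm⟩
  have h3 := (B.rectangle (some (famTgt D tgt z e)) (Nat.le_succ j) hs le_rfl le_rfl).flip
  refine ⟨(h1.paste_horiz (h2.paste_horiz h3)).flip,
    hB.fibrant _ _ _ (by omega) (by omega) le_rfl (by omega),
    hB.fibrant _ _ _ (by omega) (by omega) le_rfl hs,
    hB.fibrant _ _ _ (by omega) (by omega) (by omega) hs, Or.inr (hfib _ _ (by omega))⟩

variable {A : PreGrid D tgt k Y} {B : PreGrid D tgt k Y'} {β : Y ⟶ Y'}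

omit [ModelCategory E] [HasZeroObject E] in
lemma GridMap.app_hor_zero (Φ : GridMap A B β) (z : Option C) (j : ℕ) (ρ : Option ℕ)
    (hρ : ValidRow (nodeDeg D k z) j ρ) :
    Φ.app z j ρ ≫ HigherOps.hor (B.F z) (Nat.zero_le j) _ =
      HigherOps.hor (A.F z) (Nat.zero_le j) _ ≫ Φ.app z 0 ρ := by
  induction j with
  | zero => rw [hor_refl, hor_refl, Category.comp_id, Category.id_comp]
  | succ j ih =>
    rw [← hor_comp (B.F z) (Nat.zero_le j) (Nat.le_succ j),
      ← hor_comp (A.F z) (Nat.zero_le j) (Nat.le_succ j), ← Category.assoc, (Φ.good z).hor j ρ hρ,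
      Category.assoc, ih hρ.of_succ, Category.assoc]

omit [ModelCategory E] [HasZeroObject E] in
lemma GridMap.app_row_ver (Φ : GridMap A B β)
    (hdeg : ∀ (z : Option C) (e : Fam D I z), D.deg (famTgt D tgt z e) + 1 = nodeDeg D k z)
    (z : Option C) (e : Fam D I z) {j r m : ℕ} (hz : r + 2 ≤ nodeDeg D k z) (hj : j ≤ r + 1)
    (h1 : 1 ≤ m) (hr : r ≤ m) (hm : m + 2 ≤ nodeDeg D k z)
    (hA : m ≤ A.ht (some (famTgt D tgt z e))) (hB : m ≤ B.ht (some (famTgt D tgt z e))) :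
    Φ.app z j (some (r + 1)) ≫ HigherOps.hor (B.F z) (Nat.zero_le _) (r + 1) ≫ B.row z r e ≫
        HigherOps.ver _ r hB =
      (HigherOps.hor (A.F z) (Nat.zero_le _) (r + 1) ≫ A.row z r e ≫ HigherOps.ver _ r hA) ≫
        Φ.app (some (famTgt D tgt z e)) r (some m) := by
  have h0 := hdeg z e
  have h0' : nodeDeg D k (some (famTgt D tgt z e)) = D.deg (famTgt D tgt z e) := rfl
  have e1 := Φ.app_hor_zero z j (some (r + 1)) ⟨by omega, hj, hz⟩
  have e2 := (Φ.good z).row r e hz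
  have e3 := (Φ.good (some (famTgt D tgt z e))).ver r m none ⟨h1, hr, by omega⟩
    (by simp only [ValidRow]; omega) hA hB
  rw [← Category.assoc, e1, Category.assoc, ← Category.assoc (Φ.app z 0 _), e2]
  simp only [Category.assoc]
  rw [e3]

/-- Only the target grid has to consist of homotopy pullbacks; the source may be a restriction to a
string, whose squares merely map to them. -/
lemma GridMap.isLoopStep (Φ : GridMap A B β) (hB : B.Full)
    (hdeg : ∀ (z : Option C) (e : Fam D I z), D.deg (famTgt D tgt z e) + 1 = nodeDeg D k z)
    (hfib : ∀ (z : Option C) (j : ℕ), j + 2 ≤ nodeDeg D k z →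
      Fibration (HigherOps.hor (B.F z) (Nat.le_succ j) (j + 1)))
    (z : Option C) (e : Fam D I z) (he : ∀ e', e' = e) {r : ℕ} (hz : r + 3 ≤ nodeDeg D k z)
    (hs : r + 1 ≤ A.ht (some (famTgt D tgt z e))) :
    IsLoopStep (HigherOps.ver (A.F z) (r + 1) (Nat.le_succ (r + 1)))
      (HigherOps.hor (A.F z) (Nat.zero_le _) (r + 2) ≫ A.row z (r + 1) e ≫
        HigherOps.ver _ (r + 1) hs)
      (HigherOps.hor (A.F z) (Nat.zero_le _) (r + 1) ≫ A.row z r e ≫ HigherOps.ver _ r hs)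
      (HigherOps.hor (A.F (some (famTgt D tgt z e))) (Nat.le_succ r) (r + 1))
      (Φ.app z (r + 1) (some (r + 2))) (Φ.app (some (famTgt D tgt z e)) r (some (r + 1))) := by
  have h0 := hdeg z e
  have h0' : nodeDeg D k (some (famTgt D tgt z e)) = D.deg (famTgt D tgt z e) := rfl
  have hB' := B.le_ht (some (famTgt D tgt z e))
  have hsB : r + 1 ≤ B.ht (some (famTgt D tgt z e)) := by omega
  have h1 := hB.hoPullback hdeg hfib z e he hz hsB
  refine ⟨_, _, _, _, _, _, Φ.app z (r + 1) (some (r + 1)), Φ.app _ (r + 1) (some (r + 1)), h1,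
    hfib _ _ (by omega), hB.contractible _ _ (by omega), hB.contractible _ _ (by omega), ?_, ?_, ?_,
    ?_⟩
  · exact (Φ.good z).ver (r + 1) (r + 1) (some (r + 2)) ⟨by omega, by omega, by omega⟩
      ⟨by omega, by omega, by omega⟩ _ _
  · exact Φ.app_row_ver hdeg z e (by omega) (by omega) (by omega) le_rfl (by omega) hs hsB
  · exact (Φ.app_row_ver hdeg z e (by omega) (by omega) (by omega) (by omega) (by omega) hs hsB).symm
  · exact ((Φ.good _).hor r (some (r + 1)) ⟨by omega, by omega, by omega⟩).symm

/-- Over a linear indexing category, the maps of a map of grids are components. -/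
lemma GridMap.isComponent (Φ : GridMap A B β) (hB : B.Full)
    (hdeg : ∀ (z : Option C) (e : Fam D I z), D.deg (famTgt D tgt z e) + 1 = nodeDeg D k z)
    (hfib : ∀ (z : Option C) (j : ℕ), j + 2 ≤ nodeDeg D k z →
      Fibration (HigherOps.hor (B.F z) (Nat.le_succ j) (j + 1)))
    (hsub : ∀ z, Subsingleton (Fam D I z)) (hβ : ∀ t, WeakEquivalence (β.app t))
    (r : ℕ) (z : Option C) (e : Fam D I z) (π : OPath D (r + 1) (famTgt D tgt z e))
    (hz : r + 2 ≤ nodeDeg D k z) :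
    IsComponent A r z e π _ (Φ.app z r (some (r + 1))) := by
  have h0 := hdeg z e
  have h0' : nodeDeg D k (some (famTgt D tgt z e)) = D.deg (famTgt D tgt z e) := rfl
  induction r generalizing z with
  | zero =>
    have hz' := B.le_ht z
    have e1 := (hB.hasProducts.row z 0 hz).isIso_of_unique e fun _ => Subsingleton.elim _ _
    have e2 : IsIso (B.top (some (famTgt D tgt z e)) π.1) :=
      (hB.hasProducts.top _ (by omega)).isIso_of_unique _ fun _ =>
        @Subsingleton.elim _ (hsub (some (famTgt D tgt z e))) _ _
    refine ⟨hB.fibrant z 0 1 (by omega) le_rfl (by omega) (by omega), ?_⟩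
    have e3 := (Φ.good z).row 0 e hz
    have e4 := (Φ.good (some (famTgt D tgt z e))).top (by omega) π.1
    exact exists_weq_of_iso _ e1 _ e2 e3 e4 (hβ _)
  | succ r ih =>
    exact ⟨_, _, ih (some (famTgt D tgt z e)) π.1 π.2 (by omega) (hdeg _ _) rfl, fun hs =>
      Φ.isLoopStep hB hdeg hfib z e (fun _ => Subsingleton.elim _ _) hz hs⟩

/-- Being a component refers only to the arrows of the given string, so it does not see which other
arrows were discarded. -/
lemma IsComponent.of_comapHead {I' : Type (max u v)} {hd : I' → I} {r : ℕ} {e : I'}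
    {π : OPath D (r + 1) (tgt (hd e))} {B : E} {φ : entry (A.F none) r (r + 1) ⟶ B}
    (h : IsComponent (A.comapHead hd) r none e π B φ) : IsComponent A r none (hd e) π B φ := by
  have key : ∀ (r : ℕ) (s : C) (e : OutOne D s) (π : OPath D (r + 1) e.1.1) (B : E)
      (φ : entry (A.F (some s)) r (r + 1) ⟶ B), IsComponent (A.comapHead hd) r (some s) e π B φ →
      IsComponent A r (some s) e π B φ := by
    intro r
    induction r with
    | zero => exact fun s e π B φ h => h
    | succ r ih =>
      rintro s e π B φ ⟨V, ψ, h1, h2⟩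
      exact ⟨V, ψ, ih _ _ _ _ _ h1, h2⟩
  cases r with
  | zero => exact h
  | succ r =>
    obtain ⟨V, ψ, h1, h2⟩ := h
    exact ⟨V, ψ, key _ _ _ _ _ _ h1, h2⟩

end ComponentsOfMaps

/-! ### Components of a restricted grid -/

section ComponentsOfRestriction

variable {C : Type u} [Category.{v} C] {D : GradedIdeal C}
variable {E : Type u₂} [Category.{v₂} E] [ModelCategory E] [HasZeroObject E] [HasZeroMorphisms E]
variable {k : ℕ} {Y : C ⥤ E} {C' : Type} [SmallCategory C'] {D' : GradedIdeal C'} {k' : ℕ}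
variable {K : C' ⥤ C} {I' : Type} {tgt' : I' → C'} {h : PreGrid.Restrictable D k D' k' K}
  {A : PreGrid D (I := ULift.{max u v} I') (fun e => K.obj (tgt' e.down)) k Y}

lemma IsComponent.of_comap {r : ℕ} {e : I'} {π : OPath D' (r + 1) (tgt' e)} {B : E}
    {φ : entry (A.F none) r (r + 1) ⟶ B} (hc : IsComponent (A.comap h) r none e π B φ) :
    IsComponent A r none ⟨e⟩ (OPath.map h _ _ π) B φ := by
  have key : ∀ (r : ℕ) (s : C') (e : OutOne D' s) (π : OPath D' (r + 1) e.1.1) (B : E)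
      (φ : entry (A.F (some (K.obj s))) r (r + 1) ⟶ B),
      IsComponent (A.comap h) r (some s) e π B φ →
      IsComponent A r (some (K.obj s)) (h.out s e) (OPath.map h _ _ π) B φ := by
    intro r
    induction r with
    | zero => exact fun s e π B φ h => h
    | succ r ih =>
      rintro s e π B φ ⟨V, ψ, h1, h2⟩
      exact ⟨V, ψ, ih _ _ _ _ _ h1, h2⟩
  cases r with
  | zero => exact hc
  | succ r =>
    obtain ⟨V, ψ, h1, h2⟩ := hc
    exact ⟨V, ψ, key _ _ _ _ _ _ h1, h2⟩

end ComponentsOfRestriction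

/-! ### Strings -/

section Strings

lemma chainIdeal_outOne_subsingleton (n : ℕ) (z : Option (Fin (n + 1))) :
    Subsingleton (Fam (chainIdeal n) PUnit.{1} z) := by
  cases z with
  | none => exact inferInstanceAs (Subsingleton PUnit)
  | some p =>
    refine ⟨?_⟩
    rintro ⟨⟨q, f⟩, hq, h⟩ ⟨⟨q', f'⟩, hq', h'⟩
    have : q = q' := by
      simp only [chainIdeal] at hq hq'
      omega
    subst this
    obtain rfl := Subsingleton.elim f f'
    rfl

lemma chainIdeal_famTgt_deg (n : ℕ) (z : Option (Fin (n + 1))) (e : Fam (chainIdeal n) PUnit.{1} z) :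
    (chainIdeal n).deg (famTgt (chainIdeal n) (fun _ => 0) z e) + 1 =
      nodeDeg (chainIdeal n) n z :=
  famTgt_deg (D := chainIdeal n) (tgt := fun _ => 0) (fun _ => by simp [chainIdeal]) z e

lemma goodString_id (n : ℕ) : GoodString (chainIdeal n) (m := n) (𝟭 (Fin (n + 1))) := by
  rw [goodString_iff]
  intro i hi
  simp only [chainIdeal, Functor.id_obj]
  omega

variable {C : Type u} [Category.{v} C] {D : GradedIdeal C}

lemma GoodString.deg_add {m : ℕ} {F : ComposableArrows C m} (h : GoodString D F) (i : ℕ)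
    (hi : i ≤ m) : D.deg (F.obj' i) + i = D.deg (F.obj' 0) := by
  rw [goodString_iff] at h
  induction i with
  | zero => rfl
  | succ i ih =>
    have := (h i hi).1
    have := ih (by omega)
    omega

lemma GoodString.restrictable {m k : ℕ} {F : ComposableArrows C m} (h : GoodString D F)
    (hk : D.deg (F.obj' 0) = k) : PreGrid.Restrictable D k (chainIdeal m) m F where
  deg_le t := by
    have := h.deg_add t (by omega)
    change m - (t : ℕ) ≤ D.deg (F.obj t)
    have h1 := h.deg_add m le_rfl
    change D.deg (F.obj t) + t = _ at this
    omega
  le := by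
    have h1 := h.deg_add m le_rfl
    omega
  map {s t} f hs hn := by
    rw [goodString_iff] at h
    obtain ⟨s, hs'⟩ := s
    obtain ⟨t, ht⟩ := t
    obtain rfl : t = s + 1 := by
      simp only [chainIdeal] at hs
      omega
    exact h s (by omega)

variable {J : Type u} [Category.{v} J] {D : PointedIndexing J} {x : J} {k n : ℕ}

lemma TString.good (S : TString D x k n) : GoodString (D.bdryIdeal x k) S.chain := by
  rw [goodString_iff]
  intro i hi
  refine ⟨?_, S.not_null ⟨i, hi⟩⟩
  have h1 := S.deg_eq ⟨i, by omega⟩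
  have h2 := S.deg_eq ⟨i + 1, by omega⟩
  change D.deg (S.chain.obj ⟨i + 1, _⟩).obj + 1 = D.deg (S.chain.obj ⟨i, _⟩).obj
  simp only at h1 h2
  omega

lemma TString.le (S : TString D x k n) : n ≤ k := by
  have := S.deg_eq (Fin.last n)
  simp only [Fin.val_last] at this
  omega

lemma TString.restrictable (S : TString D x k n) :
    PreGrid.Restrictable (D.bdryIdeal x k) k (chainIdeal n) n S.chain :=
  S.good.restrictable (S.deg_eq 0)

/-- The maps of a string. -/
def TString.path (S : TString D x k n) :
    Σ e : XTop D x k, OPath (D.bdryIdeal x k) n e.1.1 :=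
  ⟨S.first, pathOf _ S.chain S.good⟩

/-- Strings are given as functors, whereas the product decomposition is proved for inductively
described paths; this identifies the two indexing sets. -/
lemma TString.path_bijective :
    Function.Bijective (TString.path : TString D x k n → _) := by
  constructor
  · intro S S' h
    obtain ⟨h1, h2⟩ := Sigma.mk.inj_iff.1 h
    obtain ⟨h3, h4⟩ := Sigma.mk.inj_iff.1 (Subtype.ext_iff.1 h1)
    have h5 := pathOf_injective _ S.good S'.good (Sigma.ext h3 h2)
    obtain ⟨F, f, _, _, _⟩ := S
    obtain ⟨F', f', _, _, _⟩ := S'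
    obtain rfl : F = F' := h5
    obtain rfl : f = f' := eq_of_heq h4
    rfl
  · rintro ⟨⟨⟨t, f⟩, ht, hf⟩, π⟩
    obtain ⟨F, hF, h⟩ := pathOf_surjective (D.bdryIdeal x k) t π
    obtain ⟨h1, h2⟩ := Sigma.mk.inj_iff.1 h
    change F.left = t at h1
    subst h1
    obtain rfl := eq_of_heq h2
    refine ⟨⟨F, f, fun i => ?_, hf, fun i => ?_⟩, rfl⟩
    · exact (hF.deg_add i (by omega)).trans ht
    · exact ((goodString_iff _ F).1 hF i i.2).2

end Strings

/-! ### Pointed Reedy fibrant replacements of chain complexes -/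

section ChainComplexes

variable {E : Type u₂} [Category.{v₂} E] [ModelCategory E] [HasZeroObject E] [HasZeroMorphisms E]

/-- Consecutive maps compose to zero. -/
def IsComplex {n : ℕ} (Y : ComposableArrows E n) : Prop :=
  ∀ i (hi : i + 2 ≤ n), Y.map' i (i + 1) ≫ Y.map' (i + 1) (i + 2) = 0

omit [ModelCategory E] [HasZeroObject E] in
lemma isComplex_iff_pointed {n : ℕ} (Y : ComposableArrows E n) :
    IsComplex Y ↔ Pointed (chainIdeal n) Y := by
  constructor
  · intro h p q f hpq
    obtain ⟨p, hp⟩ := p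
    obtain ⟨q, hq⟩ := q
    have hpq' : p + 2 ≤ q := hpq
    have h1 : p + 1 < n + 1 := by omega
    have h2 : p + 2 < n + 1 := by omega
    have h3 : f = homOfLE (by simp : (⟨p, hp⟩ : Fin (n + 1)) ≤ ⟨p + 1, h1⟩) ≫
        homOfLE (by simp : (⟨p + 1, h1⟩ : Fin (n + 1)) ≤ ⟨p + 2, h2⟩) ≫
          homOfLE (by simpa using hpq') := Subsingleton.elim _ _
    rw [h3, Y.map_comp, Y.map_comp, ← Category.assoc]
    exact (congrArg (· ≫ _) (h p (by omega))).trans zero_comp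
  · intro h i hi
    have h1 := @h ⟨i, by omega⟩ ⟨i + 2, by omega⟩ (homOfLE (by simp)) (le_refl (i + 2))
    exact (Y.map_comp _ _).symm.trans h1

/-- The lifting property of the reduced matching maps of a chain complex. -/
structure ChainFibrant {n : ℕ} (Y : ComposableArrows E n) : Prop where
  zero : IsComplex Y
  last : IsFibrant (Y.obj' n)
  lift : ∀ i (hi : i < n) {A B : E} (a : A ⟶ B) [Cofibration a] [WeakEquivalence a]
    (u : A ⟶ Y.obj' i) (b : B ⟶ Y.obj' (i + 1)), a ≫ b = u ≫ Y.map' i (i + 1) →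
    (∀ h : i + 2 ≤ n, b ≫ Y.map' (i + 1) (i + 2) = 0) →
    ∃ l : B ⟶ Y.obj' i, a ≫ l = u ∧ l ≫ Y.map' i (i + 1) = b

omit [HasZeroObject E] in
-- For a chain complex the matching object consists of the cycles in the next term, so the lifting
-- condition is that of the matching maps; at the last term it is fibrancy.
lemma ChainFibrant.pointedReedyFibrant {n : ℕ} {Y : ComposableArrows E n} (h : ChainFibrant Y)
    (hY : Pointed (chainIdeal n) Y) : PointedReedyFibrant (chainIdeal n) Y hY := by
  intro s
  obtain ⟨s, hs⟩ := s
  have hD := chainIdeal_reduced n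
  rcases (Nat.le_of_lt_succ hs).eq_or_lt with rfl | hs'
  · have h0 : IsZero (redMatch (chainIdeal s) Y ⟨s, hs⟩) :=
      isZero_redMatch (D := chainIdeal s) hD (Nat.sub_self s)
    exact (isFibrant_iff_of_isTerminal _ h0.isTerminal).1 h.last
  · let e₀ : OutOne (chainIdeal n) ⟨s, hs⟩ :=
      ⟨⟨⟨s + 1, by omega⟩, homOfLE (by simp)⟩, by simp only [chainIdeal]; omega⟩
    have he : ∀ e, e = e₀ := fun e =>
      @Subsingleton.elim _ (chainIdeal_outOne_subsingleton n (some ⟨s, hs⟩)) e e₀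
    rw [fibration_iff, ← trivialCofibrations_rlp]
    intro A B a ha
    obtain ⟨_, _⟩ := (mem_trivialCofibrations_iff a).1 ha
    refine ⟨fun {u w} sq => ?_⟩
    have h1 : a ≫ w ≫ redProj (chainIdeal n) Y ⟨s, hs⟩ e₀ = u ≫ Y.map e₀.1.2 :=
      (Category.assoc _ _ _).symm.trans ((congrArg (· ≫ redProj (chainIdeal n) Y _ e₀)
        sq.w.symm).trans ((Category.assoc _ _ _).trans
          (congrArg (u ≫ ·) (matchMap_redProj hY _ e₀))))
    obtain ⟨l, hl, hl'⟩ := h.lift s hs' a u (w ≫ redProj (chainIdeal n) Y ⟨s, hs⟩ e₀) h1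
      (fun h2 => by
        have h3 := redProj_map (Y := Y) hD e₀ (t := ⟨s + 2, by omega⟩) (homOfLE (by simp [e₀]))
          (by simp only [chainIdeal, e₀]; omega)
        exact (Category.assoc _ _ _).trans ((congrArg (w ≫ ·) h3).trans comp_zero))
    refine ⟨⟨⟨l, hl, redMatch_hom_ext hD Y _ fun e => ?_⟩⟩⟩
    rw [he e]
    exact (Category.assoc _ _ _).trans
      ((congrArg (l ≫ ·) (matchMap_redProj hY _ e₀)).trans hl')

/-- When the last term is zero, being a cycle in the term before it is no condition, and the lifting
property there over the zero object is fibrancy. -/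
lemma ChainFibrant.castSucc {n : ℕ} {Z : ComposableArrows E (n + 1)} (h : ChainFibrant Z)
    (hz : IsZero (Z.obj' (n + 1))) :
    ChainFibrant (n := n) (Fin.castSuccFunctor (n + 1) ⋙ Z) where
  zero i hi := h.zero i (by omega)
  last := by
    rw [isFibrant_iff_of_isTerminal (0 : _ ⟶ (0 : E)) HasZeroObject.zeroIsTerminal, fibration_iff,
      ← trivialCofibrations_rlp]
    intro A B a ha
    obtain ⟨_, _⟩ := (mem_trivialCofibrations_iff a).1 ha
    refine ⟨fun {u w} sq => ?_⟩
    obtain ⟨l, hl, -⟩ := h.lift n (by omega) a u 0 (hz.eq_of_tgt _ _) (fun h => by omega)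
    exact ⟨⟨⟨l, hl, (isZero_zero E).eq_of_tgt _ _⟩⟩⟩
  lift i hi A B a _ _ u b h1 h2 := h.lift i (by omega) a u b h1 (fun hi' => by
    rcases (Nat.lt_succ_iff.1 hi').eq_or_lt with h3 | h3
    · obtain rfl : n = i + 1 := by omega
      exact hz.eq_of_tgt _ _
    · exact h2 (by omega))

omit [HasZeroObject E] in
-- The factorization is made over the kernel of `w` rather than over `W`, so that the composite with
-- `w` stays zero and lifts exist exactly for cycles.
lemma exists_kernel_factorization {S W V : E} (s : S ⟶ W) (w : W ⟶ V) (h : s ≫ w = 0) :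
    ∃ (R : E) (i : S ⟶ R) (g : R ⟶ W), WeakEquivalence i ∧ i ≫ g = s ∧ g ≫ w = 0 ∧
      ∀ {A B : E} (a : A ⟶ B) [Cofibration a] [WeakEquivalence a] (u : A ⟶ R) (b : B ⟶ W),
        a ≫ b = u ≫ g → b ≫ w = 0 → ∃ l : B ⟶ R, a ≫ l = u ∧ l ≫ g = b := by
  let F := MorphismProperty.factorizationData (trivialCofibrations E) (fibrations E)
    (kernel.lift w s h)
  refine ⟨F.Z, F.i, F.p ≫ kernel.ι w, inferInstance, by simp [F], by simp, ?_⟩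
  intro A B a _ _ u b h1 h2
  have sq : CommSq u a F.p (kernel.lift w b h2) := ⟨by
    rw [← cancel_mono (kernel.ι w)]
    simp [h1]⟩
  have := ModelCategory.cm4a a F.p
  exact ⟨sq.lift, sq.fac_left, by rw [sq.fac_right_assoc, kernel.lift_ι]⟩

/-- A chain complex has a fibrant replacement, extended by a zero object. -/
lemma exists_chainFibrant {n : ℕ} (S : ComposableArrows E n) (hS : IsComplex S) :
    ∃ (Z : ComposableArrows E (n + 1)) (α : S ⟶ Fin.castSuccFunctor (n + 1) ⋙ Z),
      ChainFibrant Z ∧ IsZero (Z.obj' (n + 1)) ∧ ∀ i, WeakEquivalence (α.app i) := by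
  induction n with
  | zero =>
    obtain ⟨R, i, g, hi, -, -, hl⟩ := exists_kernel_factorization (0 : S.obj' 0 ⟶ (0 : E))
      (0 : (0 : E) ⟶ 0) comp_zero
    refine ⟨.mk₁ g, ComposableArrows.homMk₀ i,
      ⟨fun i hi => by omega, inferInstanceAs (IsFibrant (0 : E)), ?_⟩, isZero_zero E, ?_⟩
    · intro i hi A B a _ _ u b h1 _
      obtain rfl : i = 0 := by omega
      exact hl a u b h1 ((isZero_zero E).eq_of_tgt _ _)
    · rintro ⟨j, hj⟩
      obtain rfl : j = 0 := by omega
      exact hi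
  | succ n ih =>
    obtain ⟨Z, α, hZ, hz, hα⟩ := ih S.δ₀ (fun i hi => hS (i + 1) (by omega))
    -- The replacement is built from the end. For `n = 0` the next term is the added zero object;
    -- otherwise the relation is that of `S`, transported along `α`.
    have h0 : (S.map' 0 1 ≫ α.app 0) ≫ Z.map' 0 1 = 0 := by
      rcases n with _ | n
      · exact hz.eq_of_tgt _ _
      · have h1 := α.naturality (homOfLE (by simp) : (0 : Fin (n + 1 + 1)) ⟶ 1)
        have h2 := hS 0 (by omega)
        refine (Category.assoc _ _ _).trans ((congrArg (S.map' 0 1 ≫ ·) h1.symm).trans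
          ((Category.assoc _ _ _).symm.trans ((congrArg (· ≫ α.app 1) h2).trans zero_comp)))
    obtain ⟨R, i, g, hi, e1, e2, hl⟩ := exists_kernel_factorization _ _ h0
    refine ⟨Z.precomp g, ComposableArrows.homMkSucc i α e1.symm, ⟨?_, hZ.last, ?_⟩, hz, ?_⟩
    · intro j hj
      rcases j with _ | j
      · exact e2
      · exact hZ.zero j (by omega)
    · intro j hj A B a _ _ u b h1 h2
      rcases j with _ | j
      · exact hl a u b h1 (h2 (by omega))
      · exact hZ.lift j (by omega) a u b h1 (fun h => h2 (by omega))
    · rintro ⟨j, hj⟩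
      rcases j with _ | j
      · exact hi
      · exact hα ⟨j, by omega⟩

end ChainComplexes

/-! ### Comparison of a separation grid with the grids of strings -/

section OpValues

variable {C : Type u} [Category.{v} C] {D : GradedIdeal C}
variable {E : Type u₂} [Category.{v₂} E] [ModelCategory E] [HasZeroObject E] [HasZeroMorphisms E]
variable {H : Type u₃} [Category.{v₃} H] (L : E ⥤ H) [L.IsLocalization (weakEquivalences E)]
variable {I : Type (max u v)} [Finite I] {tgt : I → C} {k : ℕ} {Y : C ⥤ E} {hY : Pointed D Y}

/-- Entries are fibrant, so left homotopy is equality in the homotopy category. The null-homotopy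
required of `θ` itself is automatic, its target on the diagonal being contractible. -/
lemma SepGrid.isOpValue_iff (G : SepGrid D Y hY I tgt k) (hD : D.Reduced)
    (hfib : PointedReedyFibrant D Y hY) (htgt : ∀ e, D.deg (tgt e) = k) {X : E} [IsCofibrant X]
    {σ : ∀ e : I, X ⟶ Y.obj (tgt e)} {j : ℕ} (hj : j + 2 ≤ k)
    {κ : ∀ i : ℕ, X ⟶ G.at' i (k + 1)} {θ : X ⟶ G.at' (j + 1) (j + 2)} :
    (G.toPreGrid htgt).IsOpValue L σ j κ θ ↔ G.IsThread σ κ j ∧ G.IsValue j hj (κ j) θ := by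
  have hn : nodeDeg D k none = k + 1 := rfl
  have hF : ∀ i, 1 ≤ i → i ≤ j → IsFibrant (G.at' i (i + 1)) := fun i h h' =>
    G.isFibrant_entry hD hfib htgt none (by omega) (by omega) (by omega) (by omega)
  have : IsFibrant (G.at' (j + 1) (j + 1)) :=
    G.isFibrant_entry hD hfib htgt none (by omega) (by omega) (by omega) (by omega)
  constructor
  · intro h
    refine ⟨⟨h.start, h.lift, fun i hi h1 h2 => ?_⟩, h.value (by change j + 2 ≤ k + 1; omega), ?_⟩
    · have := hF i h1 h2
      exact (LeftHomotopyRel.iff_map_eq L _ _).2 (h.vanish i hi h1 h2)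
    · exact (LeftHomotopyRel.iff_map_eq L _ _).2
        (map_eq_of_contractible L (G.diag_contractible none (by omega)) _ _)
  · rintro ⟨h, h'⟩
    exact ⟨h.start, h.lift, fun i hi h1 h2 => map_eq_of_leftHomotopyRel L (h.vanish i hi h1 h2),
      fun _ => h'.1⟩

omit [Finite I] in
lemma SepGrid.Free.cofibrant {G : SepGrid D Y hY I tgt k} (hG : G.Free) (z : Option C) (j : ℕ)
    (h : j + 2 ≤ nodeDeg D k z) : IsCofibrant (entry (G.F z) (j + 1) (j + 1)) := by
  rcases h.lt_or_eq with h | h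
  · exact hG z j h
  · have h1 := G.last z (by omega)
    rw [← h] at h1
    exact (isCofibrant_iff_of_isInitial (0 : (0 : E) ⟶ _) HasZeroObject.zeroIsInitial).2
      (have : IsIso (0 : (0 : E) ⟶ entry (G.F z) (j + 1) (j + 1)) :=
        ⟨0, (isZero_zero E).eq_of_src _ _, h1.eq_of_src _ _⟩
      inferInstance)

end OpValues

/-! ### The zigzag from a separation grid to a Toda bracket -/

section Comparison

lemma comp_symm_trans_hom {H : Type u₃} [Category.{v₃} H] {X A B T T' : H} {a : X ⟶ A} {f : A ⟶ B}
    {t : X ⟶ T} {e : T ≅ B} {e' : T ≅ T'} {p : X ⟶ T'} (h : a ≫ f = t ≫ e.hom)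
    (h' : t ≫ e'.hom = p) : a ≫ f ≫ (e.symm ≪≫ e').hom = p := by
  rw [reassoc_of% h, Iso.trans_hom, Iso.symm_hom, e.hom_inv_id_assoc, h']

lemma exists_iso_of_weq {E : Type u₂} [Category.{v₂} E] [ModelCategory E] {H : Type u₃}
    [Category.{v₃} H] (L : E ⥤ H) [L.IsLocalization (weakEquivalences E)] {A B : E} (f : A ⟶ B)
    (hf : WeakEquivalence f) : ∃ e : L.obj A ≅ L.obj B, e.hom = L.map f :=
  have := isIso_map_of_weq L f
  ⟨asIso (L.map f), rfl⟩

variable {E : Type u₂} [Category.{v₂} E] [ModelCategory E] [HasZeroObject E] [HasZeroMorphisms E]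

lemma castSucc_restrictable (n : ℕ) :
    PreGrid.Restrictable (chainIdeal (n + 1)) (n + 1) (chainIdeal n) n
      (Fin.castSuccFunctor (n + 1)) where
  deg_le t := by
    simp only [chainIdeal, Fin.castSuccFunctor_obj, Fin.val_castSucc]
    omega
  le := by omega
  map {s t} f h h' := by
    simp only [chainIdeal, Fin.castSuccFunctor_obj, Fin.val_castSucc] at *
    omega

lemma castSucc_out_bijective (n : ℕ) (s : Fin (n + 1)) (hs : 1 ≤ (chainIdeal n).deg s) :
    Function.Bijective ((castSucc_restrictable n).out s) := by
  have h1 := chainIdeal_outOne_subsingleton n (some s)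
  have h2 := chainIdeal_outOne_subsingleton (n + 1) (some s.castSucc)
  have hs' : (s : ℕ) + 1 ≤ n := by
    simp only [chainIdeal] at hs
    omega
  exact ⟨fun a b _ => @Subsingleton.elim _ h1 a b, fun b =>
    ⟨⟨⟨⟨s + 1, by omega⟩, homOfLE (by simp [Fin.le_def])⟩, by simp only [chainIdeal]; omega⟩,
      @Subsingleton.elim _ h2 _ b⟩⟩

/-- A chain complex maps, by a weak equivalence, to the restriction of the grid of a longer one, in
which the horizontal maps of the last column are fibrations as well. -/
lemma exists_extended_grid {n : ℕ} (Z : Fin (n + 1) ⥤ E) (hZ : Pointed (chainIdeal n) Z) :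
    ∃ (Z' : Fin (n + 1) ⥤ E) (α : Z ⟶ Z')
      (B : PreGrid (chainIdeal n) (I := PUnit.{1}) (fun _ => 0) n Z'),
      (∀ t, WeakEquivalence (α.app t)) ∧ B.Full ∧
      ∀ (z : Option (Fin (n + 1))) (j : ℕ), j + 2 ≤ nodeDeg (chainIdeal n) n z →
        Fibration (hor (B.F z) (Nat.le_succ j) (j + 1)) := by
  -- The extra term raises the degree of every node by one, so a column that was leftmost now lies
  -- in the range where the horizontal maps are fibrations.
  obtain ⟨W, α, hW, -, hα⟩ := exists_chainFibrant Z ((isComplex_iff_pointed Z).2 hZ)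
  have hp : Pointed (chainIdeal (n + 1)) W := (isComplex_iff_pointed W).1 hW.zero
  have hf := hW.pointedReedyFibrant hp
  have hD := chainIdeal_reduced (n + 1)
  have htgt : ∀ _ : PUnit.{1}, (chainIdeal (n + 1)).deg 0 = n + 1 := fun _ => by simp [chainIdeal]
  obtain ⟨G, -⟩ := exists_free_sepGrid (I := PUnit.{1}) (tgt := fun _ => (0 : Fin (n + 2))) hp hD htgt
  let A : PreGrid (chainIdeal (n + 1)) (I := ULift.{0} PUnit.{1})
    (fun _ => (Fin.castSuccFunctor (n + 1)).obj 0) (n + 1) W :=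
    (G.toPreGrid htgt).comapHead (fun _ : ULift.{0} PUnit.{1} => PUnit.unit)
  have hA : A.Full := (G.toPreGrid_full hD hf htgt).comapHead
    ⟨fun _ _ _ => Subsingleton.elim _ _, fun _ => ⟨⟨PUnit.unit⟩, rfl⟩⟩
  refine ⟨_, α, A.comap (tgt' := fun _ => 0) (castSucc_restrictable n), hα,
    hA.comap (castSucc_restrictable n) (castSucc_out_bijective n), fun z j hj => ?_⟩
  refine G.fib _ j ?_
  cases z with
  | none =>
    simp only [nodeDeg, Option.map] at *
    omega
  | some s =>
    simp only [nodeDeg, Option.map, chainIdeal, Fin.castSuccFunctor_obj, Fin.val_castSucc] at *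
    omega

variable {H : Type u₃} [Category.{v₃} H] (L : E ⥤ H) [L.IsLocalization (weakEquivalences E)]
variable {J : Type u} [Category.{v} J] {D : PointedIndexing J} {x : J} {k : ℕ}
variable {Y : D.Bdry x k ⥤ E} {hY : Pointed (D.bdryIdeal x k) Y}

lemma TString.nodeDeg_eq {n : ℕ} (S : TString D x k n) (z : Option (Fin (n + 1))) :
    nodeDeg (D.bdryIdeal x k) k (z.map S.chain.obj) + n = nodeDeg (chainIdeal n) n z + k := by
  have := S.le
  cases z with
  | none =>
    simp only [nodeDeg, Option.map]
    omega
  | some s =>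
    have := S.deg_eq s
    change D.deg (S.chain.obj s).obj + n = n - (s : ℕ) + k
    omega

lemma xTop_deg (e : XTop D x k) : (D.bdryIdeal x k).deg e.1.1 = k := e.2.1

/-- The comparison of the grid of `x` with the Toda bracket of a string. -/
lemma exists_toda_component {j : ℕ} (G : GridAt Y hY) (hG : G.Free)
    (S : TString D x k (j + 2)) (T : TodaModel (S.chain ⋙ Y)) :
    ∃ (B : E) (φ : G.at' (j + 1) (j + 2) ⟶ B) (e : L.obj B ≅ L.obj (T.grid.at' (j + 1) (j + 2))),
      IsComponent (G.toPreGrid xTop_deg) (j + 1) none S.path.1 S.path.2 B φ ∧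
      ∀ (X : E) [IsCofibrant X] (σ : ∀ e : XTop D x k, X ⟶ Y.obj e.1.1)
        (κ : ∀ i : ℕ, X ⟶ G.at' i (k + 1)) (θ : X ⟶ G.at' (j + 1) (j + 2)),
        (G.toPreGrid xTop_deg).IsOpValue L σ j κ θ →
        ∃ ψ : X ⟶ T.grid.at' (j + 1) (j + 2),
          LeftHomotopyClass.mk ψ ∈ T.bracket (σ S.first) ∧
          L.map θ ≫ L.map φ ≫ e.hom = L.map ψ := by
  have hD := chainIdeal_reduced (j + 2)
  have htgt : ∀ _ : PUnit.{1}, (chainIdeal (j + 2)).deg 0 = j + 2 := fun _ => by simp [chainIdeal]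
  obtain ⟨Z', α, B, hα, hB, hBfib⟩ := exists_extended_grid T.Z T.pointed
  obtain ⟨T', hT'⟩ := exists_free_sepGrid (I := PUnit.{1}) (tgt := fun _ => (0 : Fin (j + 3)))
    T.pointed hD htgt
  have hTf := T.grid.toPreGrid_full hD T.fibrant htgt
  have hTf' := T'.toPreGrid_full hD T.fibrant htgt
  let A₀ : PreGrid (D.bdryIdeal x k) (I := ULift.{max u v} PUnit.{1})
    (fun _ => S.chain.obj 0) k Y :=
    (G.toPreGrid xTop_deg).comapHead (fun _ : ULift.{max u v} PUnit.{1} => S.first)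
  let A := A₀.comap (tgt' := fun _ : PUnit.{1} => 0) S.restrictable
  -- This is the projection to the string; it is not an equivalence, as `A` still carries all other
  -- factors.
  obtain ⟨Φ⟩ : Nonempty (GridMap A B (T.α ≫ α)) := by
    refine HigherOps.exists_gridMap hB.hasProducts (chainIdeal_famTgt_deg _) fun z i hi => Or.inr ?_
    have h1 := S.nodeDeg_eq z
    have h2 := S.le
    exact ⟨G.diag_contractible _ (by omega), hG.cofibrant _ _ (by omega), hBfib z i hi⟩
  -- A grid with cofibrant diagonals maps both to the extended grid and to the grid defining the
  -- bracket. In the leftmost column of the latter, where fibrations are lacking, the source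
  -- diagonal is zero.
  obtain ⟨Θ⟩ : Nonempty (GridMap (T'.toPreGrid htgt) B α) :=
    HigherOps.exists_gridMap hB.hasProducts (chainIdeal_famTgt_deg _) fun z i hi => Or.inr
      ⟨T'.diag_contractible _ hi, hT'.cofibrant _ _ hi, hBfib z i hi⟩
  obtain ⟨Ξ⟩ : Nonempty (GridMap (T'.toPreGrid htgt) (T.grid.toPreGrid htgt) (𝟙 T.Z)) :=
    HigherOps.exists_gridMap hTf.hasProducts (chainIdeal_famTgt_deg _) fun z i hi => by
      rcases hi.lt_or_eq with h | h
      · exact Or.inr ⟨T'.diag_contractible _ hi, hT'.cofibrant _ _ hi, T.grid.fib z i h⟩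
      · have h1 := T'.last z (by omega)
        rw [← h] at h1
        exact Or.inl h1
  have hΘ := Θ.weq (chainIdeal_famTgt_deg _) hTf' hB hα none
  have hΞ := Ξ.weq (chainIdeal_famTgt_deg _) hTf' hTf (fun _ => inferInstance) none
  have hv : ValidRow (nodeDeg (chainIdeal (j + 2)) (j + 2) none) (j + 1) (some (j + 2)) := by
    simp only [ValidRow, nodeDeg]
    omega
  obtain ⟨eΘ, h1⟩ := exists_iso_of_weq L _ (hΘ _ _ hv)
  obtain ⟨eΞ, h2⟩ := exists_iso_of_weq L _ (hΞ _ _ hv)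
  refine ⟨_, Φ.app none (j + 1) (some (j + 2)), eΘ.symm ≪≫ eΞ, ?_, ?_⟩
  · have h3 := Φ.isComponent hB (chainIdeal_famTgt_deg _) hBfib
      (chainIdeal_outOne_subsingleton _) (fun t => by
        have := T.weq t
        have := hα t
        rw [NatTrans.comp_app]
        infer_instance) (j + 1) none PUnit.unit
      (pathOf (chainIdeal (j + 2)) (𝟭 (Fin (j + 3))) (goodString_id (j + 2))) hv.2.2
    have h4 := IsComponent.of_comapHead (A := G.toPreGrid xTop_deg)
      (hd := fun _ : ULift.{max u v} PUnit.{1} => S.first) (e := ⟨PUnit.unit⟩)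
      (IsComponent.of_comap (A := A₀) (tgt' := fun _ : PUnit.{1} => 0) (h := S.restrictable)
        (e := PUnit.unit) h3)
    have h5 := OPath.map_pathOf S.restrictable (𝟭 (Fin (j + 3))) (goodString_id (j + 2)) S.good
    exact (congrArg (fun π : OPath (D.bdryIdeal x k) (j + 2) S.first.1.1 =>
      IsComponent (G.toPreGrid xTop_deg) (j + 1) none S.first π _
        (Φ.app none (j + 1) (some (j + 2)))) h5).mp h4
  · intro X _ σ κ θ h
    have hA : A.IsOpValue L (fun _ => σ S.first) j κ θ :=
      ⟨fun _ => h.start S.first, h.lift, h.vanish, h.value⟩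
    -- The value is pushed along `Φ`, lifted back along the equivalence `Θ`, and finally pushed
    -- along `Ξ` into the bracket.
    obtain ⟨κ', θ', h5, h6⟩ := (hA.push le_rfl Φ).exists_lift le_rfl Θ hTf' hB hΘ
      (fun _ => σ S.first ≫ T.α.app 0) (fun _ => Category.assoc _ _ _)
    have h7 := h5.push le_rfl Ξ
    have h8 : (T.grid.toPreGrid htgt).IsOpValue L (fun _ => σ S.first ≫ T.α.app 0) j
        (fun i => κ' i ≫ Ξ.app none i none) (θ' ≫ Ξ.app none (j + 1) (some (j + 2))) :=
      ⟨fun e => (h7.start e).trans (Category.comp_id _), h7.lift, h7.vanish, h7.value⟩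
    have h9 := (T.grid.isOpValue_iff L hD T.fibrant htgt le_rfl).1 h8
    refine ⟨_, ⟨_, h9.1, _, h9.2, rfl⟩, ?_⟩
    exact comp_symm_trans_hom (((L.map_comp _ _).symm.trans h6.symm).trans
      ((L.map_comp _ _).trans (congrArg (L.map θ' ≫ ·) h1.symm)))
      ((congrArg (L.map θ' ≫ ·) h2).trans (L.map_comp _ _).symm)

end Comparison

/-! ### The total operation and separated operations -/

section TotalOperation

variable {E : Type u₂} [Category.{v₂} E] [ModelCategory E] [HasZeroObject E] [HasZeroMorphisms E]

omit [HasZeroObject E] [HasZeroMorphisms E] in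
lemma IsProd.map_eq_iff {H : Type u₃} [Category.{v₃} H] (L : E ⥤ H)
    [L.IsLocalization (weakEquivalences E)] {ι : Type u₁} [Finite ι] {P : E} {B : ι → E}
    {p : ∀ i, P ⟶ B i} (h : IsProd p) (hB : ∀ i, IsFibrant (B i)) {X : E} (f g : X ⟶ P) :
    L.map f = L.map g ↔ ∀ i, L.map (f ≫ p i) = L.map (g ≫ p i) := by
  simp only [L.map_comp]
  exact ⟨fun h i => by rw [h], (h.localization L hB).hom_ext⟩

variable {H : Type u₃} [Category.{v₃} H] (L : E ⥤ H) [L.IsLocalization (weakEquivalences E)]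
variable {J : Type u} [Category.{v} J] {D : PointedIndexing J} {x : J} {k : ℕ}
variable {Y : D.Bdry x k ⥤ E} {hY : Pointed (D.bdryIdeal x k) Y} {X : E}

omit [ModelCategory E] [HasZeroObject E] in
lemma mono_forget [HasFiniteLimits E] (s : D.Bdry x k) : Mono (forget (D.bdryIdeal x k) Y s) := by
  unfold forget
  infer_instance

omit [HasZeroObject E] in
lemma mono_prodForget : Mono (prodForget Y) := by
  have := fun e : XTop D x k => mono_forget (Y := Y) e.1.1
  refine ⟨fun f g h => Pi.hom_ext _ _ fun e => ?_⟩
  rw [← cancel_mono (forget (D.bdryIdeal x k) Y e.1.1)]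
  simpa [prodForget] using h =≫ Pi.π _ e

/-- A composite from `x` to an object of degree below `k` lowers degree by at least two, hence is
null; the coordinates detect maps because `prodForget` is a monomorphism. -/
lemma PointwiseData.ρ_eq_zero (hD : D.FullyReduced) (hx : k < D.deg x) (d : PointwiseData Y X) :
    d.ρ = 0 := by
  have := mono_prodForget (Y := Y)
  rw [← cancel_mono (prodForget Y), zero_comp]
  refine Pi.hom_ext _ _ fun e => Pi.hom_ext _ _ fun f => ?_
  rw [Category.assoc, Category.assoc, d.ρ_forget, zero_comp, zero_comp]
  have h1 := f.2.1
  have h2 := e.2.1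
  exact d.low_null _ _ (hD _ (by
    change D.deg f.1.1.obj < D.deg e.1.1.obj at h1
    omega))

lemma isFibrant_F₂ (hY : Pointed (D.bdryIdeal x k) Y) (hD : (D.bdryIdeal x k).Reduced)
    (hfib : PointedReedyFibrant (D.bdryIdeal x k) Y hY) (Φ : DiagFactorization Y) :
    IsFibrant Φ.F₂ ∧ IsFibrant (∏ᶜ fun e : XTop D x k => redMatch (D.bdryIdeal x k) Y e.1.1) := by
  have h1 := (IsProd.pi fun e : XTop D x k => redMatch (D.bdryIdeal x k) Y e.1.1).isFibrant
    fun e => hfib.isFibrant_redMatch hD e.1.1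
  have := Φ.fib
  exact ⟨isFibrant_of_fibration (pullback.snd Φ.p (prodForget Y)), h1⟩

/-- The special value `η ≫ γ` projects to `ρ = 0` in the product of matching objects, while every
representative of the operation projects to `σtop ≫ prodMatch`. Conversely, a homotopy between these
two lifts along the fibration `F₂ ⟶ ∏ redMatch`, moving `η ≫ γ` to a representative. -/
lemma PointwiseData.totalVanishes_iff [IsCofibrant X] (hD : D.FullyReduced) (hx : k < D.deg x)
    (hfib : PointedReedyFibrant (D.bdryIdeal x k) Y hY) (d : PointwiseData Y X)
    (Φ : DiagFactorization Y) :
    d.TotalVanishes hY Φ ↔ L.map (d.σtop ≫ prodMatch Y hY) = L.map 0 := by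
  have hmono := mono_prodForget (Y := Y)
  have hF := isFibrant_F₂ hY (D.bdryIdeal_reduced hD x k) hfib Φ
  have := hF.1
  have := hF.2
  have hη : (d.η ≫ Φ.γ) ≫ pullback.snd _ _ = 0 := by
    rw [Category.assoc, DiagFactorization.γ, pullback.lift_snd, PointwiseData.η,
      pullback.lift_snd, d.ρ_eq_zero hD hx]
  constructor
  · rintro ⟨θ, h1, h2, -⟩
    rw [LeftHomotopyClass.mk_eq_mk_iff] at h1
    have h3 : θ ≫ pullback.snd _ _ = d.σtop ≫ prodMatch Y hY := by
      rw [← cancel_mono (prodForget Y), Category.assoc, ← pullback.condition, h2, Category.assoc]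
    rw [← h3, L.map_comp, map_eq_of_leftHomotopyRel L h1, ← L.map_comp, hη]
  · intro h
    have := Φ.fib
    obtain ⟨θ, h1, h2⟩ := exists_lift_of_fibration L (pullback.snd Φ.p (prodForget Y)) (d.η ≫ Φ.γ)
      (d.σtop ≫ prodMatch Y hY) (by rw [hη, h])
    refine ⟨θ, LeftHomotopyClass.sound h2.symm, ?_, ?_⟩
    · rw [pullback.condition, ← Category.assoc, h1, Category.assoc]
    · have h3 : (d.η ≫ Φ.γ) ≫ pullback.fst _ _ = d.σlow ≫ Φ.ι := by
        rw [Category.assoc, DiagFactorization.γ, pullback.lift_fst, PointwiseData.η,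
          pullback.lift_fst_assoc]
      rw [← h3]
      exact h2.symm.postcomp _

lemma map_eq_zero_iff_of_fac {A B : E} {a : X ⟶ A} {b : X ⟶ B} {u : A ⟶ B} (h : b = a ≫ u)
    (hu : IsIso u) : L.map b = L.map 0 ↔ L.map a = L.map 0 := by
  rw [← cancel_mono (L.map u), h, L.map_comp, map_zero_comp]

omit [HasZeroObject E] in
lemma PointwiseData.σtop_prodMatch_π {hY : Pointed (D.bdryIdeal x k) Y} (d : PointwiseData Y X)
    (e : XTop D x k) : (d.σtop ≫ prodMatch Y hY) ≫ Pi.π _ e =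
      d.top e ≫ matchMap (D.bdryIdeal x k) Y hY e.1.1 := by
  simp [PointwiseData.σtop, prodMatch]

/-- Row `k` of column `0` is the product of the matching objects, up to the isomorphisms `matIso`,
and the vertical map into it is the product of the matching maps. -/
lemma SepGrid.map_ver_eq_zero_iff {k : ℕ} {Y : D.Bdry x k ⥤ E} {hY : Pointed (D.bdryIdeal x k) Y}
    (hk : 2 ≤ k) (hD : (D.bdryIdeal x k).Reduced)
    (hfib : PointedReedyFibrant (D.bdryIdeal x k) Y hY) (G : GridAt Y hY) (d : PointwiseData Y X)
    (κ₀ : X ⟶ G.at' 0 (k + 1)) (hκ : ∀ e, κ₀ ≫ G.top none e = d.top e) :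
    L.map (κ₀ ≫ ver (G.F none) 0 (Nat.le_succ k)) = L.map 0 ↔
      L.map (d.σtop ≫ prodMatch Y hY) = L.map 0 := by
  obtain ⟨k, rfl⟩ := Nat.exists_eq_add_of_le' hk
  have h1 := G.row_isProd none (k + 1) (le_refl (k + 3))
  have h2 := IsProd.pi fun e : XTop D x (k + 2) => redMatch (D.bdryIdeal x (k + 2)) Y e.1.1
  rw [h2.map_eq_iff L (fun e => hfib.isFibrant_redMatch hD e.1.1),
    h1.map_eq_iff L (fun e => ?_)]
  · refine forall_congr' fun e => ?_
    have hdeg : (D.bdryIdeal x (k + 2)).deg e.1.1 = k + 2 := e.2.1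
    have h4 : 1 ≤ (D.bdryIdeal x (k + 2)).deg e.1.1 := by omega
    have h5 : k + 1 ≤ (D.bdryIdeal x (k + 2)).deg e.1.1 - 1 := by omega
    have h3 := G.top_ver none (k + 1) e le_rfl h4 h5
    have h6 := isIso_hor_of_eq (G.F (some e.1.1)) h5 (by omega) ((D.bdryIdeal x (k + 2)).deg e.1.1)
    have e1 := d.σtop_prodMatch_π (hY := hY) e
    have e2 : (κ₀ ≫ ver (G.F none) 0 (Nat.le_succ (k + 2))) ≫ G.row none (k + 1) e =
        ((d.σtop ≫ prodMatch Y hY) ≫ Pi.π _ e) ≫ (G.matIso e.1.1 h4).hom ≫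
          hor (G.F (some e.1.1)) h5 _ :=
      (Category.assoc _ _ _).trans ((congrArg (κ₀ ≫ ·) h3).trans
        ((Category.assoc _ _ _).symm.trans
          ((congrArg (· ≫ matchMap (D.bdryIdeal x (k + 2)) Y hY e.1.1 ≫ (G.matIso e.1.1 h4).hom ≫
            hor (G.F (some e.1.1)) h5 _) (hκ e)).trans ((Category.assoc _ _ _).symm.trans
              (congrArg (· ≫ (G.matIso e.1.1 h4).hom ≫ hor (G.F (some e.1.1)) h5 _) e1.symm)))))
    rw [zero_comp, zero_comp]
    exact map_eq_zero_iff_of_fac L e2 (@IsIso.comp_isIso _ _ _ _ _ _ _ inferInstance h6)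
  · have hdeg : (D.bdryIdeal x (k + 2)).deg e.1.1 = k + 2 := e.2.1
    exact G.isFibrant_entry hD hfib xTop_deg (some e.1.1) (by change _ < (D.bdryIdeal x (k + 2)).deg e.1.1; omega)
      (by change 1 ≤ (D.bdryIdeal x (k + 2)).deg e.1.1; omega)
      (by change k + 1 ≤ (D.bdryIdeal x (k + 2)).deg e.1.1; omega) le_rfl

/-- All separated operations vanish together because the last one controls them: a vanishing image
of `κ_{k-1}` projects to column `0`, and a null image there lifts back along a fibration. -/
lemma SepGrid.exists_thread_iff [IsCofibrant X] (hk : 2 ≤ k) (hD : (D.bdryIdeal x k).Reduced)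
    (hfib : PointedReedyFibrant (D.bdryIdeal x k) Y hY) (G : GridAt Y hY) (d : PointwiseData Y X) :
    (∃ κ : ∀ i : ℕ, X ⟶ G.at' i (k + 1), G.IsThread d.top κ (k - 1)) ↔
      L.map (d.σtop ≫ prodMatch Y hY) = L.map 0 := by
  have hn : nodeDeg (D.bdryIdeal x k) k none = k + 1 := rfl
  have hF : ∀ j i, j < k + 1 → 1 ≤ i → j ≤ i → i ≤ k + 1 → IsFibrant (G.at' j i) :=
    fun j i h h1 h2 h3 => G.isFibrant_entry hD hfib xTop_deg none h h1 h2 h3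
  constructor
  · rintro ⟨κ, h⟩
    rw [← G.map_ver_eq_zero_iff L hk hD hfib d (κ 0) h.start]
    have h1 : ∀ i, i ≤ k - 1 → κ i ≫ hor (G.F none) (Nat.zero_le i) (k + 1) = κ 0 := by
      intro i hi
      induction i with
      | zero => rw [hor_refl, Category.comp_id]
      | succ i ih =>
        rw [← hor_comp _ (Nat.zero_le i) (Nat.le_succ i), ← Category.assoc, h.lift i (by omega),
          ih (by omega)]
    have h2 := map_eq_of_leftHomotopyRel L (h.vanish (k - 1) (by omega) (by omega) le_rfl)
    have h3 : κ (k - 1) ≫ ver (G.F none) (k - 1) (Nat.le_succ k) ≫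
        hor (G.F none) (Nat.zero_le (k - 1)) k = κ 0 ≫ ver (G.F none) 0 (Nat.le_succ k) := by
      rw [← hor_ver, ← Category.assoc, h1 _ le_rfl]
    -- The row `k - 1 + 1` in the vanishing condition has to be identified with row `k`.
    have h4 : ∀ m (hm : m + 1 = k), L.map (κ m ≫ ver (G.F none) m (by omega : m + 1 ≤ k + 1)) =
        L.map 0 → L.map (κ m ≫ ver (G.F none) m (Nat.le_succ k)) = L.map 0 := by
      rintro m rfl h
      exact h
    rw [← h3, ← Category.assoc, L.map_comp, h4 (k - 1) (by omega) h2, map_zero_comp]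
  · intro h
    have htop := G.top_isProd none (Nat.le_add_left 1 k)
    obtain ⟨κ₀, h0⟩ : ∃ κ₀ : X ⟶ G.at' 0 (k + 1), ∀ e, κ₀ ≫ G.top none e = d.top e :=
      ⟨htop.lift d.top, htop.lift_fac d.top⟩
    rw [← G.map_ver_eq_zero_iff L hk hD hfib d κ₀ h0] at h
    have := G.fibration_hor none (Nat.zero_le (k - 1)) (i := k) (by omega) (by omega) (by omega)
    have := hF 0 k (by omega) (by omega) (by omega) (by omega)
    -- The zero map is deformed to a map `a` lying strictly over the image of `κ₀`; with `κ₀` it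
    -- defines `l` by the pullback rectangle. The thread consists of the horizontal images of `l`,
    -- and their images in lower rows factor through the null map `a`.
    obtain ⟨a, h1, h2⟩ := exists_lift_of_fibration L (hor (G.F none) (Nat.zero_le (k - 1)) k)
      (0 : X ⟶ G.at' (k - 1) k) (κ₀ ≫ ver (G.F none) 0 (Nat.le_succ k)) (by rw [zero_comp, h])
    have hp := G.rectangle none (Nat.zero_le (k - 1)) (Nat.le_succ k) (Nat.sub_le k 1) le_rfl
    let l := hp.lift κ₀ a h1.symm
    have hl : l ≫ hor (G.F none) (Nat.zero_le (k - 1)) (k + 1) = κ₀ := hp.lift_fst _ _ _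
    have hl' : l ≫ ver (G.F none) (k - 1) (Nat.le_succ k) = a := hp.lift_snd _ _ _
    refine ⟨fun i => if hi : i ≤ k - 1 then l ≫ hor (G.F none) hi (k + 1) else 0, fun e => ?_,
      fun i hi => ?_, fun i hi h3 h4 => ?_⟩
    · rw [dif_pos (Nat.zero_le _), hl]
      exact h0 e
    · rw [dif_pos (by omega), dif_pos (by omega), Category.assoc, hor_comp]
    · have := hF i (i + 1) (by omega) (by omega) (by omega) hi
      have h5 : i + 1 ≤ k := by omega
      rw [dif_pos h4, LeftHomotopyRel.iff_map_eq L, ← ver_comp _ i h5 (Nat.le_succ k),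
        Category.assoc, ← Category.assoc (hor _ _ _), hor_ver, Category.assoc, reassoc_of% hl',
        L.map_comp, ← map_eq_of_leftHomotopyRel L h2, map_zero_comp]

end TotalOperation

/-! ### Targets of Toda brackets -/

section TodaTargets

variable {E : Type u₂} [Category.{v₂} E] [ModelCategory E] [HasZeroObject E] [HasZeroMorphisms E]

omit [HasZeroObject E] [HasZeroMorphisms E] in
lemma WeakEqv.of_isIso {A B : E} (hA : IsFibrant A) (hB : IsFibrant B) (f : A ⟶ B)
    (hf : IsIso f) : WeakEqv A B :=
  WeakEqv.of_weq hA hB f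

/-- On a chain the products have one factor, so each step along the diagonal `F_z^{r,r+1}` is a
single looping. The induction moves to the next node as `r` decreases and ends with the term `r + 2`
degrees below `z`. -/
lemma SepGrid.weakEqv_iterate_loopObj {n : ℕ} {Y : Fin (n + 1) ⥤ E}
    {hY : Pointed (chainIdeal n) Y} (hfib : PointedReedyFibrant (chainIdeal n) Y hY)
    (G : SepGrid (chainIdeal n) Y hY PUnit.{1} (fun _ => 0) n) (r : ℕ)
    (z : Option (Fin (n + 1))) (e : Fam (chainIdeal n) PUnit.{1} z)
    (π : OPath (chainIdeal n) (r + 1) (famTgt (chainIdeal n) (fun _ => 0) z e))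
    (t : Fin (n + 1)) (ht : (chainIdeal n).deg t + (r + 2) = nodeDeg (chainIdeal n) n z) :
    WeakEqv (entry (G.F z) r (r + 1)) (loopObj^[r] (Y.obj t)) := by
  have hD := chainIdeal_reduced n
  have htgt : ∀ e : PUnit.{1}, (chainIdeal n).deg ((fun _ => 0) e : Fin (n + 1)) = n :=
    fun _ => by simp [chainIdeal]
  have hsub := chainIdeal_outOne_subsingleton n
  have hdeg := chainIdeal_famTgt_deg n z e
  have hn : nodeDeg (chainIdeal n) n (some (famTgt (chainIdeal n) (fun _ => 0) z e)) =
      (chainIdeal n).deg (famTgt (chainIdeal n) (fun _ => 0) z e) := rfl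
  induction r generalizing z with
  | zero =>
    have i1 := (G.row_isProd z 0 (by omega)).isIso_of_unique e fun _ => Subsingleton.elim _ _
    have i2 : IsIso (G.top (some (famTgt (chainIdeal n) (fun _ => 0) z e)) π.1) :=
      (G.top_isProd _ (by omega)).isIso_of_unique _ fun _ =>
        @Subsingleton.elim _ (hsub (some _)) _ _
    have h1 : (chainIdeal n).deg π.1.1.1 + 1 = _ := π.1.2.1
    obtain rfl : t = π.1.1.1 := by
      simp only [chainIdeal] at h1 ht hdeg
      have := t.2
      have := π.1.1.1.2
      simp only [nodeDeg] at *
      ext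
      omega
    have hF := G.isFibrant_entry hD hfib htgt z (j := 0) (i := 1) (by omega) le_rfl (by omega)
      (by omega)
    have hF' := G.isFibrant_entry hD hfib htgt
      (some (famTgt (chainIdeal n) (fun _ => 0) z e)) (j := 0)
      (i := (chainIdeal n).deg (famTgt (chainIdeal n) (fun _ => 0) z e)) (by omega) (by omega)
      (by omega) le_rfl
    exact (WeakEqv.of_isIso hF hF' (G.row z 0 e) i1).trans _ _ _
      (WeakEqv.of_isIso hF' (hfib.isFibrant hD _) _ i2)
  | succ r ih =>
    have hle : ∀ e' : Fam (chainIdeal n) PUnit.{1} z,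
        r + 1 ≤ (chainIdeal n).deg (famTgt (chainIdeal n) (fun _ => 0) z e') := fun e' => by
      have := chainIdeal_famTgt_deg n z e'
      omega
    have hq := IsProd.pi fun e : Fam (chainIdeal n) PUnit.{1} z =>
      entry (G.F (some (famTgt (chainIdeal n) (fun _ => 0) z e))) (r + 1) (r + 1)
    have hw := IsProd.pi fun e : Fam (chainIdeal n) PUnit.{1} z =>
      entry (G.F (some (famTgt (chainIdeal n) (fun _ => 0) z e))) r (r + 1)
    have h1 := G.hoPullback hD hfib htgt z (j := r) (by omega) hq hw hle
      (fun e => hq.lift_fac _ e) (fun e => hw.lift_fac _ e) (fun e => hw.lift_fac _ e)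
    have hF : ∀ e' : Fam (chainIdeal n) PUnit.{1} z, ∀ j ≤ r + 1,
        IsFibrant (entry (G.F (some (famTgt (chainIdeal n) (fun _ => 0) z e'))) j (r + 1)) :=
      fun e' j hj => by
        have h2 := chainIdeal_famTgt_deg n z e'
        have h3 : nodeDeg (chainIdeal n) n (some (famTgt (chainIdeal n) (fun _ => 0) z e')) =
          (chainIdeal n).deg (famTgt (chainIdeal n) (fun _ => 0) z e') := rfl
        exact G.isFibrant_entry hD hfib htgt _ (by omega) (by omega) hj (by omega)
    have i1 := hw.isIso_of_unique e fun _ => Subsingleton.elim _ _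
    rw [Function.iterate_succ_apply']
    refine IsWeakLoop.weakEqv ⟨_, _, _, _, _, _, h1, G.diag_contractible z (by omega),
      hq.contractible (fun e' => hF e' _ le_rfl) fun e' => G.diag_contractible _ ?_⟩
      ((WeakEqv.of_weq h1.fibrant_base (hF e r (by omega)) (Pi.π _ e)).trans _ _ _
        (ih _ π.1 π.2 (by omega) (chainIdeal_famTgt_deg n _ _) rfl))
    have h2 := chainIdeal_famTgt_deg n z e'
    change _ ≤ (chainIdeal n).deg (famTgt (chainIdeal n) (fun _ => 0) z e')
    omega

lemma TodaModel.nonempty_iso {H : Type u₃} [Category.{v₃} H] (L : E ⥤ H)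
    [L.IsLocalization (weakEquivalences E)] {j : ℕ} {S : Fin (j + 2 + 1) ⥤ E} (T : TodaModel S)
    (hS : IsFibrant (S.obj (Fin.last (j + 2)))) {A : E}
    (hA : IsIterLoopObject (j + 1) (S.obj (Fin.last (j + 2))) A) :
    Nonempty (L.obj (T.grid.at' (j + 1) (j + 2)) ≅ L.obj A) := by
  have h1 := T.grid.weakEqv_iterate_loopObj T.fibrant (j + 1) none PUnit.unit
    (pathOf _ (m := j + 2) (𝟭 (Fin (j + 2 + 1))) (goodString_id (j + 2))) (Fin.last (j + 2))
    (by simp [chainIdeal, nodeDeg])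
  have := T.weq (Fin.last (j + 2))
  have h2 := (WeakEqv.of_weq hS (T.fibrant.isFibrant (chainIdeal_reduced _) _)
    (T.α.app (Fin.last (j + 2)))).iterate_loopObj (j + 1) hS
  exact WeakEqv.nonempty_iso L ((hA.weakEqv hS).trans _ _ _ (h2.trans _ _ _ h1.symm)).symm

/-- The replacement is constructed with an added zero term, which is then dropped. -/
lemma exists_todaModel {n : ℕ} (S : Fin (n + 1) ⥤ E) (hS : Pointed (chainIdeal n) S) :
    Nonempty (TodaModel S) := by
  obtain ⟨Z, α, hZ, hz, hα⟩ := exists_chainFibrant S ((isComplex_iff_pointed S).2 hS)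
  have h1 := hZ.castSucc hz
  have hp : Pointed (chainIdeal n) _ := (isComplex_iff_pointed _).1 h1.zero
  obtain ⟨G, -⟩ := exists_free_sepGrid (I := PUnit.{1}) (tgt := fun _ => (0 : Fin (n + 1))) hp
    (chainIdeal_reduced n) (k := n) (fun _ => by simp [chainIdeal])
  exact ⟨⟨_, hp, h1.pointedReedyFibrant hp, α, hα, G⟩⟩

variable {J : Type u} [Category.{v} J] {D : PointedIndexing J} {x : J} {k : ℕ}
variable {Y : D.Bdry x k ⥤ E}

omit [ModelCategory E] [HasZeroObject E] in
lemma TString.pointed (hD : D.FullyReduced) (hY : Pointed (D.bdryIdeal x k) Y) {n : ℕ}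
    (S : TString D x k n) : Pointed (chainIdeal n) (S.chain ⋙ Y) := by
  intro p q f hf
  have hf' : (p : ℕ) + 2 ≤ q := hf
  have h1 := S.deg_eq p
  have h2 := S.deg_eq q
  exact hY _ (hD _ (by omega))

omit [HasZeroObject E] in
lemma exists_diagFactorization (Y : D.Bdry x k ⥤ E) : Nonempty (DiagFactorization Y) := by
  let F := MorphismProperty.factorizationData (trivialCofibrations E) (fibrations E) (genDiag Y)
  exact ⟨⟨F.Z, F.i, F.p, F.fac, inferInstance, inferInstance⟩⟩

end TodaTargets

/-! ### Decomposition of separated operations into Toda brackets -/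

section Decomposition

variable {E : Type u₂} [Category.{v₂} E] [ModelCategory E] [HasZeroObject E] [HasZeroMorphisms E]
variable {H : Type u₃} [Category.{v₃} H] (L : E ⥤ H) [L.IsLocalization (weakEquivalences E)]
variable {J : Type u} [Category.{v} J] {D : PointedIndexing J} {x : J} {k : ℕ}
variable {Y : D.Bdry x k ⥤ E} {hY : Pointed (D.bdryIdeal x k) Y}

/-- Any two grids of the same diagram are compared by extending the identity, provided that the
source has cofibrant diagonals. -/
lemma SepGrid.exists_comparison {C : Type u} [Category.{v} C] {D : GradedIdeal C}
    {I : Type (max u v)} [Finite I] {tgt : I → C} {k : ℕ} {Y : C ⥤ E} {hY : Pointed D Y}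
    (G' G : SepGrid D Y hY I tgt k) (hG' : G'.Free) (hD : D.Reduced)
    (hfib : PointedReedyFibrant D Y hY) (htgt : ∀ e, D.deg (tgt e) = k) :
    ∃ Ψ : GridMap (G'.toPreGrid htgt) (G.toPreGrid htgt) (𝟙 Y),
      ∀ z j ρ, ValidRow (nodeDeg D k z) j ρ → WeakEquivalence (Ψ.app z j ρ) := by
  have h := G.toPreGrid_full hD hfib htgt
  obtain ⟨Ψ⟩ : Nonempty (GridMap (G'.toPreGrid htgt) (G.toPreGrid htgt) (𝟙 Y)) :=
    HigherOps.exists_gridMap h.hasProducts (famTgt_deg htgt) fun z i hi => by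
      rcases hi.lt_or_eq with h | h
      · exact Or.inr ⟨G'.diag_contractible _ hi, hG'.cofibrant _ _ hi, G.fib z i h⟩
      · have h1 := G'.last z (by omega)
        rw [← h] at h1
        exact Or.inl h1
  exact ⟨Ψ, Ψ.weq (famTgt_deg htgt) (G'.toPreGrid_full hD hfib htgt) h fun _ => inferInstance⟩

lemma isProd_map_of_isComponent {j : ℕ} (hj : j + 2 ≤ k) (hD : (D.bdryIdeal x k).Reduced)
    (hfib : PointedReedyFibrant (D.bdryIdeal x k) Y hY) (G : GridAt Y hY)
    {B : TString D x k (j + 2) → E} {φ : ∀ S, G.at' (j + 1) (j + 2) ⟶ B S}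
    (h : ∀ S : TString D x k (j + 2),
      IsComponent (G.toPreGrid xTop_deg) (j + 1) none S.path.1 S.path.2 (B S) (φ S)) :
    IsProd fun S => L.map (φ S) := by
  let f := Equiv.ofBijective _ (TString.path_bijective (D := D) (x := x) (k := k) (n := j + 2))
  have h1 : ∀ p S, f S = p →
      IsComponent (G.toPreGrid xTop_deg) (j + 1) none p.1 p.2 (B S) (φ S) := by
    rintro _ S rfl
    exact h S
  have h2 := isWeakProd_of_isComponent G hD hfib xTop_deg (j + 1) none
    (by simp only [nodeDeg]; omega) (B := fun e π => B (f.symm ⟨e, π⟩))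
    (φ := fun e π => φ (f.symm ⟨e, π⟩)) fun e π => h1 ⟨e, π⟩ _ (f.apply_symm_apply _)
  have : Finite (Fam (D.bdryIdeal x k) (XTop D x k) none) := inferInstanceAs (Finite (XTop D x k))
  have h5 : ∀ e : XTop D x k, j + 1 ≤ (D.bdryIdeal x k).deg e.1.1 := fun e =>
    (by omega : j + 1 ≤ k).trans (xTop_deg e).ge
  have h3 := (h2.localization L fun p => IsComponent.isFibrant
    (A := G.toPreGrid xTop_deg) (z := none) h5 (h (f.symm p))).reindex f f.bijective
  have h4 : ∀ g : TString D x k (j + 2) → TString D x k (j + 2), g = id →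
      IsProd (fun S => L.map (φ (g S))) → IsProd fun S => L.map (φ S) := by
    rintro _ rfl h
    exact h
  exact h4 (fun S => f.symm (f S)) (funext f.symm_apply_apply) h3

omit [HasZeroObject E] [HasZeroMorphisms E] in
lemma exists_iso_of_map_comp_eq {A B : E} (f : A ⟶ B) (hf : WeakEquivalence f) :
    ∃ a : L.obj B ≅ L.obj A, ∀ {X : E} (u : X ⟶ A) (w : X ⟶ B),
      L.map (u ≫ f) = L.map w → L.map w ≫ a.hom = L.map u :=
  have := isIso_map_of_weq L f
  ⟨(asIso (L.map f)).symm, fun u w h => by simp [← h]⟩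

lemma exists_toda_decomposition {j : ℕ} (hj : j + 2 ≤ k) (hD : (D.bdryIdeal x k).Reduced)
    (hfib : PointedReedyFibrant (D.bdryIdeal x k) Y hY) (G : GridAt Y hY)
    (T : ∀ S : TString D x k (j + 2), TodaModel (S.chain ⋙ Y)) :
    ∃ c : ∀ S : TString D x k (j + 2),
        L.obj (G.at' (j + 1) (j + 2)) ⟶ L.obj ((T S).grid.at' (j + 1) (j + 2)),
      IsProd c ∧
      ∀ (X : E) [IsCofibrant X] (σ : ∀ e : XTop D x k, X ⟶ Y.obj e.1.1)
        (κ : ∀ i : ℕ, X ⟶ G.at' i (k + 1)) (θ : X ⟶ G.at' (j + 1) (j + 2)),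
        G.IsThread σ κ j → G.IsValue j hj (κ j) θ → ∀ S : TString D x k (j + 2),
          ∃ ψ : X ⟶ (T S).grid.at' (j + 1) (j + 2),
            LeftHomotopyClass.mk ψ ∈ (T S).bracket (σ S.first) ∧ L.map θ ≫ c S = L.map ψ := by
  -- The diagonals of `G` need not be cofibrant, so the comparison with the strings is made for `G'`
  -- and transported to `G`.
  obtain ⟨G', hG'⟩ := exists_free_sepGrid hY hD (xTop_deg (D := D) (x := x) (k := k))
  obtain ⟨Ψ, hΨ⟩ := SepGrid.exists_comparison G' G hG' hD hfib xTop_deg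
  choose B φ e hc hv using fun S => exists_toda_component L G' hG' S (T S)
  obtain ⟨a, ha⟩ : ∃ a : L.obj (G.at' (j + 1) (j + 2)) ≅ L.obj (G'.at' (j + 1) (j + 2)),
      ∀ {X : E} (u : X ⟶ G'.at' (j + 1) (j + 2)) (w : X ⟶ G.at' (j + 1) (j + 2)),
        L.map (u ≫ Ψ.app none (j + 1) (some (j + 2))) = L.map w → L.map w ≫ a.hom = L.map u :=
    exists_iso_of_map_comp_eq L _ (hΨ none (j + 1) (some (j + 2)) (by
      simp only [ValidRow, nodeDeg]
      omega))
  refine ⟨fun S => a.hom ≫ L.map (φ S) ≫ (e S).hom,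
    ((isProd_map_of_isComponent L hj hD hfib G' hc).iso_comp fun S => (e S).hom).comp_iso a.hom, ?_⟩
  intro X _ σ κ θ h h' S
  obtain ⟨κ', θ', h1, h2⟩ := ((G.isOpValue_iff L hD hfib xTop_deg hj).2 ⟨h, h'⟩).exists_lift hj Ψ
    (G'.toPreGrid_full hD hfib xTop_deg) (G.toPreGrid_full hD hfib xTop_deg) (hΨ none) σ
    (fun _ => Category.comp_id _)
  obtain ⟨ψ, h3, h4⟩ := hv S X σ κ' θ' h1
  exact ⟨ψ, h3, (Category.assoc _ _ _).symm.trans ((congrArg (· ≫ _) (ha θ' θ h2)).trans h4)⟩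

/-- A map vanishes if and only if its factors do, because zero in the homotopy category is
compatible with arbitrary projections, even those not represented by maps of `E`. -/
lemma IsProd.leftHomotopyRel_zero_iff {ι : Type u₁} {A : E} {B : ι → E}
    {c : ∀ i, L.obj A ⟶ L.obj (B i)} (h : IsProd c) {X : E} [IsCofibrant X] [IsFibrant A]
    (θ : X ⟶ A) : LeftHomotopyRel θ 0 ↔ ∀ i, L.map θ ≫ c i = L.map 0 := by
  rw [LeftHomotopyRel.iff_map_eq L]
  exact ⟨fun h' i => by rw [h', map_zero_comp],
    fun h' => h.hom_ext fun i => by rw [h', map_zero_comp]⟩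

end Decomposition

end HigherOps

end

/-! ### Assembly of the decomposition -/

theorem mainTheorem7 {J : Type u} [Category.{v} J] (D : HigherOps.PointedIndexing J)
    (hD : D.FullyReduced)
    {E : Type u₂} [Category.{v₂} E] [ModelCategory E] [HasZeroObject E] [HasZeroMorphisms E]
    {H : Type u₃} [Category.{v₃} H] (L : E ⥤ H) [L.IsLocalization (weakEquivalences E)]
    (x : J) (k : ℕ) (hk : 2 ≤ k) (hx : k < D.deg x)
    (Y : D.Bdry x k ⥤ E) (hY : HigherOps.Pointed (D.bdryIdeal x k) Y)
    (hfib : HigherOps.PointedReedyFibrant (D.bdryIdeal x k) Y hY) :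
    Nonempty (HigherOps.DiagFactorization Y) ∧
    Nonempty (HigherOps.GridAt Y hY) ∧
    (∀ (j : ℕ) (S : HigherOps.TString D x k (j + 2)),
      Nonempty (HigherOps.TodaModel (S.chain ⋙ Y)) ∧ j + 2 ≤ D.deg (S.chain.obj 0).obj) ∧
    ∀ (G : HigherOps.GridAt Y hY)
      (T : ∀ (j : ℕ) (S : HigherOps.TString D x k (j + 2)), HigherOps.TodaModel (S.chain ⋙ Y))
      (Ω : ∀ j : ℕ, HigherOps.TString D x k (j + 2) → E),
      (∀ j S, HigherOps.IsIterLoopObject (j + 1) (Y.obj (S.chain.obj (Fin.last (j + 2)))) (Ω j S)) →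
      ∃ (ω : ∀ (j : ℕ) (S : HigherOps.TString D x k (j + 2)),
          L.obj ((T j S).grid.at' (j + 1) (j + 2)) ≅ L.obj (Ω j S))
        (c : ∀ (j : ℕ) (S : HigherOps.TString D x k (j + 2)),
          L.obj (G.at' (j + 1) (j + 2)) ⟶ L.obj (Ω j S)),
        (∀ j : ℕ, j + 2 ≤ k →
          Nonempty (IsLimit (Fan.mk (L.obj (G.at' (j + 1) (j + 2))) (c j)))) ∧
        ∀ (X : E) [IsCofibrant X] (d : HigherOps.PointwiseData Y X),
          (∀ (j : ℕ) (hj : j + 2 ≤ k) (κ : ∀ i : ℕ, X ⟶ G.at' i (k + 1)),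
            G.IsThread d.top κ j →
            ∀ θ : X ⟶ G.at' (j + 1) (j + 2), G.IsValue j hj (κ j) θ →
              (∀ S : HigherOps.TString D x k (j + 2), ∃ ψ : X ⟶ (T j S).grid.at' (j + 1) (j + 2),
                LeftHomotopyClass.mk ψ ∈ (T j S).bracket (d.top S.first) ∧
                  L.map θ ≫ c j S = L.map ψ ≫ (ω j S).hom) ∧
              (LeftHomotopyRel θ 0 ↔
                ∀ S : HigherOps.TString D x k (j + 2),
                  L.map θ ≫ c j S = L.map (0 : X ⟶ Ω j S))) ∧
          ∀ Φ : HigherOps.DiagFactorization Y,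
            List.TFAE [
              d.TotalVanishes hY Φ,
              ∃ κ : ∀ i : ℕ, X ⟶ G.at' i (k + 1), G.IsThread d.top κ (k - 1),
              ∃ κ : ∀ i : ℕ, X ⟶ G.at' i (k + 1),
                (∀ e, κ 0 ≫ G.top none e = d.top e) ∧
                ∀ (j : ℕ) (hj : j + 2 ≤ k),
                  κ (j + 1) ≫ HigherOps.hor (G.F none) (Nat.le_succ j) (k + 1) = κ j ∧
                  ∀ S : HigherOps.TString D x k (j + 2),
                    L.map (κ (j + 1) ≫ HigherOps.ver (G.F none) (j + 1)
                        (Nat.le_succ_of_le hj : j + 2 ≤ k + 1)) ≫ c j S =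
                      L.map (0 : X ⟶ Ω j S)] := by
  have hR := D.bdryIdeal_reduced hD x k
  refine ⟨HigherOps.exists_diagFactorization Y, ?_, fun j S => ⟨?_, ?_⟩, ?_⟩
  · obtain ⟨G, -⟩ := HigherOps.exists_free_sepGrid hY hR
      (HigherOps.xTop_deg (D := D) (x := x) (k := k))
    exact ⟨G⟩
  · exact HigherOps.exists_todaModel _ (S.pointed hD hY)
  · have h1 := S.le
    have h2 := S.deg_eq 0
    rw [Fin.val_zero] at h2
    omega
  intro G T Ω hΩ
  -- These isomorphisms and the projections below are chosen before `X` and the data at `x`, so they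
  -- serve all data at once.
  have hω : ∀ j S, Nonempty (L.obj ((T j S).grid.at' (j + 1) (j + 2)) ≅ L.obj (Ω j S)) :=
    fun j S => (T j S).nonempty_iso L (hfib.isFibrant hR _) (hΩ j S)
  let ω := fun j S => (hω j S).some
  have hc : ∀ j, ∃ c : ∀ S : HigherOps.TString D x k (j + 2),
      L.obj (G.at' (j + 1) (j + 2)) ⟶ L.obj ((T j S).grid.at' (j + 1) (j + 2)),
      ∀ hj : j + 2 ≤ k, HigherOps.IsProd c ∧
      ∀ (X : E) [IsCofibrant X] (σ : ∀ e : HigherOps.XTop D x k, X ⟶ Y.obj e.1.1)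
        (κ : ∀ i : ℕ, X ⟶ G.at' i (k + 1)) (θ : X ⟶ G.at' (j + 1) (j + 2)),
        G.IsThread σ κ j → G.IsValue j hj (κ j) θ → ∀ S : HigherOps.TString D x k (j + 2),
          ∃ ψ : X ⟶ (T j S).grid.at' (j + 1) (j + 2),
            LeftHomotopyClass.mk ψ ∈ (T j S).bracket (σ S.first) ∧
              L.map θ ≫ c S = L.map ψ := by
    intro j
    by_cases hj : j + 2 ≤ k
    · obtain ⟨c, h⟩ := HigherOps.exists_toda_decomposition L hj hR hfib G (T j)
      exact ⟨c, fun _ => h⟩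
    -- There are no strings of order larger than `k`.
    · exact ⟨fun S => absurd S.le hj, fun h => absurd h hj⟩
  choose c hc using hc
  have hprod : ∀ j, j + 2 ≤ k → HigherOps.IsProd fun S => c j S ≫ (ω j S).hom :=
    fun j hj => (hc j hj).1.iso_comp fun S => (ω j S).hom
  have hF : ∀ j, j + 2 ≤ k → IsFibrant (G.at' (j + 1) (j + 2)) := fun j hj =>
    G.isFibrant_entry hR hfib HigherOps.xTop_deg none (by change _ < k + 1; omega) (by omega)
      (by omega) (by change _ ≤ k + 1; omega)
  have hzero : ∀ {X : E} [IsCofibrant X] (j : ℕ), j + 2 ≤ k → ∀ θ : X ⟶ G.at' (j + 1) (j + 2),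
      LeftHomotopyRel θ 0 ↔ ∀ S : HigherOps.TString D x k (j + 2),
        L.map θ ≫ c j S ≫ (ω j S).hom = L.map (0 : X ⟶ Ω j S) := fun {X} _ j hj θ => by
    have := hF j hj
    exact (hprod j hj).leftHomotopyRel_zero_iff L θ
  refine ⟨ω, fun j S => c j S ≫ (ω j S).hom, hprod, fun X _ d => ⟨?_, fun Φ => ?_⟩⟩
  · intro j hj κ hκ θ hθ
    refine ⟨fun S => ?_, hzero j hj θ⟩
    obtain ⟨ψ, h1, h2⟩ := (hc j hj).2 X d.top κ θ hκ hθ S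
    exact ⟨ψ, h1, by rw [← h2, Category.assoc]⟩
  · have h12 := (d.totalVanishes_iff L hD hx hfib Φ).trans
      (G.exists_thread_iff L hk hR hfib d).symm
    have h23 : (∃ κ : ∀ i : ℕ, X ⟶ G.at' i (k + 1), G.IsThread d.top κ (k - 1)) ↔
        ∃ κ : ∀ i : ℕ, X ⟶ G.at' i (k + 1), (∀ e, κ 0 ≫ G.top none e = d.top e) ∧
          ∀ (j : ℕ) (hj : j + 2 ≤ k),
            κ (j + 1) ≫ HigherOps.hor (G.F none) (Nat.le_succ j) (k + 1) = κ j ∧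
            ∀ S : HigherOps.TString D x k (j + 2),
              L.map (κ (j + 1) ≫ HigherOps.ver (G.F none) (j + 1)
                (Nat.le_succ_of_le hj : j + 2 ≤ k + 1)) ≫ c j S ≫ (ω j S).hom =
                  L.map (0 : X ⟶ Ω j S) := by
      -- The same sequence serves both conditions. Vanishing is required from index `1` on, which
      -- accounts for the shift between `κ (j + 1)` and the order `j + 2`.
      refine exists_congr fun κ => ⟨fun h => ⟨h.start, fun j hj => ⟨h.lift j (by omega),
        (hzero j hj _).1 (h.vanish (j + 1) (by omega) (by omega) (by omega))⟩⟩,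
        fun h => ⟨h.1, fun j hj => (h.2 j (by omega)).1, fun j hj h1 h2 => ?_⟩⟩
      obtain ⟨j, rfl⟩ := Nat.exists_eq_add_of_le' h1
      exact (hzero j (by omega) _).2 (h.2 j (by omega)).2
    tfae_have 1 ↔ 2 := h12
    tfae_have 2 ↔ 3 := h23
    tfae_finish
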